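/- **Conventions.** Double categories are pseudo double categories: objects, vertical morphisms $f\colon A\to C$ (strict composition $\circ$), horizontal morphisms $J\colon A\nrightarrow B$ (composition $\odot$ in diagrammatic order, units $1_A$, associative and unital up to coherent invertible cells), and square cells with horizontal source and target and left and right vertical sides. $V(\mathcal K)$ is the vertical $2$-category, whose $2$-cells $f\Rightarrow g$ are the cells $1_A\Rightarrow 1_C$ with left side $f$ and right side $g$. A cell $\phi\colon J\Rightarrow L$ with sides $f,g$ is *cartesian* if every cell with target $L$ and sides $f\circ h$, $g\circ k$ factors uniquely through $\phi$; then $J=L(f,g)$ is the restriction of $L$. $\mathcal K$ is an *equipment* if all restrictions exist. The *companion* of $f\colon A\to C$ is $f_*=1_C(f,\mathrm{id}_C)\colon A\nrightarrow C$; the unit cell $1_f$ factors through its cartesian cell as the corresponding (opcartesian) cell $1_A\Rightarrow f_*$. The morphism $f$ is *full and faithful* if $1_f$ is cartesian. A cell $\eta\colon J\Rightarrow 1_M$ with sides $d,l$ (where $J\colon A\nrightarrow B$) defines $l$ as the *left Kan extension* of $d$ along $J$ if every cell $J\Rightarrow 1_M$ with sides $d,k$ factors uniquely as $\eta\odot\psi$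 with $\psi\colon l\Rightarrow k$ vertical; it defines $l$ as the *pointwise* left Kan extension if, for each $H\colon B\nrightarrow C$, every cell $J\odot H\Rightarrow 1_M$ with sides $d,k$ factors uniquely as $\eta\odot\psi$ with $\psi\colon H\Rightarrow 1_M$ having sides $l,k$. A morphism $\mathsf y_M\colon M\to\widehat M$ is a *yoneda embedding* if (i) for every $J\colon M\nrightarrow B$ there exist $g\colon B\to\widehat M$ and a cartesian cell $J\Rightarrow 1_{\widehat M}$ with sides $\mathsf y_M,g$; and (ii) every cartesian cell $J\Rightarrow1_{\widehat M}$ with sides $\mathsf y_M,l$ defines $l$ as the pointwise left Kan extension of $\mathsf y_M$ along $J$. A *normal lax double monad* $T=(T,\mu,\iota)$ consists of a lax double functor $T\colon\mathcal K\to\mathcal K$ whose unitor cells are identities and double transformations $\mu\colon T^2\to T$, $\iota\colon\mathrm{id}\to T$ satisfying the monad axioms; it restricts to a $2$-monad on $V(\mathcal K)$. That $2$-monad is *colax-idempotent* if every morphism $f\colon A\to C$ between strict $T$-algebras $(A,a)$, $(C,c)$ admits a unique colax $T$-morphism structure $\bar f\colon f\circ a\Rightarrow c\circ Tf$. For $J\colon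 A\nrightarrow B$ let $\iota_{J*}\colon J\odot\iota_{B*}\Rightarrow\iota_{A*}\odot TJ$ be the horizontal cell obtained as the horizontal composite of the opcartesian cell of $\iota_{A*}$, the component $\iota_J\colon J\Rightarrow TJ$, and the cartesian cell of $\iota_{B*}$; $\iota_J$ satisfies the *right Beck–Chevalley condition* if $\iota_{J*}$ is invertible. **Theorem.** Let $T=(T,\mu,\iota)$ be a normal lax double monad on an equipment $\mathcal K$ that restricts to a colax-idempotent $2$-monad on $V(\mathcal K)$. Let $\mathsf y_M\colon M\to\widehat M$ be a yoneda embedding, $d\colon A\to\widehat M$ and $j\colon A\to B$ morphisms, and let $D=\widehat M(\mathsf y_M,d)\colon M\nrightarrow A$ denote the restriction of $1_{\widehat M}$ along $\mathsf y_M$ and $d$. Let the cell $\eta\colon j_*\Rightarrow 1_{\widehat M}$, with sides $d$ and $l$, define $l\colon B\to\widehat M$ as the pointwise left Kan extension of $d$ along the companion $j_*$ of $j$, and let $(b,\bar b,\hat b)$ and $(w,\bar w,\hat w)$ be pseudo $T$-algebra structures on $B$ and $\widehat M$. Then $l$ admits a unique colax $T$-morphism structure cell $\bar l\colon l\circ b\Rightarrow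 w\circ Tl$, and: 1. if $\iota_D$ satisfies the right Beck–Chevalley condition and the composite $1_w\circ T\eta$ defines $w\circ Tl$ as the left Kan extension of $w\circ Td$ along $T(j_*)$, then $\bar l$ is invertible; 2. conversely, if $j$ is full and faithful and $\bar l$ is invertible, then $\iota_D$ satisfies the right Beck–Chevalley condition and $1_w\circ T\eta$ defines $w\circ Tl$ as the left Kan extension of $w\circ Td$ along $T(j_*)$. -/

import Mathlib

open CategoryTheory

universe w x v u w₁ x₁ v₁ u₁ w₂ x₂ v₂ u₂ w₃ x₃ v₃ u₃

/-- A (pseudo) double category. The objects and the vertical morphisms form the underlying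
category; `Hor A B` is the type of horizontal morphisms `A ⇸ B`, and `Cell J f g L` is the type of
cells with horizontal source `J`, vertical source `f` (drawn on the left), vertical target `g`
(drawn on the right) and horizontal target `L`.  Vertical composition is strictly associative and
unital, horizontal composition (written in diagrammatic order) only up to the coherent invertible
cells `associator`, `lunit` and `runit`.

The vertical composite `vcomp φ ψ hl hr` is allowed to have any vertical morphisms that are
*equal* to the composites of those of `φ` and `ψ`, so that the strict laws can be stated as
honest equations. -/
class DoubleCategory (K : Type u) extends Category.{v} K where
  /-- horizontal morphisms -/
  Hor : K → K → Type w
  /-- cells -/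
  Cell {A B C D : K} (J : Hor A B) (f : A ⟶ C) (g : B ⟶ D) (L : Hor C D) : Type x
  /-- the identity cell of a horizontal morphism -/
  vid {A B : K} (J : Hor A B) : Cell J (𝟙 A) (𝟙 B) J
  /-- vertical composition of cells -/
  vcomp {A B C D E F : K} {J : Hor A B} {L : Hor C D} {N : Hor E F}
    {f : A ⟶ C} {g : B ⟶ D} {h : C ⟶ E} {k : D ⟶ F} {p : A ⟶ E} {q : B ⟶ F}
    (φ : Cell J f g L) (ψ : Cell L h k N) (hl : f ≫ h = p) (hr : g ≫ k = q) : Cell J p q N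
  vid_vcomp {A B C D : K} {J : Hor A B} {L : Hor C D} {f : A ⟶ C} {g : B ⟶ D}
    (φ : Cell J f g L) : vcomp (vid J) φ (Category.id_comp f) (Category.id_comp g) = φ
  vcomp_vid {A B C D : K} {J : Hor A B} {L : Hor C D} {f : A ⟶ C} {g : B ⟶ D}
    (φ : Cell J f g L) : vcomp φ (vid L) (Category.comp_id f) (Category.comp_id g) = φ
  vcomp_assoc {A B C D E F X Y : K} {J : Hor A B} {L : Hor C D} {N : Hor E F} {P : Hor X Y}
    {f : A ⟶ C} {g : B ⟶ D} {h : C ⟶ E} {k : D ⟶ F} {m : E ⟶ X} {n : F ⟶ Y}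
    (φ : Cell J f g L) (ψ : Cell L h k N) (χ : Cell N m n P) :
    vcomp (vcomp φ ψ rfl rfl) χ rfl rfl =
      vcomp φ (vcomp ψ χ rfl rfl) (Category.assoc f h m).symm (Category.assoc g k n).symm
  /-- the horizontal unit `1_A` -/
  unit (A : K) : Hor A A
  /-- the unit cell `1_f` of a vertical morphism -/
  unitCell {A C : K} (f : A ⟶ C) : Cell (unit A) f f (unit C)
  unitCell_id (A : K) : unitCell (𝟙 A) = vid (unit A)
  unitCell_comp {A C E : K} (f : A ⟶ C) (h : C ⟶ E) :
    vcomp (unitCell f) (unitCell h) rfl rfl = unitCell (f ≫ h)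
  /-- horizontal composition of horizontal morphisms -/
  compHor {A B C : K} (J : Hor A B) (H : Hor B C) : Hor A C
  /-- horizontal composition of cells -/
  hcomp {A B C D E F : K} {J : Hor A B} {H : Hor B C} {L : Hor D E} {N : Hor E F}
    {f : A ⟶ D} {g : B ⟶ E} {h : C ⟶ F} (φ : Cell J f g L) (ψ : Cell H g h N) :
    Cell (compHor J H) f h (compHor L N)
  hcomp_vid {A B C : K} (J : Hor A B) (H : Hor B C) : hcomp (vid J) (vid H) = vid (compHor J H)
  interchange {A B C D E F X Y Z : K} {J : Hor A B} {H : Hor B C} {L : Hor D E} {N : Hor E F}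
    {P : Hor X Y} {Q : Hor Y Z} {f : A ⟶ D} {g : B ⟶ E} {h : C ⟶ F}
    {f' : D ⟶ X} {g' : E ⟶ Y} {h' : F ⟶ Z}
    (φ : Cell J f g L) (ψ : Cell H g h N) (φ' : Cell L f' g' P) (ψ' : Cell N g' h' Q) :
    hcomp (vcomp φ φ' rfl rfl) (vcomp ψ ψ' rfl rfl) = vcomp (hcomp φ ψ) (hcomp φ' ψ') rfl rfl
  /-- the associator cells -/
  associator {A B C D : K} (J : Hor A B) (H : Hor B C) (L : Hor C D) :
    Cell (compHor (compHor J H) L) (𝟙 A) (𝟙 D) (compHor J (compHor H L))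
  associatorInv {A B C D : K} (J : Hor A B) (H : Hor B C) (L : Hor C D) :
    Cell (compHor J (compHor H L)) (𝟙 A) (𝟙 D) (compHor (compHor J H) L)
  associator_associatorInv {A B C D : K} (J : Hor A B) (H : Hor B C) (L : Hor C D) :
    vcomp (associator J H L) (associatorInv J H L) (Category.id_comp _) (Category.id_comp _) = vid _
  associatorInv_associator {A B C D : K} (J : Hor A B) (H : Hor B C) (L : Hor C D) :
    vcomp (associatorInv J H L) (associator J H L) (Category.id_comp _) (Category.id_comp _) = vid _
  associator_naturality {A B C D A' B' C' D' : K} {J : Hor A B} {H : Hor B C} {L : Hor C D}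
    {J' : Hor A' B'} {H' : Hor B' C'} {L' : Hor C' D'}
    {f : A ⟶ A'} {g : B ⟶ B'} {h : C ⟶ C'} {k : D ⟶ D'}
    (φ : Cell J f g J') (ψ : Cell H g h H') (χ : Cell L h k L') :
    vcomp (hcomp (hcomp φ ψ) χ) (associator J' H' L') (Category.comp_id f) (Category.comp_id k) =
      vcomp (associator J H L) (hcomp φ (hcomp ψ χ)) (Category.id_comp f) (Category.id_comp k)
  /-- the left unitor cells `𝔩` -/
  lunit {A B : K} (J : Hor A B) : Cell (compHor (unit A) J) (𝟙 A) (𝟙 B) J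
  lunitInv {A B : K} (J : Hor A B) : Cell J (𝟙 A) (𝟙 B) (compHor (unit A) J)
  lunit_lunitInv {A B : K} (J : Hor A B) :
    vcomp (lunit J) (lunitInv J) (Category.id_comp _) (Category.id_comp _) = vid _
  lunitInv_lunit {A B : K} (J : Hor A B) :
    vcomp (lunitInv J) (lunit J) (Category.id_comp _) (Category.id_comp _) = vid _
  lunit_naturality {A B C D : K} {J : Hor A B} {L : Hor C D} {f : A ⟶ C} {g : B ⟶ D}
    (φ : Cell J f g L) :
    vcomp (hcomp (unitCell f) φ) (lunit L) (Category.comp_id f) (Category.comp_id g) =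
      vcomp (lunit J) φ (Category.id_comp f) (Category.id_comp g)
  /-- the right unitor cells `𝔯` -/
  runit {A B : K} (J : Hor A B) : Cell (compHor J (unit B)) (𝟙 A) (𝟙 B) J
  runitInv {A B : K} (J : Hor A B) : Cell J (𝟙 A) (𝟙 B) (compHor J (unit B))
  runit_runitInv {A B : K} (J : Hor A B) :
    vcomp (runit J) (runitInv J) (Category.id_comp _) (Category.id_comp _) = vid _
  runitInv_runit {A B : K} (J : Hor A B) :
    vcomp (runitInv J) (runit J) (Category.id_comp _) (Category.id_comp _) = vid _
  runit_naturality {A B C D : K} {J : Hor A B} {L : Hor C D} {f : A ⟶ C} {g : B ⟶ D}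
    (φ : Cell J f g L) :
    vcomp (hcomp φ (unitCell g)) (runit L) (Category.comp_id f) (Category.comp_id g) =
      vcomp (runit J) φ (Category.id_comp f) (Category.id_comp g)
  pentagon {A B C D E : K} (J : Hor A B) (H : Hor B C) (L : Hor C D) (N : Hor D E) :
    vcomp (vcomp (hcomp (associator J H L) (vid N)) (associator J (compHor H L) N) rfl rfl)
        (hcomp (vid J) (associator H L N)) (p := 𝟙 A) (q := 𝟙 E) (by simp) (by simp) =
      vcomp (associator (compHor J H) L N) (associator J H (compHor L N)) (by simp) (by simp)
  triangle {A B C : K} (J : Hor A B) (H : Hor B C) :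
    vcomp (associator J (unit B) H) (hcomp (vid J) (lunit H)) (Category.id_comp _) (Category.id_comp _) =
      hcomp (runit J) (vid H)

namespace DoubleCategory

section Basic

variable {K : Type u} [DoubleCategory.{w, x, v, u} K]

/-- Transport of a cell along equalities of the morphisms that form its boundary. -/
def recast {A B C D : K} {J J' : Hor A B} {f f' : A ⟶ C} {g g' : B ⟶ D} {L L' : Hor C D}
    (hJ : J = J') (hf : f = f') (hg : g = g') (hL : L = L') (φ : Cell J f g L) :
    Cell J' f' g' L' := by
  subst hJ hf hg hL
  exact φ

/-- Horizontal cells: those whose vertical source and target are identities. -/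
abbrev HCell {A B : K} (J L : Hor A B) : Type x := Cell J (𝟙 A) (𝟙 B) L

/-- A horizontal cell is invertible if it has an inverse for vertical composition. -/
def HCell.IsInvertible {A B : K} {J L : Hor A B} (φ : HCell J L) : Prop :=
  ∃ ψ : HCell L J,
    vcomp φ ψ (Category.id_comp _) (Category.id_comp _) = vid J ∧
    vcomp ψ φ (Category.id_comp _) (Category.id_comp _) = vid L

/-! ### The vertical 2-category -/

/-- Vertical cells `f ⇒ g`, the 2-cells of the vertical 2-category: those whose horizontal source
and target are units. -/
abbrev VCell {A C : K} (f g : A ⟶ C) : Type x := Cell (unit A) f g (unit C)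

/-- The composite `f ⇒ g ⇒ h` of vertical cells; this is their horizontal composite, with
`1_A ⊙ 1_A ≅ 1_A` and `1_C ⊙ 1_C ≅ 1_C` suppressed. -/
def VCell.comp {A C : K} {f g h : A ⟶ C} (φ : VCell f g) (ψ : VCell g h) : VCell f h :=
  vcomp (vcomp (lunitInv (unit A)) (hcomp φ ψ) rfl rfl) (lunit (unit C)) (by simp) (by simp)

/-- A vertical cell is invertible if it is so as a 2-cell of the vertical 2-category. -/
def VCell.IsInvertible {A C : K} {f g : A ⟶ C} (φ : VCell f g) : Prop :=
  ∃ ψ : VCell g f, VCell.comp φ ψ = unitCell f ∧ VCell.comp ψ φ = unitCell g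

/-- Whiskering `φ ∘ e` of a vertical cell `φ : f ⇒ g` with `e : X ⟶ A`, regarded as a cell between
any given morphisms that are equal to `f ∘ e` and `g ∘ e`. -/
def VCell.pre {X A C : K} {f g : A ⟶ C} (e : X ⟶ A) (φ : VCell f g) {p q : X ⟶ C}
    (hp : e ≫ f = p) (hq : e ≫ g = q) : VCell p q :=
  vcomp (unitCell e) φ hp hq

/-- Whiskering `e ∘ φ` of a vertical cell `φ : f ⇒ g` with `e : C ⟶ X`, regarded as a cell between
any given morphisms that are equal to `e ∘ f` and `e ∘ g`. -/
def VCell.post {A C X : K} {f g : A ⟶ C} (φ : VCell f g) (e : C ⟶ X) {p q : A ⟶ X}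
    (hp : f ≫ e = p) (hq : g ≫ e = q) : VCell p q :=
  vcomp φ (unitCell e) hp hq

/-! ### Cartesian cells, companions and equipments -/

/-- Cartesian cells. -/
def IsCartesian {A B C D : K} {J : Hor A B} {f : A ⟶ C} {g : B ⟶ D} {L : Hor C D}
    (φ : Cell J f g L) : Prop :=
  ∀ ⦃X Y : K⦄ (H : Hor X Y) (h : X ⟶ A) (k : Y ⟶ B) (χ : Cell H (h ≫ f) (k ≫ g) L),
    ∃! ψ : Cell H h k J, vcomp ψ φ rfl rfl = χ

/-- A companion `f_*` of `f : A ⟶ C`: a restriction of the unit `1_C` along `f` and `id_C`, that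
is a horizontal morphism `hor : A ⇸ C` with a cartesian cell `cart` as below, together with the
corresponding (opcartesian) cell `opcart`, through which the unit cell `1_f` factors. -/
structure Companion {A C : K} (f : A ⟶ C) where
  hor : Hor A C
  cart : Cell hor f (𝟙 C) (unit C)
  isCartesian : IsCartesian cart
  opcart : Cell (unit A) (𝟙 A) f hor
  fac : vcomp opcart cart (Category.id_comp f) (Category.comp_id f) = unitCell f

/-- A vertical morphism is full and faithful if its unit cell is cartesian. -/
def IsFullyFaithful {A C : K} (f : A ⟶ C) : Prop :=
  IsCartesian (unitCell f)

variable (K) in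
/-- An equipment is a double category that has all restrictions. -/
class IsEquipment : Prop where
  exists_restriction : ∀ {A B C D : K} (f : A ⟶ C) (g : B ⟶ D) (L : Hor C D),
    ∃ (J : Hor A B) (φ : Cell J f g L), IsCartesian φ

/-! ### Kan extensions and yoneda embeddings -/

/-- The cell `η` defines `l` as the left Kan extension of `d` along `J`. -/
def IsLeftKan {A B M : K} {J : Hor A B} {d : A ⟶ M} {l : B ⟶ M}
    (η : Cell J d l (unit M)) : Prop :=
  ∀ (k : B ⟶ M) (φ : Cell J d k (unit M)), ∃! ψ : VCell l k,
    vcomp (vcomp (runitInv J) (hcomp η ψ) rfl rfl) (lunit (unit M)) (by simp) (by simp) = φ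

/-- The cell `η` defines `l` as the pointwise left Kan extension of `d` along `J`. -/
def IsPointwiseLeftKan {A B M : K} {J : Hor A B} {d : A ⟶ M} {l : B ⟶ M}
    (η : Cell J d l (unit M)) : Prop :=
  ∀ ⦃C : K⦄ (H : Hor B C) (k : C ⟶ M) (φ : Cell (compHor J H) d k (unit M)),
    ∃! ψ : Cell H l k (unit M),
      vcomp (hcomp η ψ) (lunit (unit M)) (Category.comp_id d) (Category.comp_id k) = φ

/-- Yoneda embeddings in a double category. -/
structure IsYonedaEmbedding {M P : K} (y : M ⟶ P) : Prop where
  exists_cartesian : ∀ ⦃B : K⦄ (J : Hor M B),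
    ∃ (g : B ⟶ P) (φ : Cell J y g (unit P)), IsCartesian φ
  isPointwiseLeftKan : ∀ ⦃B : K⦄ (J : Hor M B) (l : B ⟶ P) (η : Cell J y l (unit P)),
    IsCartesian η → IsPointwiseLeftKan η

end Basic

end DoubleCategory

open DoubleCategory

/-! ### Double functors, double transformations and double monads -/

/-- A lax double functor; it preserves vertical composition strictly, and horizontal composition
and units up to the coherent horizontal cells `compositor` and `unitor`. -/
structure LaxDoubleFunctor (K : Type u₁) (L : Type u₂) [DoubleCategory.{w₁, x₁, v₁, u₁} K]
    [DoubleCategory.{w₂, x₂, v₂, u₂} L] extends CategoryTheory.Functor K L where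
  mapHor {A B : K} (J : Hor A B) : Hor (obj A) (obj B)
  mapCell {A B C D : K} {J : Hor A B} {f : A ⟶ C} {g : B ⟶ D} {N : Hor C D}
    (φ : Cell J f g N) : Cell (mapHor J) (map f) (map g) (mapHor N)
  mapCell_vid {A B : K} (J : Hor A B) :
    mapCell (vid J) = recast rfl (map_id A).symm (map_id B).symm rfl (vid (mapHor J))
  mapCell_vcomp {A B C D E F : K} {J : Hor A B} {N : Hor C D} {P : Hor E F}
    {f : A ⟶ C} {g : B ⟶ D} {h : C ⟶ E} {k : D ⟶ F} (φ : Cell J f g N) (ψ : Cell N h k P) :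
    mapCell (vcomp φ ψ rfl rfl) =
      vcomp (mapCell φ) (mapCell ψ) (map_comp f h).symm (map_comp g k).symm
  compositor {A B C : K} (J : Hor A B) (H : Hor B C) :
    HCell (compHor (mapHor J) (mapHor H)) (mapHor (compHor J H))
  compositor_naturality {A B C D E F : K} {J : Hor A B} {H : Hor B C} {N : Hor D E} {P : Hor E F}
    {f : A ⟶ D} {g : B ⟶ E} {h : C ⟶ F} (φ : Cell J f g N) (ψ : Cell H g h P) :
    vcomp (hcomp (mapCell φ) (mapCell ψ)) (compositor N P)
        (Category.comp_id _) (Category.comp_id _) =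
      vcomp (compositor J H) (mapCell (hcomp φ ψ)) (Category.id_comp _) (Category.id_comp _)
  unitor (A : K) : HCell (unit (obj A)) (mapHor (unit A))
  unitor_naturality {A C : K} (f : A ⟶ C) :
    vcomp (unitCell (map f)) (unitor C) (Category.comp_id _) (Category.comp_id _) =
      vcomp (unitor A) (mapCell (unitCell f)) (Category.id_comp _) (Category.id_comp _)
  compositor_assoc {A B C D : K} (J : Hor A B) (H : Hor B C) (N : Hor C D) :
    vcomp (vcomp (hcomp (compositor J H) (vid (mapHor N))) (compositor (compHor J H) N) rfl rfl)
        (mapCell (associator J H N)) (p := 𝟙 (obj A)) (q := 𝟙 (obj D))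
        (by simp [map_id]) (by simp [map_id]) =
      vcomp (vcomp (associator (mapHor J) (mapHor H) (mapHor N))
          (hcomp (vid (mapHor J)) (compositor H N)) rfl rfl)
        (compositor J (compHor H N)) (by simp) (by simp)
  compositor_left_unit {A B : K} (J : Hor A B) :
    vcomp (vcomp (hcomp (unitor A) (vid (mapHor J))) (compositor (unit A) J) rfl rfl)
        (mapCell (lunit J)) (by simp [map_id]) (by simp [map_id]) = lunit (mapHor J)
  compositor_right_unit {A B : K} (J : Hor A B) :
    vcomp (vcomp (hcomp (vid (mapHor J)) (unitor B)) (compositor J (unit B)) rfl rfl)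
        (mapCell (runit J)) (by simp [map_id]) (by simp [map_id]) = runit (mapHor J)

/-- A lax double functor is normal if its unitor cells are identities. -/
structure LaxDoubleFunctor.IsNormal {K : Type u₁} {L : Type u₂} [DoubleCategory.{w₁, x₁, v₁, u₁} K]
    [DoubleCategory.{w₂, x₂, v₂, u₂} L] (F : LaxDoubleFunctor K L) : Prop where
  mapHor_unit : ∀ A : K, F.mapHor (unit A) = unit (F.obj A)
  unitor_eq : ∀ A : K, F.unitor A = recast rfl rfl rfl (mapHor_unit A).symm (vid (unit (F.obj A)))

/-- A normal lax double monad `T = (T, μ, ι)` on a double category: a normal lax double functor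
`T : K → K` with double transformations `μ : T² → T` and `ι : id → T` that satisfy the usual
monad axioms. -/
structure NormalLaxDoubleMonad (K : Type u) [DoubleCategory.{w, x, v, u} K] extends
    LaxDoubleFunctor K K where
  isNormal : toLaxDoubleFunctor.IsNormal
  /-- The double transformation `ι : id → T` -/
  ι (A : K) : A ⟶ obj A
  ιCell {A B : K} (J : Hor A B) : Cell J (ι A) (ι B) (mapHor J)
  ι_naturality {A C : K} (f : A ⟶ C) : f ≫ ι C = ι A ≫ map f
  ιCell_naturality {A B C D : K} {J : Hor A B} {f : A ⟶ C} {g : B ⟶ D} {L : Hor C D}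
    (φ : Cell J f g L) :
    vcomp φ (ιCell L) rfl rfl =
      vcomp (ιCell J) (mapCell φ) (ι_naturality f).symm (ι_naturality g).symm
  ιCell_comp {A B C : K} (J : Hor A B) (H : Hor B C) :
    vcomp (hcomp (ιCell J) (ιCell H)) (compositor J H) (Category.comp_id _) (Category.comp_id _) =
      ιCell (compHor J H)
  ιCell_unit (A : K) :
    vcomp (unitCell (ι A)) (unitor A) (Category.comp_id _) (Category.comp_id _) = ιCell (unit A)
  /-- The double transformation `μ : T² → T`.  Recall that the compositor and unitor cells of the
  composite `T²` are those of `T` followed by the images under `T` of those of `T`. -/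
  μ (A : K) : obj (obj A) ⟶ obj A
  μCell {A B : K} (J : Hor A B) : Cell (mapHor (mapHor J)) (μ A) (μ B) (mapHor J)
  μ_naturality {A C : K} (f : A ⟶ C) : map (map f) ≫ μ C = μ A ≫ map f
  μCell_naturality {A B C D : K} {J : Hor A B} {f : A ⟶ C} {g : B ⟶ D} {L : Hor C D}
    (φ : Cell J f g L) :
    vcomp (mapCell (mapCell φ)) (μCell L) rfl rfl =
      vcomp (μCell J) (mapCell φ) (μ_naturality f).symm (μ_naturality g).symm
  μCell_comp {A B C : K} (J : Hor A B) (H : Hor B C) :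
    vcomp (hcomp (μCell J) (μCell H)) (compositor J H) (Category.comp_id _) (Category.comp_id _) =
      vcomp (vcomp (compositor (mapHor J) (mapHor H)) (mapCell (compositor J H)) rfl rfl)
        (μCell (compHor J H)) (by simp [map_id]) (by simp [map_id])
  μCell_unit (A : K) :
    vcomp (unitCell (μ A)) (unitor A) (Category.comp_id _) (Category.comp_id _) =
      vcomp (vcomp (unitor (obj A)) (mapCell (unitor A)) rfl rfl) (μCell (unit A))
        (by simp [map_id]) (by simp [map_id])
  /-- The monad axioms -/
  μ_assoc (A : K) : μ (obj A) ≫ μ A = map (μ A) ≫ μ A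
  μCell_assoc {A B : K} (J : Hor A B) :
    vcomp (μCell (mapHor J)) (μCell J) rfl rfl =
      vcomp (mapCell (μCell J)) (μCell J) (μ_assoc A).symm (μ_assoc B).symm
  ι_μ (A : K) : ι (obj A) ≫ μ A = 𝟙 (obj A)
  ιCell_μCell {A B : K} (J : Hor A B) :
    vcomp (ιCell (mapHor J)) (μCell J) (ι_μ A) (ι_μ B) = vid (mapHor J)
  map_ι_μ (A : K) : map (ι A) ≫ μ A = 𝟙 (obj A)
  map_ιCell_μCell {A B : K} (J : Hor A B) :
    vcomp (mapCell (ιCell J)) (μCell J) (map_ι_μ A) (map_ι_μ B) = vid (mapHor J)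

namespace NormalLaxDoubleMonad

variable {K : Type u} [DoubleCategory.{w, x, v, u} K] (T : NormalLaxDoubleMonad K)

/-- The image under `T` of a cell with horizontal target a unit `1_M`, as a cell with horizontal
target `1_{TM} = T 1_M`. -/
def mapToUnit {A B M : K} {J : Hor A B} {f : A ⟶ M} {g : B ⟶ M} (φ : Cell J f g (unit M)) :
    Cell (T.mapHor J) (T.map f) (T.map g) (unit (T.obj M)) :=
  recast rfl rfl rfl (T.isNormal.mapHor_unit M) (T.mapCell φ)

/-- The action of `T` on the vertical cells, as part of the 2-monad on the vertical 2-category that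
`T` restricts to. -/
def mapV {A C : K} {f g : A ⟶ C} (φ : VCell f g) : VCell (T.map f) (T.map g) :=
  recast (T.isNormal.mapHor_unit A) rfl rfl (T.isNormal.mapHor_unit C) (T.mapCell φ)

/-! ### Algebras and colax morphisms -/

/-- A strict algebra of the 2-monad `T` on the vertical 2-category. -/
structure StrictAlgebra (A : K) where
  act : T.obj A ⟶ A
  act_assoc : T.map act ≫ act = T.μ A ≫ act
  act_unit : T.ι A ≫ act = 𝟙 A

/-- A colax morphism structure `f̄ : f ∘ a ⇒ c ∘ Tf` on a morphism `f` between strict algebras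
`(A, a)` and `(C, c)`. -/
structure StrictAlgebra.IsColaxMorphism {T : NormalLaxDoubleMonad K} {A C : K}
    (a : T.StrictAlgebra A) (c : T.StrictAlgebra C) (f : A ⟶ C)
    (fbar : VCell (a.act ≫ f) (T.map f ≫ c.act)) : Prop where
  unit : fbar.pre (T.ι A) (p := f) (q := f) (by rw [← Category.assoc, a.act_unit, Category.id_comp])
    (by rw [← Category.assoc, ← T.ι_naturality, Category.assoc, c.act_unit, Category.comp_id]) =
      unitCell f
  assoc :
    fbar.pre (T.μ A) (p := T.map a.act ≫ a.act ≫ f) (q := T.map (T.map f) ≫ T.map c.act ≫ c.act)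
        (by rw [← Category.assoc, ← a.act_assoc, Category.assoc])
        (by rw [← Category.assoc, ← T.μ_naturality, Category.assoc, c.act_assoc]) =
      VCell.comp
        (fbar.pre (T.map a.act) (q := T.map a.act ≫ T.map f ≫ c.act) rfl rfl)
        ((T.mapV fbar).post c.act (by rw [T.map_comp, Category.assoc])
          (by rw [T.map_comp, Category.assoc]))

/-- The 2-monad on the vertical 2-category that `T` restricts to is colax-idempotent (in the sense
of Kelly and Lack): each morphism between (strict) algebras admits a unique structure of colax
morphism. -/
def IsColaxIdempotent : Prop :=
  ∀ ⦃A C : K⦄ (a : T.StrictAlgebra A) (c : T.StrictAlgebra C) (f : A ⟶ C),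
    ∃! fbar : VCell (a.act ≫ f) (T.map f ≫ c.act), a.IsColaxMorphism c f fbar

/-- A pseudo algebra structure on `A`, for the 2-monad `T` on the vertical 2-category: an action
`act = a : TA ⟶ A` with invertible vertical cells `assoc : a ∘ Ta ⇒ a ∘ μ_A` and
`unit : id_A ⇒ a ∘ ι_A`, satisfying the usual coherence axioms. -/
structure PseudoAlgebra (A : K) where
  act : T.obj A ⟶ A
  assoc : VCell (T.map act ≫ act) (T.μ A ≫ act)
  unit : VCell (𝟙 A) (T.ι A ≫ act)
  assoc_isInvertible : assoc.IsInvertible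
  unit_isInvertible : unit.IsInvertible
  coherence_assoc :
    VCell.comp
        ((T.mapV assoc).post act (p := T.map (T.map act) ≫ T.map act ≫ act)
          (q := T.map (T.μ A) ≫ T.map act ≫ act)
          (by rw [T.map_comp, Category.assoc]) (by rw [T.map_comp, Category.assoc]))
        (assoc.pre (T.map (T.μ A)) (q := T.μ (T.obj A) ≫ T.μ A ≫ act) rfl
          (by rw [← Category.assoc, ← T.μ_assoc, Category.assoc])) =
      VCell.comp
        (assoc.pre (T.map (T.map act)) (q := T.μ (T.obj A) ≫ T.map act ≫ act) rfl
          (by rw [← Category.assoc, T.μ_naturality, Category.assoc]))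
        (assoc.pre (T.μ (T.obj A)) rfl rfl)
  coherence_left_unit :
    VCell.comp
        (unit.pre act (q := T.ι (T.obj A) ≫ T.map act ≫ act) (Category.comp_id act)
          (by rw [← Category.assoc, T.ι_naturality, Category.assoc]))
        (assoc.pre (T.ι (T.obj A)) rfl
          (by rw [← Category.assoc, T.ι_μ, Category.id_comp])) =
      unitCell act
  coherence_right_unit :
    VCell.comp
        ((T.mapV unit).post act (p := act) (q := T.map (T.ι A) ≫ T.map act ≫ act)
          (by rw [T.map_id, Category.id_comp]) (by rw [T.map_comp, Category.assoc]))
        (assoc.pre (T.map (T.ι A)) rfl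
          (by rw [← Category.assoc, T.map_ι_μ, Category.id_comp])) =
      unitCell act

/-- A colax morphism structure `f̄ : f ∘ a ⇒ c ∘ Tf` on a morphism `f` between pseudo algebras
`(A, a)` and `(C, c)`. -/
structure PseudoAlgebra.IsColaxMorphism {T : NormalLaxDoubleMonad K} {A C : K}
    (a : T.PseudoAlgebra A) (c : T.PseudoAlgebra C) (f : A ⟶ C)
    (fbar : VCell (a.act ≫ f) (T.map f ≫ c.act)) : Prop where
  unit :
    VCell.comp
        (a.unit.post f (p := f) (q := T.ι A ≫ a.act ≫ f) (Category.id_comp f)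
          (Category.assoc _ _ _))
        (fbar.pre (T.ι A) (q := f ≫ T.ι C ≫ c.act) rfl
          (by rw [← Category.assoc, ← T.ι_naturality, Category.assoc])) =
      c.unit.pre f (Category.comp_id f) rfl
  assoc :
    VCell.comp
        (a.assoc.post f (p := T.map a.act ≫ a.act ≫ f) (q := T.μ A ≫ a.act ≫ f)
          (Category.assoc _ _ _) (Category.assoc _ _ _))
        (fbar.pre (T.μ A) (q := T.map (T.map f) ≫ T.μ C ≫ c.act) rfl
          (by rw [← Category.assoc, ← T.μ_naturality, Category.assoc])) =
      VCell.comp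
        (VCell.comp
          (fbar.pre (T.map a.act) (q := T.map a.act ≫ T.map f ≫ c.act) rfl rfl)
          ((T.mapV fbar).post c.act (q := T.map (T.map f) ≫ T.map c.act ≫ c.act)
            (by rw [T.map_comp, Category.assoc]) (by rw [T.map_comp, Category.assoc])))
        (c.assoc.pre (T.map (T.map f)) rfl rfl)

/-! ### The right Beck-Chevalley condition -/

/-- The horizontal cell `ι_{J*} : J ⊙ ι_{B*} ⇒ ι_{A*} ⊙ TJ`, for chosen companions `ι_{A*}` and
`ι_{B*}` of `ι_A` and `ι_B`: the horizontal composite of the opcartesian cell of `ι_{A*}`, the cell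
`ι_J` and the cartesian cell of `ι_{B*}`, with the unit coherence cells inserted. -/
def ιStar {A B : K} (cA : Companion (T.ι A)) (cB : Companion (T.ι B)) (J : Hor A B) :
    HCell (compHor J cB.hor) (compHor cA.hor (T.mapHor J)) :=
  vcomp
    (vcomp (lunitInv (compHor J cB.hor)) (hcomp cA.opcart (hcomp (T.ιCell J) cB.cart)) rfl rfl)
    (hcomp (vid cA.hor) (runit (T.mapHor J))) (by simp) (by simp)

/-- The right Beck-Chevalley condition for `ι_J`. -/
def RightBeckChevalley {A B : K} (cA : Companion (T.ι A)) (cB : Companion (T.ι B))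
    (J : Hor A B) : Prop :=
  (T.ιStar cA cB J).IsInvertible

end NormalLaxDoubleMonad

/-! Write P for the target of the yoneda embedding y. The argument compares three cells into the
unit of P: `D ⊙ ι_{A*} ⇒ 1_P` (`δ` followed by `extUnit` at d), `j_* ⊙ ι_{B*} ⇒ 1_P` (`η` followed
by `extUnit` at l) and `ι_{A*} ⊙ T(j_*) ⇒ 1_P` (`extUnit` at d followed by `1_w ∘ Tη`).

Colax-idempotency enters through the adjunctions `ι_B ⊣ b` and `ι_P ⊣ w`, whose units are those of
the pseudo algebras (`exists_adjunction`). The first makes `ι_{B*}` a conjoint of b, so `l ∘ b` is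
the pointwise left Kan extension of l along `ι_{B*}` (`isPointwiseLeftKan_desc`). The colax
structure `l̄` is the transpose of the unit of w, that is, the comparison from this Kan extension to
the cell `extUnit` at l (`ract_desc`). The second adjunction shows that `ι_{M*} ⊙ TD ⇒ 1_P` is
cartesian, being the transpose of a restriction of the cartesian cell `Tδ`
(`isCartesian_star_extUnit`).

The equation `arr_ιStar_extUnit` is used twice. For the horizontal morphism D it compares `D ⊙
ι_{A*} ⇒ 1_P` with that cartesian cell, so the right Beck–Chevalley condition holds exactly when `D
⊙ ι_{A*} ⇒ 1_P` is cartesian (`rightBeckChevalley_iff`). Since y is a yoneda embedding, cartesian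
means pointwise Kan (`isCartesian_iff`), and by pasting the condition says that `extUnit` at d is a
pointwise Kan extension. For the companion `j_*`, the cell `ι_{j_*}` is always invertible, so the
second and third cells above agree up to isomorphism.

Given the two conditions of (1), the third cell is a Kan extension, hence so is the second. As `η`
followed by the Kan extension along `ι_{B*}` is one as well, `l̄` compares two Kan extensions and is
invertible. Conversely, if `l̄` is invertible, then the second and third cells are pointwise Kan,
and prefixing `δ` to the third gives a cartesian cell. When j is full and faithful so is Tj, and
restricting along Tj strips off `T(j_*)`, leaving `D ⊙ ι_{A*} ⇒ 1_P` cartesian. This is the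
Beck–Chevalley condition, and cancelling in the pasting law gives the Kan extension, even pointwise.
-/

namespace DoubleCategory

/-! ### The category of horizontal morphisms and cells -/

/-- A horizontal morphism together with its source and target. -/
structure HorArrow (K : Type u) [DoubleCategory.{w, x, v, u} K] where
  {src tgt : K}
  hor : Hor src tgt

/-- A cell together with its vertical source and target. -/
structure Square {K : Type u} [DoubleCategory.{w, x, v, u} K] (J L : HorArrow K) where
  left : J.src ⟶ L.src
  right : J.tgt ⟶ L.tgt
  cell : Cell J.hor left right L.hor

section Squares

variable {K : Type u} [DoubleCategory.{w, x, v, u} K]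

/-- The square of a cell; equations between composites of cells are proved in the category of
squares, where no bookkeeping of boundaries is needed. -/
def sq {A B C D : K} {J : Hor A B} {f : A ⟶ C} {g : B ⟶ D} {L : Hor C D} (φ : Cell J f g L) :
    Square (HorArrow.mk J) (HorArrow.mk L) :=
  ⟨f, g, φ⟩

theorem sq_injective {A B C D : K} {J : Hor A B} {f : A ⟶ C} {g : B ⟶ D} {L : Hor C D}
    {φ ψ : Cell J f g L} (h : sq φ = sq ψ) : φ = ψ := by
  simpa [sq] using h

theorem sq_vcomp_eq {A B C D E F : K} {J : Hor A B} {L : Hor C D} {N : Hor E F}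
    {f : A ⟶ C} {g : B ⟶ D} {h : C ⟶ E} {k : D ⟶ F} {p : A ⟶ E} {q : B ⟶ F}
    (φ : Cell J f g L) (ψ : Cell L h k N) (hl : f ≫ h = p) (hr : g ≫ k = q) :
    sq (vcomp φ ψ hl hr) = sq (vcomp φ ψ rfl rfl) := by
  subst hl hr
  rfl

/-- Vertical composition is strict, so cells of all shapes form an honest category. Its morphisms
carry their own sides, hence an equation between them can compare cells whose sides are equal only
propositionally. -/
instance : Category (HorArrow K) where
  Hom := Square
  id J := sq (vid J.hor)
  comp φ ψ := sq (vcomp φ.cell ψ.cell rfl rfl)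
  id_comp φ := (sq_vcomp_eq _ _ (Category.id_comp _) (Category.id_comp _)).symm.trans
    (congrArg sq (vid_vcomp φ.cell))
  comp_id φ := (sq_vcomp_eq _ _ (Category.comp_id _) (Category.comp_id _)).symm.trans
    (congrArg sq (vcomp_vid φ.cell))
  assoc φ ψ χ := (congrArg sq (vcomp_assoc φ.cell ψ.cell χ.cell)).trans (sq_vcomp_eq _ _ _ _)

/-- The square of a cell, as a morphism of the category of squares. -/
def arr {A B C D : K} {J : Hor A B} {f : A ⟶ C} {g : B ⟶ D} {L : Hor C D} (φ : Cell J f g L) :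
    HorArrow.mk J ⟶ HorArrow.mk L :=
  sq φ

theorem arr_injective {A B C D : K} {J : Hor A B} {f : A ⟶ C} {g : B ⟶ D} {L : Hor C D}
    {φ ψ : Cell J f g L} (h : arr φ = arr ψ) : φ = ψ :=
  sq_injective h

@[simp]
theorem arr_vcomp {A B C D E F : K} {J : Hor A B} {L : Hor C D} {N : Hor E F}
    {f : A ⟶ C} {g : B ⟶ D} {h : C ⟶ E} {k : D ⟶ F} {p : A ⟶ E} {q : B ⟶ F}
    (φ : Cell J f g L) (ψ : Cell L h k N) (hl : f ≫ h = p) (hr : g ≫ k = q) :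
    arr (vcomp φ ψ hl hr) = arr φ ≫ arr ψ :=
  sq_vcomp_eq φ ψ hl hr

@[simp]
theorem arr_vid {A B : K} (J : Hor A B) : arr (vid J) = 𝟙 (HorArrow.mk J) := rfl

theorem arr_vcomp_eq_iff {A B C D E F : K} {J : Hor A B} {L : Hor C D} {N : Hor E F}
    {f : A ⟶ C} {g : B ⟶ D} {h : C ⟶ E} {k : D ⟶ F} {p : A ⟶ E} {q : B ⟶ F}
    {φ : Cell J f g L} {ψ : Cell L h k N} {hl : f ≫ h = p} {hr : g ≫ k = q} {χ : Cell J p q N} :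
    vcomp φ ψ hl hr = χ ↔ arr φ ≫ arr ψ = arr χ := by
  rw [← arr_vcomp φ ψ hl hr]
  exact ⟨congrArg arr, arr_injective⟩

/-- An equality of squares contains the equality of the sides, which can therefore be substituted
before the cells are compared. -/
theorem arr_hcomp_congr {A B C D E F : K} {J : Hor A B} {H : Hor B C} {L : Hor D E} {N : Hor E F}
    {f f' : A ⟶ D} {g g' : B ⟶ E} {h h' : C ⟶ F} {φ : Cell J f g L} {ψ : Cell H g h N}
    {φ' : Cell J f' g' L} {ψ' : Cell H g' h' N} (hφ : arr φ = arr φ') (hψ : arr ψ = arr ψ') :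
    arr (hcomp φ ψ) = arr (hcomp φ' ψ') := by
  have h₁ : f = f' := congrArg Square.left hφ
  have h₂ : g = g' := congrArg Square.right hφ
  have h₃ : h = h' := congrArg Square.right hψ
  subst h₁ h₂ h₃
  rw [arr_injective hφ, arr_injective hψ]

@[simp]
theorem arr_unitCell_id (A : K) : arr (unitCell (𝟙 A)) = 𝟙 (HorArrow.mk (unit A)) := by
  rw [unitCell_id, arr_vid]

theorem arr_unitCell_comp {A C E : K} (f : A ⟶ C) (h : C ⟶ E) :
    arr (unitCell (f ≫ h)) = arr (unitCell f) ≫ arr (unitCell h) := by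
  rw [← unitCell_comp, arr_vcomp]

theorem arr_unitCell_congr {A C : K} {f g : A ⟶ C} (h : f = g) :
    arr (unitCell f) = arr (unitCell g) := by
  rw [h]

theorem arr_hcomp_comp {A B C D E F X Y Z : K} {J : Hor A B} {H : Hor B C} {L : Hor D E}
    {N : Hor E F}
    {P : Hor X Y} {Q : Hor Y Z} {f : A ⟶ D} {g : B ⟶ E} {h : C ⟶ F}
    {f' : D ⟶ X} {g' : E ⟶ Y} {h' : F ⟶ Z} {p : A ⟶ X} {q : B ⟶ Y} {r : C ⟶ Z}
    (φ : Cell J f g L) (ψ : Cell H g h N) (φ' : Cell L f' g' P) (ψ' : Cell N g' h' Q)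
    (χ : Cell J p q P) (ω : Cell H q r Q)
    (hφ : arr φ ≫ arr φ' = arr χ) (hψ : arr ψ ≫ arr ψ' = arr ω) :
    arr (hcomp φ ψ) ≫ arr (hcomp φ' ψ') = arr (hcomp χ ω) := by
  rw [← arr_vcomp (hl := rfl) (hr := rfl), ← interchange]
  exact arr_hcomp_congr (by rw [arr_vcomp, hφ]) (by rw [arr_vcomp, hψ])

theorem arr_hcomp_vid {A B C : K} (J : Hor A B) (H : Hor B C) :
    arr (hcomp (vid J) (vid H)) = 𝟙 (HorArrow.mk (compHor J H)) := by
  rw [hcomp_vid, arr_vid]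

@[simp]
theorem arr_associator_inv {A B C D : K} (J : Hor A B) (H : Hor B C) (L : Hor C D) :
    arr (associator J H L) ≫ arr (associatorInv J H L) = 𝟙 _ := by
  rw [← arr_vcomp (hl := Category.id_comp _) (hr := Category.id_comp _), associator_associatorInv,
      arr_vid]

@[simp]
theorem arr_associatorInv_associator {A B C D : K} (J : Hor A B) (H : Hor B C) (L : Hor C D) :
    arr (associatorInv J H L) ≫ arr (associator J H L) = 𝟙 _ := by
  rw [← arr_vcomp (hl := Category.id_comp _) (hr := Category.id_comp _), associatorInv_associator,
      arr_vid]

@[simp]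
theorem arr_lunit_inv {A B : K} (J : Hor A B) : arr (lunit J) ≫ arr (lunitInv J) = 𝟙 _ := by
  rw [← arr_vcomp (hl := Category.id_comp _) (hr := Category.id_comp _), lunit_lunitInv, arr_vid]

@[simp]
theorem arr_lunitInv_lunit {A B : K} (J : Hor A B) : arr (lunitInv J) ≫ arr (lunit J) = 𝟙 _ := by
  rw [← arr_vcomp (hl := Category.id_comp _) (hr := Category.id_comp _), lunitInv_lunit, arr_vid]

@[simp]
theorem arr_runit_inv {A B : K} (J : Hor A B) : arr (runit J) ≫ arr (runitInv J) = 𝟙 _ := by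
  rw [← arr_vcomp (hl := Category.id_comp _) (hr := Category.id_comp _), runit_runitInv, arr_vid]

@[simp]
theorem arr_runitInv_runit {A B : K} (J : Hor A B) : arr (runitInv J) ≫ arr (runit J) = 𝟙 _ := by
  rw [← arr_vcomp (hl := Category.id_comp _) (hr := Category.id_comp _), runitInv_runit, arr_vid]

instance {A B C D : K} (J : Hor A B) (H : Hor B C) (L : Hor C D) : IsIso (arr (associator J H L)) :=
  ⟨_, arr_associator_inv J H L, arr_associatorInv_associator J H L⟩

instance {A B : K} (J : Hor A B) : IsIso (arr (lunit J)) :=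
  ⟨_, arr_lunit_inv J, arr_lunitInv_lunit J⟩

instance {A B : K} (J : Hor A B) : IsIso (arr (runit J)) :=
  ⟨_, arr_runit_inv J, arr_runitInv_runit J⟩

theorem arr_associator_naturality {A B C D A' B' C' D' : K} {J : Hor A B} {H : Hor B C}
    {L : Hor C D}
    {J' : Hor A' B'} {H' : Hor B' C'} {L' : Hor C' D'}
    {f : A ⟶ A'} {g : B ⟶ B'} {h : C ⟶ C'} {k : D ⟶ D'}
    (φ : Cell J f g J') (ψ : Cell H g h H') (χ : Cell L h k L') :
    arr (hcomp (hcomp φ ψ) χ) ≫ arr (associator J' H' L') =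
      arr (associator J H L) ≫ arr (hcomp φ (hcomp ψ χ)) := by
  rw [← arr_vcomp (hl := Category.comp_id _) (hr := Category.comp_id _), associator_naturality,
      arr_vcomp]

theorem arr_associatorInv_naturality {A B C D A' B' C' D' : K} {J : Hor A B} {H : Hor B C}
    {L : Hor C D}
    {J' : Hor A' B'} {H' : Hor B' C'} {L' : Hor C' D'}
    {f : A ⟶ A'} {g : B ⟶ B'} {h : C ⟶ C'} {k : D ⟶ D'}
    (φ : Cell J f g J') (ψ : Cell H g h H') (χ : Cell L h k L') :
    arr (hcomp φ (hcomp ψ χ)) ≫ arr (associatorInv J' H' L') =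
      arr (associatorInv J H L) ≫ arr (hcomp (hcomp φ ψ) χ) := by
  rw [← cancel_epi (arr (associator J H L)), ← Category.assoc, ← arr_associator_naturality,
    Category.assoc, arr_associator_inv, ← Category.assoc, arr_associator_inv, Category.comp_id,
    Category.id_comp]

theorem arr_lunit_naturality {A B C D : K} {J : Hor A B} {L : Hor C D} {f : A ⟶ C} {g : B ⟶ D}
    (φ : Cell J f g L) :
    arr (hcomp (unitCell f) φ) ≫ arr (lunit L) = arr (lunit J) ≫ arr φ := by
  rw [← arr_vcomp (hl := Category.comp_id _) (hr := Category.comp_id _), lunit_naturality,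
      arr_vcomp]

theorem arr_lunitInv_naturality {A B C D : K} {J : Hor A B} {L : Hor C D} {f : A ⟶ C} {g : B ⟶ D}
    (φ : Cell J f g L) :
    arr (lunitInv J) ≫ arr (hcomp (unitCell f) φ) = arr φ ≫ arr (lunitInv L) := by
  rw [← cancel_mono (arr (lunit L)), Category.assoc, arr_lunit_naturality, ← Category.assoc]
  simp

theorem arr_runit_naturality {A B C D : K} {J : Hor A B} {L : Hor C D} {f : A ⟶ C} {g : B ⟶ D}
    (φ : Cell J f g L) :
    arr (hcomp φ (unitCell g)) ≫ arr (runit L) = arr (runit J) ≫ arr φ := by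
  rw [← arr_vcomp (hl := Category.comp_id _) (hr := Category.comp_id _), runit_naturality,
      arr_vcomp]

theorem arr_runitInv_naturality {A B C D : K} {J : Hor A B} {L : Hor C D} {f : A ⟶ C} {g : B ⟶ D}
    (φ : Cell J f g L) :
    arr (runitInv J) ≫ arr (hcomp φ (unitCell g)) = arr φ ≫ arr (runitInv L) := by
  rw [← cancel_mono (arr (runit L)), Category.assoc, arr_runit_naturality, ← Category.assoc]
  simp

theorem arr_pentagon {A B C D E : K} (J : Hor A B) (H : Hor B C) (L : Hor C D) (N : Hor D E) :
    arr (hcomp (associator J H L) (vid N)) ≫ arr (associator J (compHor H L) N) ≫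
        arr (hcomp (vid J) (associator H L N)) =
      arr (associator (compHor J H) L N) ≫ arr (associator J H (compHor L N)) := by
  rw [← Category.assoc]
  simpa using congrArg arr (pentagon J H L N)

theorem arr_triangle {A B C : K} (J : Hor A B) (H : Hor B C) :
    arr (associator J (unit B) H) ≫ arr (hcomp (vid J) (lunit H)) =
      arr (hcomp (runit J) (vid H)) := by
  rw [← triangle, arr_vcomp]

end Squares

/-! ### The horizontal bicategory -/

/-- The objects of a double category, regarded as those of its horizontal bicategory. -/
def HorizontalBicategory (K : Type u) : Type u := K

section Bicat

variable {K : Type u} [DoubleCategory.{w, x, v, u} K]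

/-- The category of horizontal morphisms `A ⇸ B` and horizontal cells. -/
instance horCategory (A B : K) : Category (Hor A B) where
  Hom J L := HCell J L
  id J := vid J
  comp φ ψ := vcomp φ ψ (Category.id_comp _) (Category.id_comp _)
  id_comp φ := vid_vcomp φ
  comp_id φ := vcomp_vid φ
  assoc φ ψ χ := arr_injective (by simp)

/-- The composite of horizontal cells. -/
abbrev HCell.comp {A B : K} {J L N : Hor A B} (φ : HCell J L) (ψ : HCell L N) : HCell J N :=
  vcomp φ ψ (Category.id_comp _) (Category.id_comp _)

theorem hcomp_vid_comp {A B C : K} (J : Hor A B) {H H' H'' : Hor B C} (φ : HCell H H')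
    (ψ : HCell H' H'') :
    hcomp (vid J) (φ.comp ψ) = HCell.comp (hcomp (vid J) φ) (hcomp (vid J) ψ) :=
  arr_injective (by rw [arr_vcomp]; exact (arr_hcomp_comp _ _ _ _ _ _ (by simp) (by simp)).symm)

theorem hcomp_comp_vid {A B C : K} {J J' J'' : Hor A B} (φ : HCell J J') (ψ : HCell J' J'')
    (H : Hor B C) :
    hcomp (φ.comp ψ) (vid H) = HCell.comp (hcomp φ (vid H)) (hcomp ψ (vid H)) :=
  arr_injective (by rw [arr_vcomp]; exact (arr_hcomp_comp _ _ _ _ _ _ (by simp) (by simp)).symm)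

theorem hcomp_vid_unit {A B : K} {J L : Hor A B} (φ : HCell J L) :
    hcomp (vid (unit A)) φ = HCell.comp (lunit J) (φ.comp (lunitInv L)) :=
  arr_injective (by
    rw [arr_vcomp, arr_vcomp, ← unitCell_id, ← Category.assoc, ← arr_lunit_naturality,
      Category.assoc, arr_lunit_inv, Category.comp_id])

theorem hcomp_unit_vid {A B : K} {J L : Hor A B} (φ : HCell J L) :
    hcomp φ (vid (unit B)) = HCell.comp (runit J) (φ.comp (runitInv L)) :=
  arr_injective (by
    rw [arr_vcomp, arr_vcomp, ← unitCell_id, ← Category.assoc, ← arr_runit_naturality,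
      Category.assoc, arr_runit_inv, Category.comp_id])

theorem hcomp_vid_compHor {A B C D : K} (J : Hor A B) (H : Hor B C) {L N : Hor C D}
    (φ : HCell L N) :
    hcomp (vid (compHor J H)) φ =
      HCell.comp (associator J H L)
        (HCell.comp (hcomp (vid J) (hcomp (vid H) φ)) (associatorInv J H N)) :=
  arr_injective (by
    rw [arr_vcomp, arr_vcomp, ← Category.assoc, ← arr_associator_naturality, Category.assoc,
      arr_associator_inv, Category.comp_id, hcomp_vid])

theorem hcomp_compHor_vid {A B C D : K} {J J' : Hor A B} (φ : HCell J J') (H : Hor B C)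
    (L : Hor C D) :
    hcomp φ (vid (compHor H L)) =
      HCell.comp (associatorInv J H L)
        (HCell.comp (hcomp (hcomp φ (vid H)) (vid L)) (associator J' H L)) :=
  arr_injective (by
    rw [arr_vcomp, arr_vcomp, arr_associator_naturality, ← Category.assoc,
      arr_associatorInv_associator, Category.id_comp, hcomp_vid])

theorem hcomp_vid_hcomp_vid {A B C D : K} (J : Hor A B) {H H' : Hor B C} (φ : HCell H H')
    (L : Hor C D) :
    hcomp (hcomp (vid J) φ) (vid L) =
      HCell.comp (associator J H L)
        (HCell.comp (hcomp (vid J) (hcomp φ (vid L))) (associatorInv J H' L)) :=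
  arr_injective (by
    rw [arr_vcomp, arr_vcomp, ← Category.assoc, ← arr_associator_naturality, Category.assoc,
      arr_associator_inv, Category.comp_id])

theorem hcomp_exchange {A B C : K} {J J' : Hor A B} {H H' : Hor B C} (φ : HCell J J')
    (ψ : HCell H H') :
    HCell.comp (hcomp (vid J) ψ) (hcomp φ (vid H')) =
      HCell.comp (hcomp φ (vid H)) (hcomp (vid J') ψ) :=
  arr_injective (by
    rw [arr_vcomp, arr_vcomp, arr_hcomp_comp _ _ _ _ φ ψ (by simp) (by simp),
      arr_hcomp_comp _ _ _ _ φ ψ (by simp) (by simp)])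

theorem pentagon_comp {A B C D E : K} (J : Hor A B) (H : Hor B C) (L : Hor C D) (N : Hor D E) :
    HCell.comp (hcomp (associator J H L) (vid N))
        (HCell.comp (associator J (compHor H L) N) (hcomp (vid J) (associator H L N))) =
      HCell.comp (associator (compHor J H) L N) (associator J H (compHor L N)) :=
  arr_injective (by simpa using arr_pentagon J H L N)

/-- The associator cells, as isomorphisms. -/
def associatorIso {A B C D : K} (J : Hor A B) (H : Hor B C) (L : Hor C D) :
    compHor (compHor J H) L ≅ compHor J (compHor H L) :=
  ⟨associator J H L, associatorInv J H L, associator_associatorInv J H L,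
    associatorInv_associator J H L⟩

/-- The left unitor cells, as isomorphisms. -/
def lunitIso {A B : K} (J : Hor A B) : compHor (unit A) J ≅ J :=
  ⟨lunit J, lunitInv J, lunit_lunitInv J, lunitInv_lunit J⟩

/-- The right unitor cells, as isomorphisms. -/
def runitIso {A B : K} (J : Hor A B) : compHor J (unit B) ≅ J :=
  ⟨runit J, runitInv J, runit_runitInv J, runitInv_runit J⟩

/-- This structure serves to import Kelly's consequences of the pentagon and triangle: agreement of
the two unitors of a unit, and the unitors of a composite. -/
instance : Bicategory.{x, w} (HorizontalBicategory K) where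
  Hom A B := Hor (K := K) A B
  id A := unit (K := K) A
  comp J H := compHor (K := K) J H
  homCategory A B := horCategory (K := K) A B
  whiskerLeft J _ _ φ := hcomp (vid (K := K) J) φ
  whiskerRight φ H := hcomp φ (vid (K := K) H)
  associator J H L := associatorIso (K := K) J H L
  leftUnitor J := lunitIso (K := K) J
  rightUnitor J := runitIso (K := K) J
  whiskerLeft_id J H := hcomp_vid (K := K) J H
  whiskerLeft_comp J _ _ _ φ ψ := hcomp_vid_comp (K := K) J φ ψ
  id_whiskerLeft φ := hcomp_vid_unit (K := K) φ
  comp_whiskerLeft J H _ _ φ := hcomp_vid_compHor (K := K) J H φ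
  id_whiskerRight J H := hcomp_vid (K := K) J H
  comp_whiskerRight φ ψ H := hcomp_comp_vid (K := K) φ ψ H
  whiskerRight_id φ := hcomp_unit_vid (K := K) φ
  whiskerRight_comp φ H L := hcomp_compHor_vid (K := K) φ H L
  whisker_assoc J _ _ φ L := hcomp_vid_hcomp_vid (K := K) J φ L
  whisker_exchange φ ψ := hcomp_exchange (K := K) φ ψ
  pentagon J H L N := pentagon_comp (K := K) J H L N
  triangle J H := triangle (K := K) J H

theorem lunit_unit (A : K) : lunit (unit A) = runit (unit A) :=
  Bicategory.unitors_equal (B := HorizontalBicategory K) (a := A)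

theorem lunit_compHor {A B C : K} (J : Hor A B) (H : Hor B C) :
    lunit (compHor J H) = HCell.comp (associatorInv (unit A) J H) (hcomp (lunit J) (vid H)) :=
  Bicategory.leftUnitor_comp (B := HorizontalBicategory K) (a := A) (b := B) (c := C) J H

theorem runit_compHor {A B C : K} (J : Hor A B) (H : Hor B C) :
    runit (compHor J H) = HCell.comp (associator J H (unit C)) (hcomp (vid J) (runit H)) :=
  Bicategory.rightUnitor_comp (B := HorizontalBicategory K) (a := A) (b := B) (c := C) J H

end Bicat

/-! ### Unit coherence in the category of squares, and the calculus of cells into a unit. -/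

section Star

variable {K : Type u} [DoubleCategory.{w, x, v, u} K]

theorem arr_lunit_compHor {A B C : K} (J : Hor A B) (H : Hor B C) :
    arr (lunit (compHor J H)) = arr (associatorInv (unit A) J H) ≫ arr (hcomp (lunit J)
        (vid H)) := by
  rw [lunit_compHor, arr_vcomp]

theorem arr_runit_compHor {A B C : K} (J : Hor A B) (H : Hor B C) :
    arr (runit (compHor J H)) = arr (associator J H (unit C)) ≫ arr (hcomp (vid J) (runit H)) := by
  rw [runit_compHor, arr_vcomp]

theorem arr_lunit_unit (A : K) : arr (lunit (unit A)) = arr (runit (unit A)) := by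
  rw [lunit_unit]

theorem arr_lunitInv_unit (A : K) : arr (lunitInv (unit A)) = arr (runitInv (unit A)) := by
  rw [← cancel_mono (arr (lunit (unit A))), arr_lunitInv_lunit, arr_lunit_unit,
    arr_runitInv_runit]

theorem arr_lunitInv_compHor {A B C : K} (J : Hor A B) (H : Hor B C) :
    arr (lunitInv (compHor J H)) =
      arr (hcomp (lunitInv J) (vid H)) ≫ arr (associator (unit A) J H) := by
  rw [← cancel_mono (arr (lunit (compHor J H))), arr_lunitInv_lunit, arr_lunit_compHor,
    Category.assoc, ← Category.assoc (arr (associator _ _ _)), arr_associator_inv, Category.id_comp,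
    arr_hcomp_comp _ _ _ _ (vid J) (vid H) (by simp) (by simp), arr_hcomp_vid]

theorem arr_runitInv_compHor {A B C : K} (J : Hor A B) (H : Hor B C) :
    arr (runitInv (compHor J H)) =
      arr (hcomp (vid J) (runitInv H)) ≫ arr (associatorInv J H (unit C)) := by
  rw [← cancel_mono (arr (runit (compHor J H))), arr_runitInv_runit, arr_runit_compHor,
    Category.assoc, ← Category.assoc (arr (associatorInv _ _ _)), arr_associatorInv_associator,
    Category.id_comp, arr_hcomp_comp _ _ _ _ (vid J) (vid H) (by simp) (by simp), arr_hcomp_vid]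

theorem arr_triangle_inv {A B C : K} (J : Hor A B) (H : Hor B C) :
    arr (hcomp (vid J) (lunitInv H)) ≫ arr (associatorInv J (unit B) H) =
      arr (hcomp (runitInv J) (vid H)) := by
  rw [← cancel_mono (arr (associator J (unit B) H)), Category.assoc, arr_associatorInv_associator,
    Category.comp_id]
  have h : arr (hcomp (vid J) (lunit H)) ≫ arr (hcomp (vid J) (lunitInv H)) = 𝟙 _ := by
    rw [arr_hcomp_comp _ _ _ _ (vid J) (vid _) (by simp) (by simp), arr_hcomp_vid]
  have h' : arr (hcomp (runitInv J) (vid H)) ≫ arr (hcomp (runit J) (vid H)) = 𝟙 _ := by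
    rw [arr_hcomp_comp _ _ _ _ (vid J) (vid _) (by simp) (by simp), arr_hcomp_vid]
  rw [← Category.comp_id (arr (associator _ _ _)), ← h, ← Category.assoc (arr (associator _ _ _)),
    arr_triangle, ← Category.assoc, h', Category.id_comp]

/-! ### Composites of cells into a unit -/

/-- The horizontal composite of two cells with horizontal target `1_M`, again regarded as a cell
with horizontal target `1_M`. -/
def star {A B C M : K} {J : Hor A B} {H : Hor B C} {d : A ⟶ M} {l : B ⟶ M} {k : C ⟶ M}
    (φ : Cell J d l (unit M)) (ψ : Cell H l k (unit M)) : Cell (compHor J H) d k (unit M) :=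
  vcomp (hcomp φ ψ) (lunit (unit M)) (Category.comp_id d) (Category.comp_id k)

/-- The left action of vertical cells on cells with horizontal target `1_M`. -/
def lact {A B M : K} {J : Hor A B} {p d : A ⟶ M} {l : B ⟶ M}
    (s : VCell p d) (φ : Cell J d l (unit M)) : Cell J p l (unit M) :=
  vcomp (lunitInv J) (star s φ) (Category.id_comp p) (Category.id_comp l)

/-- The right action of vertical cells on cells with horizontal target `1_M`. -/
def ract {A B M : K} {J : Hor A B} {d : A ⟶ M} {l k : B ⟶ M}
    (φ : Cell J d l (unit M)) (t : VCell l k) : Cell J d k (unit M) :=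
  vcomp (runitInv J) (star φ t) (Category.id_comp d) (Category.id_comp k)

section

variable {A B C D M X : K} {J : Hor A B} {H : Hor B C} {L : Hor C D}

theorem arr_star {d : A ⟶ M} {l : B ⟶ M} {k : C ⟶ M}
    (φ : Cell J d l (unit M)) (ψ : Cell H l k (unit M)) :
    arr (star φ ψ) = arr (hcomp φ ψ) ≫ arr (lunit (unit M)) :=
  arr_vcomp _ _ _ _

theorem arr_lact {p d : A ⟶ M} {l : B ⟶ M} (s : VCell p d) (φ : Cell J d l (unit M)) :
    arr (lact s φ) = arr (lunitInv J) ≫ arr (star s φ) :=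
  arr_vcomp _ _ _ _

theorem arr_ract {d : A ⟶ M} {l k : B ⟶ M} (φ : Cell J d l (unit M)) (t : VCell l k) :
    arr (ract φ t) = arr (runitInv J) ≫ arr (star φ t) :=
  arr_vcomp _ _ _ _

theorem arr_star_congr {d d' : A ⟶ M} {l l' : B ⟶ M} {k k' : C ⟶ M}
    {φ : Cell J d l (unit M)} {ψ : Cell H l k (unit M)}
    {φ' : Cell J d' l' (unit M)} {ψ' : Cell H l' k' (unit M)} (hφ : arr φ = arr φ')
    (hψ : arr ψ = arr ψ') : arr (star φ ψ) = arr (star φ' ψ') := by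
  rw [arr_star, arr_star, arr_hcomp_congr hφ hψ]

theorem arr_lact_congr {p d p' d' : A ⟶ M} {l l' : B ⟶ M} {s : VCell p d} {φ : Cell J d l (unit M)}
    {s' : VCell p' d'} {φ' : Cell J d' l' (unit M)} (hs : arr s = arr s') (hφ : arr φ = arr φ') :
    arr (lact s φ) = arr (lact s' φ') := by
  rw [arr_lact, arr_lact, arr_star_congr hs hφ]

theorem arr_ract_congr {d d' : A ⟶ M} {l l' k k' : B ⟶ M} {φ : Cell J d l (unit M)} {t : VCell l k}
    {φ' : Cell J d' l' (unit M)} {t' : VCell l' k'} (hφ : arr φ = arr φ') (ht : arr t = arr t') :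
    arr (ract φ t) = arr (ract φ' t') := by
  rw [arr_ract, arr_ract, arr_star_congr hφ ht]

theorem arr_hcomp_star {A' B' C' : K} {J' : Hor A' B'} {H' : Hor B' C'} {f : A' ⟶ A} {g : B' ⟶ B}
    {h : C' ⟶ C} {d : A ⟶ M} {l : B ⟶ M} {k : C ⟶ M} {d' : A' ⟶ M} {l' : B' ⟶ M} {k' : C' ⟶ M}
    {α : Cell J' f g J} {β : Cell H' g h H}
    {φ : Cell J d l (unit M)} {ψ : Cell H l k (unit M)}
    {φ' : Cell J' d' l' (unit M)} {ψ' : Cell H' l' k' (unit M)}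
    (hφ : arr α ≫ arr φ = arr φ') (hψ : arr β ≫ arr ψ = arr ψ') :
    arr (hcomp α β) ≫ arr (star φ ψ) = arr (star φ' ψ') := by
  rw [arr_star, arr_star, ← Category.assoc, arr_hcomp_comp _ _ _ _ _ _ hφ hψ]

theorem arr_star_unitCell {d : A ⟶ M} {l : B ⟶ M} {k : C ⟶ M} {d' : A ⟶ X} {l' : B ⟶ X} {k' : C ⟶ X}
    {φ : Cell J d l (unit M)} {ψ : Cell H l k (unit M)} {e : M ⟶ X}
    {φ' : Cell J d' l' (unit X)} {ψ' : Cell H l' k' (unit X)}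
    (hφ : arr φ ≫ arr (unitCell e) = arr φ') (hψ : arr ψ ≫ arr (unitCell e) = arr ψ') :
    arr (star φ ψ) ≫ arr (unitCell e) = arr (star φ' ψ') := by
  rw [arr_star, arr_star, Category.assoc, ← arr_lunit_naturality, ← Category.assoc,
    arr_hcomp_comp _ _ _ _ _ _ hφ hψ]

/-- By naturality of the associator and the triangle identity the two ways of collapsing the targets
differ only in `lunit (unit M)` versus `runit (unit M)`, and these agree. -/
theorem arr_star_star {d : A ⟶ M} {l : B ⟶ M} {k : C ⟶ M} {m : D ⟶ M}
    (φ : Cell J d l (unit M)) (ψ : Cell H l k (unit M)) (χ : Cell L k m (unit M)) :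
    arr (star (star φ ψ) χ) = arr (associator J H L) ≫ arr (star φ (star ψ χ)) := by
  rw [arr_star, arr_star φ,
    ← arr_hcomp_comp (hcomp φ ψ) χ (lunit (unit M)) (vid _) _ _ (arr_star _ _).symm (by simp),
    ← arr_hcomp_comp φ (hcomp ψ χ) (vid _) (lunit (unit M)) _ _ (by simp) (arr_star _ _).symm,
    ← Category.assoc, ← Category.assoc, ← arr_associator_naturality, Category.assoc (arr _)
        (arr _) (arr (hcomp _ (lunit _))),
    arr_triangle, arr_hcomp_congr (arr_lunit_unit M) rfl]

theorem arr_unitCell_star {f : A ⟶ M} {k : B ⟶ M} (φ : Cell J f k (unit M)) :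
    arr (star (unitCell f) φ) = arr (lunit J) ≫ arr φ := by
  rw [arr_star, arr_lunit_naturality]

theorem arr_star_unit {f : A ⟶ M} {k : B ⟶ M} (φ : Cell J f k (unit M)) :
    arr (star φ (unitCell k)) = arr (runit J) ≫ arr φ := by
  rw [arr_star, arr_lunit_unit, arr_runit_naturality]

theorem unitCell_lact {d : A ⟶ M} {l : B ⟶ M} (φ : Cell J d l (unit M)) :
    lact (unitCell d) φ = φ :=
  arr_injective (by rw [arr_lact, arr_unitCell_star, ← Category.assoc]; simp)

theorem ract_unitCell {d : A ⟶ M} {l : B ⟶ M} (φ : Cell J d l (unit M)) :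
    ract φ (unitCell l) = φ :=
  arr_injective (by rw [arr_ract, arr_star_unit, ← Category.assoc]; simp)

theorem arr_comp_lact {A' B' : K} {J' : Hor A' B'} {f : A' ⟶ A} {g : B' ⟶ B} {α : Cell J' f g J}
    {p d : A ⟶ M} {l : B ⟶ M} {p' d' : A' ⟶ M} {l' : B' ⟶ M}
    {s : VCell p d} {φ : Cell J d l (unit M)} {s' : VCell p' d'} {φ' : Cell J' d' l' (unit M)}
    (hs : arr (unitCell f) ≫ arr s = arr s') (hφ : arr α ≫ arr φ = arr φ') :
    arr α ≫ arr (lact s φ) = arr (lact s' φ') := by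
  rw [arr_lact, arr_lact, ← Category.assoc, ← arr_lunitInv_naturality, Category.assoc,
    arr_hcomp_star hs hφ]

theorem arr_comp_ract {A' B' : K} {J' : Hor A' B'} {f : A' ⟶ A} {g : B' ⟶ B} {α : Cell J' f g J}
    {d : A ⟶ M} {l k : B ⟶ M} {d' : A' ⟶ M} {l' k' : B' ⟶ M}
    {φ : Cell J d l (unit M)} {t : VCell l k} {φ' : Cell J' d' l' (unit M)} {t' : VCell l' k'}
    (hφ : arr α ≫ arr φ = arr φ') (ht : arr (unitCell g) ≫ arr t = arr t') :
    arr α ≫ arr (ract φ t) = arr (ract φ' t') := by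
  rw [arr_ract, arr_ract, ← Category.assoc, ← arr_runitInv_naturality, Category.assoc,
    arr_hcomp_star hφ ht]

theorem arr_lact_comp {p d : A ⟶ M} {l : B ⟶ M} {p' d' : A ⟶ X} {l' : B ⟶ X}
    {s : VCell p d} {φ : Cell J d l (unit M)} {e : M ⟶ X} {s' : VCell p' d'}
    {φ' : Cell J d' l' (unit X)}
    (hs : arr s ≫ arr (unitCell e) = arr s') (hφ : arr φ ≫ arr (unitCell e) = arr φ') :
    arr (lact s φ) ≫ arr (unitCell e) = arr (lact s' φ') := by
  rw [arr_lact, arr_lact, Category.assoc, arr_star_unitCell hs hφ]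

theorem arr_ract_comp {d : A ⟶ M} {l k : B ⟶ M} {d' : A ⟶ X} {l' k' : B ⟶ X}
    {φ : Cell J d l (unit M)} {t : VCell l k} {e : M ⟶ X} {φ' : Cell J d' l' (unit X)}
    {t' : VCell l' k'}
    (hφ : arr φ ≫ arr (unitCell e) = arr φ') (ht : arr t ≫ arr (unitCell e) = arr t') :
    arr (ract φ t) ≫ arr (unitCell e) = arr (ract φ' t') := by
  rw [arr_ract, arr_ract, Category.assoc, arr_star_unitCell hφ ht]

/-- A unit is inserted between `J` and `H` in both composites, attached to `H` in one and to `J` in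
the other; the triangle identity for inverses identifies the two insertions. -/
theorem star_lact {d : A ⟶ M} {l l' : B ⟶ M} {k : C ⟶ M}
    (φ : Cell J d l (unit M)) (s : VCell l l') (ψ : Cell H l' k (unit M)) :
    star φ (lact s ψ) = star (ract φ s) ψ :=
  arr_injective (by
    rw [← arr_hcomp_star (α := vid J) (β := lunitInv H) (φ := φ) (ψ := star s ψ) (by simp)
        (arr_lact s ψ).symm,
      ← arr_hcomp_star (α := runitInv J) (β := vid H) (φ := star φ s) (ψ := ψ)
        (arr_ract φ s).symm (by simp),
      arr_star_star, ← Category.assoc, ← arr_triangle_inv]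
    simp)

theorem lact_star {p d : A ⟶ M} {l : B ⟶ M} {k : C ⟶ M}
    (s : VCell p d) (φ : Cell J d l (unit M)) (ψ : Cell H l k (unit M)) :
    star (lact s φ) ψ = lact s (star φ ψ) :=
  arr_injective (by
    rw [← arr_hcomp_star (α := lunitInv J) (β := vid H) (φ := star s φ) (ψ := ψ)
        (arr_lact s φ).symm (by simp), arr_lact, arr_star_star, arr_lunitInv_compHor,
        Category.assoc])

theorem star_ract {d : A ⟶ M} {l : B ⟶ M} {k k' : C ⟶ M}
    (φ : Cell J d l (unit M)) (ψ : Cell H l k (unit M)) (t : VCell k k') :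
    star φ (ract ψ t) = ract (star φ ψ) t :=
  arr_injective (by
    rw [← arr_hcomp_star (α := vid J) (β := runitInv H) (φ := φ) (ψ := star ψ t) (by simp)
        (arr_ract ψ t).symm, arr_ract, arr_star_star, arr_runitInv_compHor,
        Category.assoc, ← Category.assoc (arr (associatorInv _ _ _))]
    simp)

theorem lact_vcell {f g h : A ⟶ M} (s : VCell f g) (t : VCell g h) : lact s t = ract s t :=
  arr_injective (by rw [arr_lact, arr_ract, arr_lunitInv_unit])

theorem VCell.comp_eq_lact {f g h : A ⟶ M} (s : VCell f g) (t : VCell g h) :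
    VCell.comp s t = lact s t :=
  arr_injective (by simp [VCell.comp, arr_lact, arr_star])

theorem lact_ract {p d : A ⟶ M} {l k : B ⟶ M} (s : VCell p d) (φ : Cell J d l (unit M))
    (t : VCell l k) : lact s (ract φ t) = ract (lact s φ) t :=
  arr_injective (by
    rw [arr_ract, lact_star]
    exact (arr_comp_lact (α := runitInv J) (by simp) (arr_ract φ t).symm).symm)

theorem lact_lact {p q d : A ⟶ M} {l : B ⟶ M} (s : VCell p q) (t : VCell q d)
    (φ : Cell J d l (unit M)) : lact s (lact t φ) = lact (lact s t) φ :=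
  arr_injective (by rw [arr_lact, star_lact, arr_lact (lact s t), lact_vcell])

theorem ract_ract {d : A ⟶ M} {l k m : B ⟶ M} (φ : Cell J d l (unit M)) (s : VCell l k)
    (t : VCell k m) : ract (ract φ s) t = ract φ (lact s t) :=
  arr_injective (by rw [arr_ract (ract φ s), ← star_lact, arr_ract])

/-- The interchange law for whiskering on the left. -/
theorem arr_comp_vcell_eq_lact {d : A ⟶ M} {l : B ⟶ M} {f g : M ⟶ X} {d' d'' : A ⟶ X} {l' : B ⟶ X}
    {φ : Cell J d l (unit M)} {s : VCell f g} {s' : VCell d' d''} {φ' : Cell J d'' l' (unit X)}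
    (hs : arr (unitCell d) ≫ arr s = arr s') (hφ : arr φ ≫ arr (unitCell g) = arr φ') :
    arr φ ≫ arr s = arr (lact s' φ') := by
  rw [← arr_comp_lact (α := φ) (s := s) (φ := unitCell g) hs hφ, lact_vcell, ract_unitCell]

/-- The interchange law for whiskering on the right. -/
theorem arr_comp_vcell_eq_ract {d : A ⟶ M} {l : B ⟶ M} {f g : M ⟶ X} {d' : A ⟶ X} {l' l'' : B ⟶ X}
    {φ : Cell J d l (unit M)} {s : VCell f g} {φ' : Cell J d' l' (unit X)} {s' : VCell l' l''}
    (hφ : arr φ ≫ arr (unitCell f) = arr φ') (hs : arr (unitCell l) ≫ arr s = arr s') :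
    arr φ ≫ arr s = arr (ract φ' s') := by
  rw [← arr_comp_ract (α := φ) (φ := unitCell f) (t := s) hφ hs, ← lact_vcell, unitCell_lact]

theorem VCell.isInvertible_iff {f g : A ⟶ M} (s : VCell f g) :
    s.IsInvertible ↔ ∃ t : VCell g f, lact s t = unitCell f ∧ lact t s = unitCell g := by
  simp only [VCell.IsInvertible, VCell.comp_eq_lact]

theorem isLeftKan_iff {d : A ⟶ M} {l : B ⟶ M} (η : Cell J d l (unit M)) :
    IsLeftKan η ↔ ∀ (k : B ⟶ M) (φ : Cell J d k (unit M)), ∃! t : VCell l k, ract η t = φ := by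
  have h (k : B ⟶ M) (t : VCell l k) : ract η t = vcomp (vcomp (runitInv J) (hcomp η t) rfl rfl)
      (lunit (unit M)) (by simp) (by simp) := arr_injective (by simp [arr_ract, arr_star])
  simp only [IsLeftKan, h]

end

end Star

section Cartesian

variable {K : Type u} [DoubleCategory.{w, x, v, u} K]
variable {A B C D X Y M : K}

theorem HCell.isInvertible_iff {J L : Hor A B} (φ : HCell J L) :
    φ.IsInvertible ↔ ∃ ψ : HCell L J, arr φ ≫ arr ψ = 𝟙 _ ∧ arr ψ ≫ arr φ = 𝟙 _ := by
  simp only [HCell.IsInvertible, arr_vcomp_eq_iff, arr_vid]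

/-! ### Cartesian cells -/

theorem IsCartesian.exists_lift {J : Hor A B} {f : A ⟶ C} {g : B ⟶ D} {L : Hor C D}
    {φ : Cell J f g L} (hφ : IsCartesian φ) {H : Hor X Y} (h : X ⟶ A) (k : Y ⟶ B) {p : X ⟶ C}
    {q : Y ⟶ D} (χ : Cell H p q L) (hp : h ≫ f = p) (hq : k ≫ g = q) :
    ∃ ψ : Cell H h k J, arr ψ ≫ arr φ = arr χ := by
  subst hp hq
  obtain ⟨ψ, h, -⟩ := hφ H h k χ
  exact ⟨ψ, arr_vcomp_eq_iff.1 h⟩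

theorem IsCartesian.hom_ext {J : Hor A B} {f : A ⟶ C} {g : B ⟶ D} {L : Hor C D}
    {φ : Cell J f g L} (hφ : IsCartesian φ) {H : Hor X Y} {h : X ⟶ A} {k : Y ⟶ B}
    {ψ ψ' : Cell H h k J} (e : arr ψ ≫ arr φ = arr ψ' ≫ arr φ) : ψ = ψ' :=
  (hφ H h k (vcomp ψ' φ rfl rfl)).unique (arr_injective (by simpa using e)) rfl

theorem isCartesian_of {J : Hor A B} {f : A ⟶ C} {g : B ⟶ D} {L : Hor C D} {φ : Cell J f g L}
    (lift : ∀ ⦃X Y : K⦄ (H : Hor X Y) (h : X ⟶ A) (k : Y ⟶ B) (χ : Cell H (h ≫ f) (k ≫ g) L),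
      ∃ ψ : Cell H h k J, arr ψ ≫ arr φ = arr χ)
    (ext : ∀ ⦃X Y : K⦄ (H : Hor X Y) (h : X ⟶ A) (k : Y ⟶ B) (ψ ψ' : Cell H h k J),
      arr ψ ≫ arr φ = arr ψ' ≫ arr φ → ψ = ψ') : IsCartesian φ := by
  intro X Y H h k χ
  obtain ⟨ψ, hψ⟩ := lift H h k χ
  exact ⟨ψ, arr_vcomp_eq_iff.2 hψ, fun ψ' hψ' =>
    ext _ _ _ _ _ ((arr_vcomp_eq_iff.1 hψ').trans hψ.symm)⟩

theorem IsCartesian.congr {J : Hor A B} {f f' : A ⟶ C} {g g' : B ⟶ D} {L : Hor C D}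
    {φ : Cell J f g L} {φ' : Cell J f' g' L} (hφ : IsCartesian φ) (h : arr φ = arr φ') :
    IsCartesian φ' := by
  have h₁ : f = f' := congrArg Square.left h
  have h₂ : g = g' := congrArg Square.right h
  subst h₁ h₂
  rwa [← arr_injective h]

theorem IsCartesian.comp {X' Y' : K} {J : Hor A B} {f : A ⟶ C} {g : B ⟶ D} {L : Hor C D}
    {f' : C ⟶ X'} {g' : D ⟶ Y'}
    {N : Hor X' Y'} {p : A ⟶ X'} {q : B ⟶ Y'} {φ : Cell J f g L} {ψ : Cell L f' g' N}
    (hφ : IsCartesian φ) (hψ : IsCartesian ψ) {χ : Cell J p q N}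
    (e : arr φ ≫ arr ψ = arr χ) : IsCartesian χ := by
  refine IsCartesian.congr (φ := vcomp φ ψ rfl rfl) (isCartesian_of ?_ ?_) (by simpa using e)
  · intro X Y H h k χ
    obtain ⟨χ₁, h₁⟩ := hψ.exists_lift (h ≫ f) (k ≫ g) χ (by simp) (by simp)
    obtain ⟨χ₂, h₂⟩ := hφ.exists_lift h k χ₁ rfl rfl
    exact ⟨χ₂, by rw [arr_vcomp, ← Category.assoc, h₂, h₁]⟩
  · intro X Y H h k χ χ' e
    apply hφ.hom_ext
    have := hψ.hom_ext (ψ := vcomp χ φ rfl rfl) (ψ' := vcomp χ' φ rfl rfl) (by simpa using e)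
    simpa using congrArg arr this

theorem HCell.IsInvertible.isCartesian {J L : Hor A B} {φ : HCell J L} (hφ : φ.IsInvertible) :
    IsCartesian φ := by
  obtain ⟨ψ, h₁, h₂⟩ := (HCell.isInvertible_iff φ).1 hφ
  refine isCartesian_of ?_ ?_
  · intro X Y H h k χ
    exact ⟨vcomp χ ψ (by simp) (by simp), by simp [h₂]⟩
  · intro X Y H h k χ χ' e
    apply arr_injective
    simpa [h₁] using congrArg (· ≫ arr ψ) e

/-- Restrictions are unique up to isomorphism. This is the means by which the cells `ιStar` are
recognised as invertible. -/
theorem IsCartesian.isInvertible {J J' : Hor A B} {f : A ⟶ C} {g : B ⟶ D} {L : Hor C D}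
    {φ : Cell J f g L} {φ' : Cell J' f g L} (hφ : IsCartesian φ) (hφ' : IsCartesian φ')
    {ν : HCell J J'} (e : arr ν ≫ arr φ' = arr φ) : ν.IsInvertible := by
  obtain ⟨μ, hμ⟩ := hφ.exists_lift (𝟙 _) (𝟙 _) φ' (by simp) (by simp)
  refine (HCell.isInvertible_iff ν).2 ⟨μ, ?_, ?_⟩
  · have := hφ.hom_ext (ψ := ν.comp μ) (ψ' := vid _) (by simp [hμ, e])
    simpa using congrArg arr this
  · have := hφ'.hom_ext (ψ := HCell.comp μ ν) (ψ' := vid _) (by simp [hμ, e])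
    simpa using congrArg arr this

/-- The right action commutes with precomposition, so factoring `χ` through `ract φ s` amounts to
factoring through `φ` the cell obtained from `χ` by acting with the whiskered inverse of `s`. -/
theorem IsCartesian.ract {J : Hor A B} {f : A ⟶ C} {g g' : B ⟶ C} {φ : Cell J f g (unit C)}
    (hφ : IsCartesian φ) {s : VCell g g'} (hs : s.IsInvertible) : IsCartesian (ract φ s) := by
  obtain ⟨t, h₁, h₂⟩ := (VCell.isInvertible_iff s).1 hs
  have pre {E F : K} {k : E ⟶ F} {m n : F ⟶ C} {a : VCell m n} {b : VCell n m}
      (hab : lact a b = unitCell m) :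
      lact (vcomp (unitCell k) a rfl rfl) (vcomp (unitCell k) b rfl rfl) = unitCell (k ≫ m) :=
    arr_injective (by
      rw [← arr_comp_lact (α := unitCell k) (s := a) (φ := b) (by simp) (by simp), hab,
        arr_unitCell_comp])
  refine isCartesian_of ?_ ?_
  · intro X Y H h k χ
    obtain ⟨ψ, hψ⟩ := hφ.exists_lift h k
      (DoubleCategory.ract χ (vcomp (unitCell k) t rfl rfl)) rfl rfl
    refine ⟨ψ, ?_⟩
    rw [arr_comp_ract (t' := vcomp (unitCell k) s rfl rfl) hψ (by simp), ract_ract, pre h₂,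
      ract_unitCell]
  · intro X Y H h k χ χ' e
    apply hφ.hom_ext
    rw [arr_comp_ract (φ' := vcomp χ φ rfl rfl) (t' := vcomp (unitCell k) s rfl rfl) (by simp)
        (by simp),
      arr_comp_ract (φ' := vcomp χ' φ rfl rfl) (t' := vcomp (unitCell k) s rfl rfl) (by simp)
        (by simp)] at e
    have := congrArg (DoubleCategory.ract · (vcomp (unitCell k) t rfl rfl)) (arr_injective e)
    simp only [ract_ract] at this
    rw [pre h₁, ract_unitCell, ract_unitCell] at this
    simpa using congrArg arr this

/-! ### Companions and conjoints -/

theorem Companion.arr_fac {f : A ⟶ C} (c : Companion f) :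
    arr c.opcart ≫ arr c.cart = arr (unitCell f) := by
  rw [← c.fac, arr_vcomp]

theorem arr_runit_comp_unit {J : Hor A B} {f : A ⟶ M} {k : B ⟶ M} (φ : Cell J f k (unit M)) :
    arr (runit J) ≫ arr φ = arr (star φ (unitCell k)) :=
  (arr_star_unit φ).symm

/-- A companion is given with one of its two identities, `fac`. The other holds because both sides
agree after composition with the cartesian cell. -/
theorem Companion.zigzag {f : A ⟶ C} (c : Companion f) :
    arr (lunitInv c.hor) ≫ arr (hcomp c.opcart c.cart) ≫ arr (runit c.hor) = 𝟙 _ := by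
  have := c.isCartesian.hom_ext (ψ' := vid _) (ψ := (vcomp (lunitInv c.hor)
    (vcomp (hcomp c.opcart c.cart) (runit c.hor) rfl rfl) (by simp) (by simp) : HCell _ _)) (by
      simp only [arr_vcomp, Category.assoc]
      rw [arr_runit_comp_unit, arr_hcomp_star (φ' := unitCell f) (ψ' := c.cart) c.arr_fac (by simp),
        arr_unitCell_star, ← Category.assoc]
      simp)
  simpa using congrArg arr this

/-- The two companion identities are equations, which a normal lax double functor preserves, whereas
the universal property is not visibly preserved; this converse recovers it. The factorisation of `χ`
is the horizontal composite of `opcart`, whiskered by `h`, with `χ`. -/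
theorem isCartesian_of_zigzag {f : A ⟶ C} {J : Hor A C} {cart : Cell J f (𝟙 C) (unit C)}
    {opcart : Cell (unit A) (𝟙 A) f J} (fac : arr opcart ≫ arr cart = arr (unitCell f))
    (zigzag : arr (lunitInv J) ≫ arr (hcomp opcart cart) ≫ arr (runit J) = 𝟙 _) :
    IsCartesian cart := by
  refine isCartesian_of ?_ ?_
  · intro X Y H h k χ
    refine ⟨vcomp (vcomp (lunitInv H) (hcomp (vcomp (unitCell h) opcart rfl rfl) χ) rfl rfl)
      (runit J) (by simp) (by simp), ?_⟩
    simp only [arr_vcomp, Category.assoc]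
    rw [arr_runit_comp_unit, arr_hcomp_star (φ' := unitCell (h ≫ f)) (ψ' := χ)
      (by rw [arr_vcomp, Category.assoc, fac, arr_unitCell_comp]) (by simp), arr_unitCell_star,
      ← Category.assoc]
    simp
  · intro X Y H h k ψ ψ' e
    have key (χ : Cell H h k J) : arr χ = arr (lunitInv H) ≫ arr (hcomp (vcomp
        (unitCell h) opcart rfl rfl)
        (vcomp χ cart rfl rfl)) ≫ arr (runit J) := by
      rw [← arr_hcomp_comp (unitCell h) χ opcart cart _ _ (by simp) (by simp), ← Category.assoc,
        ← Category.assoc, arr_lunitInv_naturality, Category.assoc, Category.assoc, zigzag,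
        Category.comp_id]
    have e' : arr (vcomp ψ cart rfl rfl) = arr (vcomp ψ' cart rfl rfl) := by simpa using e
    apply arr_injective
    rw [key ψ, key ψ', arr_hcomp_congr rfl e']

/-- A conjoint `g^*` of `g : B ⟶ D`: a restriction of the unit `1_D` along `id_D` and `g`, together
with the corresponding opcartesian cell. -/
structure Conjoint (g : B ⟶ D) where
  hor : Hor D B
  cart : Cell hor (𝟙 D) g (unit D)
  isCartesian : IsCartesian cart
  opcart : Cell (unit B) g (𝟙 B) hor
  arr_fac : arr opcart ≫ arr cart = arr (unitCell g)

theorem nonempty_companion [IsEquipment K] (f : A ⟶ C) : Nonempty (Companion f) := by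
  obtain ⟨J, φ, hφ⟩ := IsEquipment.exists_restriction f (𝟙 C) (unit C)
  obtain ⟨ψ, hψ⟩ := hφ.exists_lift (𝟙 A) f (unitCell f) (by simp) (by simp)
  exact ⟨J, φ, hφ, ψ, arr_vcomp_eq_iff.2 hψ⟩

theorem nonempty_conjoint [IsEquipment K] (g : B ⟶ D) : Nonempty (Conjoint g) := by
  obtain ⟨J, φ, hφ⟩ := IsEquipment.exists_restriction (𝟙 D) g (unit D)
  obtain ⟨ψ, hψ⟩ := hφ.exists_lift g (𝟙 B) (unitCell g) (by simp) (by simp)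
  exact ⟨J, φ, hφ, ψ, hψ⟩

theorem arr_lunit_comp_unit {J : Hor A B} {f : A ⟶ M} {k : B ⟶ M} (φ : Cell J f k (unit M)) :
    arr (lunit J) ≫ arr φ = arr (star (unitCell f) φ) :=
  (arr_unitCell_star φ).symm

theorem Conjoint.zigzag {g : B ⟶ D} (c : Conjoint g) :
    arr (runitInv c.hor) ≫ arr (hcomp c.cart c.opcart) ≫ arr (lunit c.hor) = 𝟙 _ := by
  have := c.isCartesian.hom_ext (ψ' := vid _) (ψ := (vcomp (runitInv c.hor)
    (vcomp (hcomp c.cart c.opcart) (lunit c.hor) rfl rfl) (by simp) (by simp) : HCell _ _)) (by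
      simp only [arr_vcomp, Category.assoc]
      rw [arr_lunit_comp_unit, arr_hcomp_star (φ' := c.cart) (ψ' := unitCell g) (by simp) c.arr_fac,
        arr_star_unit, ← Category.assoc]
      simp)
  simpa using congrArg arr this

theorem isCartesian_of_conjoint_zigzag {g : B ⟶ D} {J : Hor D B} {cart : Cell J (𝟙 D) g (unit D)}
    {opcart : Cell (unit B) g (𝟙 B) J} (fac : arr opcart ≫ arr cart = arr (unitCell g))
    (zigzag : arr (runitInv J) ≫ arr (hcomp cart opcart) ≫ arr (lunit J) = 𝟙 _) :
    IsCartesian cart := by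
  refine isCartesian_of ?_ ?_
  · intro X Y H h k χ
    refine ⟨vcomp (vcomp (runitInv H) (hcomp χ (vcomp (unitCell k) opcart rfl rfl)) rfl rfl)
      (lunit J) (by simp) (by simp), ?_⟩
    simp only [arr_vcomp, Category.assoc]
    rw [arr_lunit_comp_unit, arr_hcomp_star (φ' := χ) (ψ' := unitCell (k ≫ g)) (by simp)
      (by rw [arr_vcomp, Category.assoc, fac, arr_unitCell_comp]), arr_star_unit,
      ← Category.assoc]
    simp
  · intro X Y H h k ψ ψ' e
    have key (χ : Cell H h k J) : arr χ = arr (runitInv H) ≫ arr (hcomp (vcomp χ cart rfl rfl)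
        (vcomp (unitCell k) opcart rfl rfl)) ≫ arr (lunit J) := by
      rw [← arr_hcomp_comp χ (unitCell k) cart opcart _ _ (by simp) (by simp), ← Category.assoc,
        ← Category.assoc, arr_runitInv_naturality, Category.assoc, Category.assoc, zigzag,
        Category.comp_id]
    have e' : arr (vcomp ψ cart rfl rfl) = arr (vcomp ψ' cart rfl rfl) := by simpa using e
    apply arr_injective
    rw [key ψ, key ψ', arr_hcomp_congr e' rfl]

/-- The cartesian cell `f_* ⊙ L ⇒ L`. -/
def Companion.restr {f : A ⟶ C} (c : Companion f) (L : Hor C D) :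
    Cell (compHor c.hor L) f (𝟙 D) L :=
  vcomp (hcomp c.cart (vid L)) (lunit L) (Category.comp_id _) (Category.comp_id _)

theorem Companion.restr_zigzag {f : A ⟶ C} (c : Companion f) (L : Hor C D) :
    arr (lunitInv (compHor c.hor L)) ≫ arr (hcomp c.opcart (c.restr L)) = 𝟙 _ := by
  rw [← arr_hcomp_comp c.opcart (hcomp c.cart (vid L)) (vid _) (lunit L) c.opcart (c.restr L)
    (by simp) (by simp [restr]), arr_lunitInv_compHor, Category.assoc,
    ← Category.assoc (arr (associator _ _ _)), ← arr_associator_naturality, Category.assoc,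
    arr_triangle,
    arr_hcomp_comp _ _ _ _ (vcomp (hcomp c.opcart c.cart) (runit c.hor) (Category.comp_id _)
      (Category.comp_id _)) (vid L) (by simp) (by simp),
    arr_hcomp_comp _ _ _ _ (vid _) (vid L) (by simpa using c.zigzag) (by simp), arr_hcomp_vid]

/-- Existence of factorisations comes from placing `c.opcart` to the left of the given cell,
uniqueness from `restr_zigzag`, which rebuilds any cell into `f_* ⊙ L` from its composite with
`c.restr L`. -/
theorem Companion.isCartesian_restr {f : A ⟶ C} (c : Companion f) (L : Hor C D) :
    IsCartesian (c.restr L) := by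
  refine isCartesian_of ?_ ?_
  · intro X Y H h k χ
    refine ⟨vcomp (lunitInv H) (hcomp (vcomp (unitCell h) c.opcart (Category.comp_id _) rfl)
      (vcomp χ (vid L) (q := k) (Category.comp_id _) (by simp))) (by simp) (by simp), ?_⟩
    rw [arr_vcomp, restr, arr_vcomp, Category.assoc, ← Category.assoc (arr (hcomp _ _)),
      arr_hcomp_comp _ _ _ _ (unitCell (h ≫ f)) χ
      (by rw [arr_vcomp, Category.assoc, c.arr_fac, arr_unitCell_comp]) (by simp),
      arr_lunit_naturality, ← Category.assoc]
    simp
  · intro X Y H h k ψ ψ' e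
    have key (χ : Cell H h k (compHor c.hor L)) : arr χ = arr (lunitInv H) ≫
        arr (hcomp (vcomp (unitCell h) c.opcart rfl rfl) (vcomp χ (c.restr L) rfl rfl)) := by
      rw [← arr_hcomp_comp (unitCell h) χ c.opcart (c.restr L) _ _ (by simp) (by simp),
        ← Category.assoc, arr_lunitInv_naturality, Category.assoc, c.restr_zigzag,
        Category.comp_id]
    have e' : arr (vcomp ψ (c.restr L) rfl rfl) = arr (vcomp ψ'
        (c.restr L) rfl rfl) := by simpa using e
    apply arr_injective
    rw [key ψ, key ψ', arr_hcomp_congr rfl e']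

/-- The cartesian cell `L ⊙ g^* ⇒ L`. -/
def Conjoint.restr {g : B ⟶ D} (c : Conjoint g) (L : Hor C D) :
    Cell (compHor L c.hor) (𝟙 C) g L :=
  vcomp (hcomp (vid L) c.cart) (runit L) (Category.comp_id _) (Category.comp_id _)

theorem arr_associatorInv_hcomp_runit {A B C : K} (J : Hor A B) (H : Hor B C) :
    arr (associatorInv J (unit B) H) ≫ arr (hcomp (runit J) (vid H)) =
      arr (hcomp (vid J) (lunit H)) := by
  rw [← arr_triangle, ← Category.assoc, arr_associatorInv_associator, Category.id_comp]

theorem Conjoint.restr_zigzag {g : B ⟶ D} (c : Conjoint g) (L : Hor C D) :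
    arr (runitInv (compHor L c.hor)) ≫ arr (hcomp (c.restr L) c.opcart) = 𝟙 _ := by
  rw [← arr_hcomp_comp (hcomp (vid L) c.cart) c.opcart (runit L) (vid _) (c.restr L) c.opcart
    (by simp [restr]) (by simp), arr_runitInv_compHor, Category.assoc,
    ← Category.assoc (arr (associatorInv _ _ _)), ← arr_associatorInv_naturality, Category.assoc,
    arr_associatorInv_hcomp_runit,
    arr_hcomp_comp _ _ _ _ (vid L) (vcomp (hcomp c.cart c.opcart) (lunit c.hor)
      (Category.comp_id _) (Category.comp_id _)) (by simp) (by simp),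
    arr_hcomp_comp _ _ _ _ (vid L) (vid _) (by simp) (by simpa using c.zigzag), arr_hcomp_vid]

theorem Conjoint.isCartesian_restr {g : B ⟶ D} (c : Conjoint g) (L : Hor C D) :
    IsCartesian (c.restr L) := by
  refine isCartesian_of ?_ ?_
  · intro X Y H h k χ
    refine ⟨vcomp (runitInv H) (hcomp (vcomp χ (vid L) (p := h) (by simp) (Category.comp_id _))
      (vcomp (unitCell k) c.opcart rfl (Category.comp_id _))) (by simp) (by simp), ?_⟩
    rw [arr_vcomp, restr, arr_vcomp, Category.assoc, ← Category.assoc (arr (hcomp _ _)),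
      arr_hcomp_comp _ _ _ _ χ (unitCell (k ≫ g)) (by simp)
      (by rw [arr_vcomp, Category.assoc, c.arr_fac, arr_unitCell_comp]),
      arr_runit_naturality, ← Category.assoc]
    simp
  · intro X Y H h k ψ ψ' e
    have key (χ : Cell H h k (compHor L c.hor)) : arr χ = arr (runitInv H) ≫
        arr (hcomp (vcomp χ (c.restr L) rfl rfl) (vcomp (unitCell k) c.opcart rfl rfl)) := by
      rw [← arr_hcomp_comp χ (unitCell k) (c.restr L) c.opcart _ _ (by simp) (by simp),
        ← Category.assoc, arr_runitInv_naturality, Category.assoc, c.restr_zigzag,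
        Category.comp_id]
    have e' : arr (vcomp ψ (c.restr L) rfl rfl) = arr (vcomp ψ'
        (c.restr L) rfl rfl) := by simpa using e
    apply arr_injective
    rw [key ψ, key ψ', arr_hcomp_congr e' rfl]

theorem Companion.arr_star_cart {f : A ⟶ C} (c : Companion f) {H : Hor C B} {l : B ⟶ C}
    (φ : Cell H (𝟙 C) l (unit C)) : arr (star c.cart φ) = arr (c.restr H) ≫ arr φ := by
  rw [restr, arr_vcomp, Category.assoc, arr_lunit_comp_unit,
    arr_hcomp_star (φ' := c.cart) (ψ' := φ) (by simp) (by simp)]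

/-- The cell `f_* ⊙ g^* ⇒ 1` is cartesian. -/
theorem isCartesian_star_companion_conjoint {f : A ⟶ C} {g : B ⟶ C} (c : Companion f)
    (e : Conjoint g) : IsCartesian (star c.cart e.cart) :=
  (c.isCartesian_restr e.hor).comp e.isCartesian (c.arr_star_cart e.cart).symm

/-- The cell `J ⇒ J ⊙ j_*` -/
def Companion.opRestr {j : A ⟶ B} (c : Companion j) (J : Hor X A) :
    Cell J (𝟙 X) j (compHor J c.hor) :=
  vcomp (runitInv J) (hcomp (vid J) c.opcart) (Category.comp_id _) (Category.id_comp _)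

/-- Full faithfulness of `j` says that `1_A ≅ j_* ⊙ j^*`. Hence `J ≅ (J ⊙ j_*) ⊙ j^*`, and the
right-hand side is the restriction of `J ⊙ j_*` along `j`. -/
theorem Companion.isCartesian_opRestr [IsEquipment K] {j : A ⟶ B} (c : Companion j)
    (hj : IsFullyFaithful j)
    (J : Hor X A) : IsCartesian (c.opRestr J) := by
  obtain ⟨e⟩ := nonempty_conjoint j
  -- `κ` compares two restrictions of `1_B` along `j` on both sides: `1_A`, by full faithfulness,
  -- and `j_* ⊙ j^*`.
  let κ : HCell (unit A) (compHor c.hor e.hor) :=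
    vcomp (lunitInv (unit A)) (hcomp c.opcart e.opcart) (Category.comp_id _) (Category.comp_id _)
  have hκ : κ.IsInvertible := hj.isInvertible (isCartesian_star_companion_conjoint c e) (by
    rw [arr_vcomp, Category.assoc, arr_hcomp_star (φ' := unitCell j) (ψ' := unitCell j) c.arr_fac
      e.arr_fac, arr_unitCell_star, ← Category.assoc]
    simp)
  obtain ⟨κ', h₁, h₂⟩ := (HCell.isInvertible_iff κ).1 hκ
  let n : HCell J (compHor (compHor J c.hor) e.hor) :=
    (HCell.comp (runitInv J) (hcomp (vid J) κ)).comp (associatorInv J c.hor e.hor)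
  have hn : n.IsInvertible := by
    refine (HCell.isInvertible_iff n).2 ⟨HCell.comp (associator J c.hor e.hor) (HCell.comp
      (hcomp (vid J) κ') (runit J)), ?_, ?_⟩
    · simp only [n, HCell.comp, arr_vcomp, Category.assoc]
      rw [← Category.assoc (arr (associatorInv _ _ _)), arr_associatorInv_associator,
        Category.id_comp, ← Category.assoc (arr (hcomp _ _)),
        arr_hcomp_comp _ _ _ _ (vid J) (vid _) (by simp) (by simpa using h₁), arr_hcomp_vid]
      simp
    · simp only [n, HCell.comp, arr_vcomp, Category.assoc]
      rw [← Category.assoc (arr (runit _)), arr_runit_inv,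
        Category.id_comp, ← Category.assoc (arr (hcomp _ _)),
        arr_hcomp_comp _ _ _ _ (vid J) (vid _) (by simp) (by simpa using h₂), arr_hcomp_vid]
      simp
  refine hn.isCartesian.comp (e.isCartesian_restr (compHor J c.hor)) ?_
  -- Cancelling `j^*` against its cartesian cell turns `κ` back into the opcartesian cell of `j_*`;
  -- this identifies `n` followed by the restriction cell with `c.opRestr J`.
  have h : arr κ ≫ arr (hcomp (vid c.hor) e.cart) ≫ arr (runit c.hor) = arr c.opcart := by
    rw [arr_vcomp, Category.assoc, ← Category.assoc (arr (hcomp c.opcart _)),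
      arr_hcomp_comp _ _ _ _ c.opcart (unitCell j) (by simp) e.arr_fac, arr_runit_naturality,
      arr_lunitInv_unit, ← Category.assoc]
    simp
  simp only [n, HCell.comp, opRestr, Conjoint.restr, arr_vcomp, Category.assoc]
  rw [← hcomp_vid, ← Category.assoc (arr (associatorInv _ _ _)), ← arr_associatorInv_naturality,
    Category.assoc, arr_runit_compHor, ← Category.assoc (arr (associatorInv _ _ _)),
    arr_associatorInv_associator, Category.id_comp,
    arr_hcomp_comp _ _ _ _ (vid J) (vcomp (hcomp (vid c.hor) e.cart) (runit c.hor)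
      (Category.comp_id _) (Category.comp_id _)) (by simp) (by simp),
    arr_hcomp_comp _ _ _ _ (vid J) c.opcart (by simp) (by simpa using h)]

/-! ### Cells out of a companion -/

/-- The cell `f_* ⇒ 1_M` corresponding to a vertical cell `p ⇒ q ∘ f`. -/
def Companion.desc {f : A ⟶ C} (c : Companion f) {p r : A ⟶ M} {q : C ⟶ M} (s : VCell p r)
    (hr : f ≫ q = r) : Cell c.hor p q (unit M) :=
  lact s (vcomp c.cart (unitCell q) hr (Category.id_comp q))

theorem Companion.arr_opcart_desc {f : A ⟶ C} (c : Companion f) {p r : A ⟶ M} {q : C ⟶ M}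
    (s : VCell p r) (hr : f ≫ q = r) : arr c.opcart ≫ arr (c.desc s hr) = arr s := by
  rw [desc, arr_comp_lact (s' := s) (φ' := unitCell r) (by simp) (by
    rw [arr_vcomp, ← Category.assoc, c.arr_fac, ← hr, arr_unitCell_comp]), lact_vcell,
    ract_unitCell]

/-- The zigzag identity inserts `opcart ⊙ cart` in front of `φ`, which exhibits `φ` as determined by
its composite with `opcart`. -/
theorem Companion.arr_eq_desc {f : A ⟶ C} (c : Companion f) {p : A ⟶ M} {q : C ⟶ M}
    (φ : Cell c.hor p q (unit M)) :
    φ = c.desc (vcomp c.opcart φ (Category.id_comp p) rfl) rfl := by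
  apply arr_injective
  rw [desc, arr_lact, ← Category.id_comp (arr φ), ← c.zigzag, Category.assoc, Category.assoc,
    arr_runit_comp_unit, arr_hcomp_star (φ' := vcomp c.opcart φ (Category.id_comp p) rfl)
      (ψ' := vcomp c.cart (unitCell q) rfl (Category.id_comp q)) (by simp) (by simp)]

theorem Companion.desc_hom_ext {f : A ⟶ C} (c : Companion f) {p : A ⟶ M} {q : C ⟶ M}
    {φ φ' : Cell c.hor p q (unit M)} (h : arr c.opcart ≫ arr φ = arr c.opcart ≫ arr φ') :
    φ = φ' := by
  rw [c.arr_eq_desc φ, c.arr_eq_desc φ']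
  congr 1
  exact arr_injective (by simpa using h)

theorem Companion.arr_desc_comp {f : A ⟶ C} (c : Companion f) {p r : A ⟶ M} {q : C ⟶ M}
    (s : VCell p r) (hr : f ≫ q = r) {e : M ⟶ X} {p' r' : A ⟶ X} {q' : C ⟶ X} {s' : VCell p' r'}
    (hr' : f ≫ q' = r') (hq : q ≫ e = q') (hs : arr s ≫ arr (unitCell e) = arr s') :
    arr (c.desc s hr) ≫ arr (unitCell e) = arr (c.desc s' hr') :=
  arr_lact_comp hs (by
    rw [arr_vcomp, arr_vcomp, Category.assoc, ← arr_unitCell_comp, arr_unitCell_congr hq])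

end Cartesian

section Kan

variable {K : Type u} [DoubleCategory.{w, x, v, u} K]
variable {A B C D X Y M P : K}

/-! ### Kan extensions -/

theorem IsPointwiseLeftKan.isLeftKan {J : Hor A B} {d : A ⟶ M} {l : B ⟶ M}
    {η : Cell J d l (unit M)} (hη : IsPointwiseLeftKan η) : IsLeftKan η := by
  rw [isLeftKan_iff]
  intro k φ
  obtain ⟨t, ht, huniq⟩ := hη (unit B) k (vcomp (runit J) φ (Category.id_comp d)
      (Category.id_comp k))
  change star η t = _ at ht
  refine ⟨t, arr_injective ?_, fun t' ht' => huniq t' ?_⟩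
  · rw [arr_ract, ht, arr_vcomp, ← Category.assoc]
    simp
  · change star η t' = _
    rw [← ht']
    apply arr_injective
    rw [arr_vcomp, arr_ract, ← Category.assoc]
    simp

/-- Only the first factor has to be pointwise: it converts cells out of `J ⊙ H` into cells out of
`H`, where the ordinary universal property of `θ` applies. This is why an ordinary Kan extension
suffices as hypothesis in part (1). -/
theorem IsPointwiseLeftKan.star_isLeftKan {J : Hor A B} {H : Hor B C} {d : A ⟶ M} {l : B ⟶ M}
    {k : C ⟶ M} {η : Cell J d l (unit M)} (hη : IsPointwiseLeftKan η) {θ : Cell H l k (unit M)}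
    (hθ : IsLeftKan θ) : IsLeftKan (star η θ) := by
  rw [isLeftKan_iff] at hθ ⊢
  intro k' φ
  obtain ⟨ψ, hψ, hψu⟩ := hη H k' φ
  obtain ⟨t, ht, htu⟩ := hθ k' ψ
  refine ⟨t, ?_, fun t' ht' => htu t' (hψu _ ?_)⟩
  · change ract (star η θ) t = φ
    rw [← star_ract, ht]
    exact hψ
  · change star η (ract θ t') = φ
    rw [star_ract]
    exact ht'

theorem arr_associatorInv_star_star {J : Hor A B} {H : Hor B C} {L : Hor C D}
    {d : A ⟶ M} {l : B ⟶ M} {k : C ⟶ M} {m : D ⟶ M}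
    (φ : Cell J d l (unit M)) (ψ : Cell H l k (unit M)) (χ : Cell L k m (unit M)) :
    arr (associatorInv J H L) ≫ arr (star (star φ ψ) χ) = arr (star φ (star ψ χ)) := by
  rw [arr_star_star, ← Category.assoc, arr_associatorInv_associator, Category.id_comp]

/-- Pasting of pointwise left Kan extensions. -/
theorem IsPointwiseLeftKan.star_iff {J : Hor A B} {H : Hor B C} {d : A ⟶ M} {l : B ⟶ M}
    {k : C ⟶ M} {η : Cell J d l (unit M)} (hη : IsPointwiseLeftKan η) {θ : Cell H l k (unit M)} :
    IsPointwiseLeftKan (star η θ) ↔ IsPointwiseLeftKan θ := by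
  constructor
  · intro h E L m φ
    obtain ⟨ψ, hψ, hψu⟩ := h L m (vcomp (associator J H L) (star η φ) (Category.id_comp _)
      (Category.id_comp _))
    change star (star η θ) ψ = _ at hψ
    refine ⟨ψ, (hη _ m (star η φ)).unique ?_ rfl, fun ψ' hψ' => hψu ψ' ?_⟩
    · change star η (star θ ψ) = star η φ
      apply arr_injective
      rw [← arr_associatorInv_star_star, hψ, arr_vcomp, ← Category.assoc]
      simp
    · change star (star η θ) ψ' = _
      change star θ ψ' = φ at hψ'
      apply arr_injective
      rw [arr_star_star, hψ', arr_vcomp]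
  · intro h E L m φ
    obtain ⟨ψ, hψ, hψu⟩ := hη (compHor H L) m (vcomp (associatorInv J H L) φ (Category.id_comp _)
      (Category.id_comp _))
    change star η ψ = _ at hψ
    obtain ⟨χ, hχ, hχu⟩ := h L m ψ
    change star θ χ = _ at hχ
    refine ⟨χ, ?_, fun χ' hχ' => hχu χ' (hψu _ ?_)⟩
    · change star (star η θ) χ = φ
      apply arr_injective
      rw [arr_star_star, hχ, hψ, arr_vcomp, ← Category.assoc]
      simp
    · change star η (star θ χ') = _
      change star (star η θ) χ' = _ at hχ'
      apply arr_injective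
      rw [← arr_associatorInv_star_star, hχ', arr_vcomp]

theorem IsPointwiseLeftKan.ract {J : Hor A B} {d : A ⟶ M} {l l' : B ⟶ M} {η : Cell J d l (unit M)}
    (hη : IsPointwiseLeftKan η) {s : VCell l l'} (hs : s.IsInvertible) :
    IsPointwiseLeftKan (ract η s) := by
  obtain ⟨t, h₁, h₂⟩ := (VCell.isInvertible_iff s).1 hs
  intro E H k φ
  obtain ⟨ψ, hψ, hψu⟩ := hη H k φ
  refine ⟨lact t ψ, ?_, fun ψ' hψ' => ?_⟩
  · change star (DoubleCategory.ract η s) (lact t ψ) = φ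
    rw [← star_lact, lact_lact, h₁, unitCell_lact]
    exact hψ
  · change star (DoubleCategory.ract η s) ψ' = φ at hψ'
    rw [← star_lact] at hψ'
    rw [← hψu _ hψ', lact_lact, h₂, unitCell_lact]

theorem IsPointwiseLeftKan.comp {J J' : Hor A B} {d : A ⟶ M} {l : B ⟶ M}
    {η : Cell J d l (unit M)} (hη : IsPointwiseLeftKan η) {ν : HCell J' J} (hν : ν.IsInvertible)
    {η' : Cell J' d l (unit M)} (e : arr ν ≫ arr η = arr η') : IsPointwiseLeftKan η' := by
  obtain ⟨μ, h₁, h₂⟩ := (HCell.isInvertible_iff ν).1 hν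
  have e' : arr μ ≫ arr η' = arr η := by rw [← e, ← Category.assoc, h₂, Category.id_comp]
  intro E H k φ
  obtain ⟨ψ, hψ, hψu⟩ := hη H k (vcomp (hcomp μ (vid H)) φ (Category.id_comp _)
      (Category.id_comp _))
  change star η ψ = _ at hψ
  refine ⟨ψ, ?_, fun ψ' hψ' => hψu ψ' ?_⟩
  · change star η' ψ = φ
    apply arr_injective
    rw [← arr_hcomp_star (α := ν) (β := vid H) e (Category.id_comp (arr ψ)), hψ, arr_vcomp,
      ← Category.assoc, arr_hcomp_comp _ _ _ _ (vid _) (vid _) (by simpa using h₁) (by simp),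
      arr_hcomp_vid, Category.id_comp]
  · change star η ψ' = _
    change star η' ψ' = φ at hψ'
    apply arr_injective
    rw [← arr_hcomp_star (α := μ) (β := vid H) e' (Category.id_comp (arr ψ')), hψ', arr_vcomp]

theorem IsLeftKan.comp {J J' : Hor A B} {d : A ⟶ M} {l : B ⟶ M}
    {η : Cell J d l (unit M)} (hη : IsLeftKan η) {ν : HCell J' J} (hν : ν.IsInvertible)
    {η' : Cell J' d l (unit M)} (e : arr ν ≫ arr η = arr η') : IsLeftKan η' := by
  obtain ⟨μ, h₁, h₂⟩ := (HCell.isInvertible_iff ν).1 hν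
  have e' : arr μ ≫ arr η' = arr η := by rw [← e, ← Category.assoc, h₂, Category.id_comp]
  rw [isLeftKan_iff] at hη ⊢
  intro k φ
  obtain ⟨ψ, hψ, hψu⟩ := hη k (vcomp μ φ (Category.id_comp _) (Category.id_comp _))
  refine ⟨ψ, ?_, fun ψ' hψ' => hψu ψ' ?_⟩
  · apply arr_injective
    rw [← arr_comp_ract (α := ν) e (t := ψ) (by simp), hψ, arr_vcomp, ← Category.assoc, h₁,
      Category.id_comp]
  · apply arr_injective
    rw [← arr_comp_ract (α := μ) e' (t := ψ') (by simp), hψ', arr_vcomp]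

theorem IsLeftKan.exists_iso {J : Hor A B} {d : A ⟶ M} {l l' : B ⟶ M}
    {η : Cell J d l (unit M)} {η' : Cell J d l' (unit M)} (hη : IsLeftKan η) (hη' : IsLeftKan η') :
    ∃ s : VCell l l', s.IsInvertible ∧ DoubleCategory.ract η s = η' := by
  rw [isLeftKan_iff] at hη hη'
  obtain ⟨s, hs, -⟩ := hη l' η'
  obtain ⟨t, ht, -⟩ := hη' l η
  refine ⟨s, (VCell.isInvertible_iff s).2 ⟨t, (hη l η).unique ?_ (ract_unitCell η),
    (hη' l' η').unique ?_ (ract_unitCell η')⟩, hs⟩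
  · rw [← ract_ract, hs, ht]
  · rw [← ract_ract, ht, hs]

/-- By uniqueness `s` is the canonical comparison of two left Kan extensions of `d` along `J`. -/
theorem IsLeftKan.isInvertible_of_ract {J : Hor A B} {d : A ⟶ M} {l l' : B ⟶ M}
    {η : Cell J d l (unit M)} {s : VCell l l'} (hη : IsLeftKan η)
    (hη' : IsLeftKan (DoubleCategory.ract η s)) : s.IsInvertible := by
  obtain ⟨t, ht, e⟩ := hη.exists_iso hη'
  rw [isLeftKan_iff] at hη
  rwa [(hη _ _).unique (y₁ := s) rfl e]

/-- A cell with left side a yoneda embedding is cartesian if and only if it defines a pointwise left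
Kan extension. -/
theorem IsYonedaEmbedding.isCartesian_iff {y : M ⟶ P} (hy : IsYonedaEmbedding y) {J : Hor M B}
    {l : B ⟶ P} (φ : Cell J y l (unit P)) : IsCartesian φ ↔ IsPointwiseLeftKan φ := by
  refine ⟨hy.isPointwiseLeftKan J l φ, fun h => ?_⟩
  -- Some cartesian cell on `J` exists and is itself a Kan extension, so `φ` differs from it by an
  -- invertible vertical cell, under which cartesian cells are stable.
  obtain ⟨g, ψ, hψ⟩ := hy.exists_cartesian J
  obtain ⟨s, hs, rfl⟩ := (hy.isPointwiseLeftKan J g ψ hψ).isLeftKan.exists_iso h.isLeftKan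
  exact hψ.ract hs

/-! ### Adjunctions in the vertical 2-category -/

/-- An adjunction `e ⊣ b` in the vertical 2-category. -/
structure VAdjunction (e : B ⟶ X) (b : X ⟶ B) where
  η : VCell (𝟙 B) (e ≫ b)
  ε : VCell (b ≫ e) (𝟙 X)
  left_triangle : lact (vcomp η (unitCell e) (Category.id_comp e) rfl : VCell e ((e ≫ b) ≫ e))
    (vcomp (unitCell e) ε (Category.assoc _ _ _).symm (Category.comp_id e)) = unitCell e
  right_triangle : lact (vcomp (unitCell b) η (Category.comp_id b) rfl : VCell b (b ≫ e ≫ b))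
    (vcomp ε (unitCell b) (Category.assoc _ _ _) (Category.id_comp b)) = unitCell b

namespace VAdjunction

variable {e : B ⟶ X} {b : X ⟶ B} (adj : VAdjunction e b)

/-- The transpose along an adjunction `e ⊣ b` of a cell whose left side factors through `e`. -/
def sharp {H : Hor C D} {a : C ⟶ B} {p : C ⟶ X} {q : D ⟶ X} {q' : D ⟶ B}
    (χ : Cell H p q (unit X)) (hp : a ≫ e = p) (hq : q ≫ b = q') : Cell H a q' (unit B) :=
  lact (vcomp (unitCell a) adj.η (Category.comp_id a) rfl : VCell a (a ≫ e ≫ b))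
    (vcomp χ (unitCell b) (by rw [← hp, Category.assoc]) hq)

/-- The transpose along an adjunction `e ⊣ b` of a cell whose right side factors through `b`. -/
def flat {H : Hor C D} {a : C ⟶ B} {p : C ⟶ X} {q : D ⟶ X} {q' : D ⟶ B}
    (χ : Cell H a q' (unit B)) (hp : a ≫ e = p) (hq : q ≫ b = q') : Cell H p q (unit X) :=
  ract (vcomp χ (unitCell e) hp rfl)
    (vcomp (unitCell q) adj.ε (by rw [← hq, Category.assoc]) (Category.comp_id q))

theorem flat_sharp {H : Hor C D} {a : C ⟶ B} {p : C ⟶ X} {q : D ⟶ X} {q' : D ⟶ B}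
    (χ : Cell H p q (unit X)) (hp : a ≫ e = p) (hq : q ≫ b = q') :
    adj.flat (adj.sharp χ hp hq) hp hq = χ := by
  subst hp hq
  apply arr_injective
  have h₁ : arr (adj.flat (adj.sharp χ rfl rfl) rfl rfl) =
      arr (ract (lact (vcomp (vcomp (unitCell a) adj.η (Category.comp_id a) rfl : VCell a
          (a ≫ e ≫ b))
          (unitCell e) rfl rfl) (vcomp χ (unitCell (b ≫ e)) (q := q ≫ b ≫ e) (by simp) rfl))
        (vcomp (unitCell q) adj.ε rfl (Category.comp_id q))) := by
    refine arr_ract_congr ?_ (by simp)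
    rw [arr_vcomp]
    exact arr_lact_comp (by simp) (by simp [arr_unitCell_comp])
  rw [h₁, ← lact_ract]
  -- Interchange slides the counit from the right of `χ` to its left, where it meets the unit and
  -- the left triangle identity applies.
  have h₂ : ract (vcomp χ (unitCell (b ≫ e)) (p := ((a ≫ e ≫ b) ≫ e)) (q := q ≫ b ≫ e)
      (by simp) rfl)
        (vcomp (unitCell q) adj.ε rfl (Category.comp_id q)) =
      lact (vcomp (unitCell (a ≫ e)) adj.ε (by simp) (Category.comp_id _)) χ := by
    apply arr_injective
    rw [← arr_comp_vcell_eq_ract (φ := χ) (s := adj.ε) (by simp) (by simp)]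
    exact arr_comp_vcell_eq_lact (by simp) (by simp)
  rw [h₂, lact_lact]
  have h₃ : lact (vcomp (vcomp (unitCell a) adj.η (Category.comp_id a) rfl : VCell a (a ≫ e ≫ b))
          (unitCell e) rfl rfl) (vcomp (unitCell (a ≫ e)) adj.ε (by simp) (Category.comp_id _)) =
      unitCell (a ≫ e) := by
    apply arr_injective
    rw [arr_unitCell_comp]
    exact (arr_comp_lact (by simp) (by simp [arr_unitCell_comp])).symm.trans
      (congrArg (arr (unitCell a) ≫ ·) (congrArg arr adj.left_triangle))
  rw [h₃, unitCell_lact]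

/-- Here interchange slides the unit to the right of `χ`, where it cancels against the counit by the
right triangle identity. -/
theorem sharp_flat {H : Hor C D} {a : C ⟶ B} {p : C ⟶ X} {q : D ⟶ X} {q' : D ⟶ B}
    (χ : Cell H a q' (unit B)) (hp : a ≫ e = p) (hq : q ≫ b = q') :
    adj.sharp (adj.flat χ hp hq) hp hq = χ := by
  subst hp hq
  apply arr_injective
  have h₁ : arr (adj.sharp (adj.flat χ rfl rfl) rfl rfl) =
      arr (lact (vcomp (unitCell a) adj.η (Category.comp_id a) rfl : VCell a (a ≫ e ≫ b))
        (ract (vcomp χ (unitCell (e ≫ b)) (q := (q ≫ b) ≫ e ≫ b) rfl rfl)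
          (vcomp (vcomp (unitCell q) adj.ε rfl (Category.comp_id q)) (unitCell b)
            (by simp) rfl))) := by
    refine arr_lact_congr rfl ?_
    rw [arr_vcomp]
    exact arr_ract_comp (by simp [arr_unitCell_comp]) (by simp)
  rw [h₁, lact_ract]
  have h₂ : lact (vcomp (unitCell a) adj.η (Category.comp_id a) rfl : VCell a (a ≫ e ≫ b))
        (vcomp χ (unitCell (e ≫ b)) (q := (q ≫ b) ≫ e ≫ b) rfl rfl) =
      ract χ (vcomp (unitCell (q ≫ b)) adj.η (Category.comp_id _) rfl) := by
    apply arr_injective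
    rw [← arr_comp_vcell_eq_lact (φ := χ) (s := adj.η) (by simp) (by simp)]
    exact arr_comp_vcell_eq_ract (by simp) (by simp)
  rw [h₂, ract_ract]
  have h₃ : lact (vcomp (unitCell (q ≫ b)) adj.η (Category.comp_id _) rfl)
      (vcomp (vcomp (unitCell q) adj.ε rfl (Category.comp_id q)) (unitCell b) (by simp) rfl) =
      unitCell (q ≫ b) := by
    apply arr_injective
    rw [arr_unitCell_comp]
    exact (arr_comp_lact (by simp [arr_unitCell_comp]) (by simp)).symm.trans
      (congrArg (arr (unitCell q) ≫ ·) (congrArg arr adj.right_triangle))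
  rw [h₃, ract_unitCell]

theorem arr_comp_sharp {C' D' : K} {H : Hor C D} {H' : Hor C' D'} {a : C ⟶ B} {p : C ⟶ X}
    {q : D ⟶ X} {q' : D ⟶ B}
    {χ : Cell H p q (unit X)} (hp : a ≫ e = p) (hq : q ≫ b = q')
    {h : C' ⟶ C} {k : D' ⟶ D} {ψ : Cell H' h k H} {a' : C' ⟶ B} {p₁ : C' ⟶ X} {q₁ : D' ⟶ X}
        {q₁' : D' ⟶ B}
    {χ' : Cell H' p₁ q₁ (unit X)} (hp' : a' ≫ e = p₁) (hq' : q₁ ≫ b = q₁')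
    (ha : h ≫ a = a') (e : arr ψ ≫ arr χ = arr χ') :
    arr ψ ≫ arr (adj.sharp χ hp hq) = arr (adj.sharp χ' hp' hq') := by
  refine arr_comp_lact ?_ ?_
  · rw [arr_vcomp, arr_vcomp, ← Category.assoc, ← arr_unitCell_comp, arr_unitCell_congr ha]
  · rw [arr_vcomp, arr_vcomp, ← Category.assoc, e]

/-- Transposition along an adjunction preserves cartesian cells. -/
theorem isCartesian_sharp {H : Hor C D} {a : C ⟶ B} {p : C ⟶ X} {q : D ⟶ X} {q' : D ⟶ B}
    {χ : Cell H p q (unit X)} (hχ : IsCartesian χ) (hp : a ≫ e = p) (hq : q ≫ b = q') :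
    IsCartesian (adj.sharp χ hp hq) := by
  refine isCartesian_of ?_ ?_
  · intro E F J h k ω
    obtain ⟨ψ, hψ⟩ := hχ.exists_lift h k (adj.flat ω (by rw [Category.assoc, hp])
      (q := k ≫ q) (by rw [Category.assoc, hq])) rfl rfl
    refine ⟨ψ, ?_⟩
    rw [adj.arr_comp_sharp hp hq (by rw [Category.assoc, hp]) (by rw [Category.assoc, hq]) rfl hψ,
      sharp_flat]
  · intro E F J h k ψ ψ' e
    apply hχ.hom_ext
    rw [adj.arr_comp_sharp (χ' := vcomp ψ χ rfl rfl) hp hq (by rw [Category.assoc, hp])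
        (by rw [Category.assoc, hq]) rfl (by simp),
      adj.arr_comp_sharp (χ' := vcomp ψ' χ rfl rfl) hp hq (by rw [Category.assoc, hp])
        (by rw [Category.assoc, hq]) rfl (by simp)] at e
    have := congrArg (fun t => adj.flat t (by rw [Category.assoc, hp]) (by rw [Category.assoc, hq]))
      (arr_injective e)
    simp only [flat_sharp] at this
    simpa using congrArg arr this

/-- The companion of a left adjoint `e ⊣ b` defines `l ∘ b` as the pointwise left Kan extension of
`l` along `e_*`. -/
theorem isPointwiseLeftKan_desc (c : Companion e) (l : B ⟶ M) :
    IsPointwiseLeftKan (c.desc (vcomp adj.η (unitCell l) (Category.id_comp l) rfl)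
      (q := b ≫ l) (Category.assoc _ _ _).symm) := by
  set θ := c.desc (vcomp adj.η (unitCell l) (Category.id_comp l) rfl)
    (q := b ≫ l) (Category.assoc _ _ _).symm with hθ
  -- The cells `β` and `γ`, obtained from the unit and the counit, exhibit `e_*` as a conjoint of
  -- `b`: the identities `hγβ` and `hβγ` below are the two conjoint identities.
  let β := c.desc adj.η (q := b) rfl
  have hβ : arr β ≫ arr (unitCell l) = arr θ := c.arr_desc_comp _ _ _ rfl (by simp)
  obtain ⟨γ, hγ⟩ := c.isCartesian.exists_lift b (𝟙 X) adj.ε rfl (by simp)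
  have hγβ : arr γ ≫ arr β = arr (unitCell b) := by
    rw [← adj.right_triangle]
    exact arr_comp_lact (by simp) (by simp [← hγ])
  have hγθ : arr γ ≫ arr θ = arr (unitCell (b ≫ l)) := by
    rw [← hβ, ← Category.assoc, hγβ, arr_unitCell_comp]
  have hβγ : arr (runitInv c.hor) ≫ arr (hcomp β γ) ≫ arr (lunit c.hor) = 𝟙 _ := by
    have h := c.isCartesian.hom_ext (ψ := (vcomp (vcomp (runitInv c.hor) (hcomp β γ) rfl rfl)
      (lunit c.hor) (by simp) (by simp) : HCell c.hor c.hor)) (ψ' := vid _) (by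
      simp only [arr_vcomp, Category.assoc, arr_vid, Category.id_comp]
      have h₀ : arr (lunit c.hor) ≫ arr c.cart = arr (star (unitCell e) c.cart) :=
        arr_lunit_comp_unit c.cart
      have h₁ : arr (hcomp β γ) ≫ arr (star (unitCell e) c.cart) =
          arr (star (vcomp β (unitCell e) (Category.id_comp e) rfl) adj.ε) :=
        arr_hcomp_star (by simp) hγ
      rw [h₀, h₁, ← arr_ract]
      congr 1
      apply c.desc_hom_ext
      rw [c.arr_fac]
      refine Eq.trans ?_ (congrArg arr adj.left_triangle)
      rw [lact_vcell]
      refine arr_comp_ract ?_ (by simp)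
      rw [arr_vcomp, arr_vcomp, ← Category.assoc, c.arr_opcart_desc])
    simpa using congrArg arr h
  have key {E : K} (H : Hor X E) : arr (hcomp (vid c.hor) (lunitInv H)) ≫
      arr (hcomp β (hcomp γ (vid H))) ≫ arr (lunit (compHor c.hor H)) = 𝟙 _ := by
    rw [arr_lunit_compHor, ← Category.assoc (arr (hcomp β _)), arr_associatorInv_naturality,
      Category.assoc, ← Category.assoc, arr_triangle_inv,
      arr_hcomp_comp _ _ _ _ (vcomp (hcomp β γ) (lunit c.hor)
        (Category.comp_id _) (Category.comp_id _)) (vid H) (by simp) (by simp),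
      arr_hcomp_comp _ _ _ _ (vid _) (vid H) (by simpa using hβγ) (by simp), arr_hcomp_vid]
  intro E H k φ
  -- The opcartesian cell `γ` of the conjoint gives a cell `H ⇒ e_* ⊙ H`, along which `φ` is pulled
  -- back.
  refine ⟨vcomp (vcomp (lunitInv H) (hcomp γ (vid H)) rfl rfl) φ (by simp) (by simp), ?_,
    fun ψ hψ => ?_⟩
  · change star θ _ = φ
    apply arr_injective
    rw [arr_star, ← arr_hcomp_comp β (vcomp (lunitInv H) (hcomp γ (vid H)) (Category.id_comp b)
        (Category.id_comp _))
      (unitCell l) φ _ _ hβ (by simp),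
      ← arr_hcomp_comp (vid c.hor) (lunitInv H) β (hcomp γ (vid H)) _ _ (by simp) (by simp),
      Category.assoc, arr_lunit_naturality, ← Category.assoc, Category.assoc (arr _), key,
      Category.id_comp]
  · change star θ ψ = φ at hψ
    apply arr_injective
    simp only [arr_vcomp, Category.assoc]
    rw [← hψ, arr_hcomp_star (φ' := unitCell (b ≫ l)) (ψ' := ψ) hγθ (by simp), arr_unitCell_star,
      ← Category.assoc]
    simp

end VAdjunction

end Kan

/-! ### Transport of cells along equalities of their boundaries. -/

section Recast

variable {K : Type u} [DoubleCategory.{w, x, v, u} K] {A B C D : K}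

theorem arr_recast_tgt {J : Hor A B} {f : A ⟶ C} {g : B ⟶ D} {L L' : Hor C D} (h : L = L')
    (φ : Cell J f g L) :
    arr (recast rfl rfl rfl h φ) = arr φ ≫ arr (recast rfl rfl rfl h (vid L)) := by
  subst h
  exact (Category.comp_id (arr φ)).symm

theorem arr_recast_boundary {J J' : Hor A B} {f : A ⟶ C} {g : B ⟶ D} {L L' : Hor C D} (h : J = J')
    (h' : L = L') (φ : Cell J f g L) :
    arr (recast h rfl rfl h' φ) = arr (recast rfl rfl rfl h.symm (vid J')) ≫ arr φ ≫
      arr (recast rfl rfl rfl h' (vid L)) := by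
  subst h h'
  exact ((Category.id_comp _).trans (Category.comp_id (arr φ))).symm

theorem arr_recast_comp_recast {J J' : Hor A B} (h : J = J') :
    arr (recast rfl rfl rfl h (vid J)) ≫ arr (recast rfl rfl rfl h.symm (vid J')) = 𝟙 _ := by
  subst h
  exact Category.id_comp _

theorem arr_recast_sides {J : Hor A B} {f f' : A ⟶ C} {g g' : B ⟶ D} {L : Hor C D} (h : f = f')
    (h' : g = g') (φ : Cell J f g L) : arr (recast rfl h h' rfl φ) = arr φ := by
  subst h h'
  rfl

end Recast

end DoubleCategory

namespace NormalLaxDoubleMonad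

variable {K : Type u} [DoubleCategory.{w, x, v, u} K] (T : NormalLaxDoubleMonad K)
variable {A B C D E F M P X Y : K}

/-! ### The action of a normal lax double monad on cells -/

theorem arr_mapCell_comp {J : Hor A B} {N : Hor C D} {L : Hor E F}
    {f : A ⟶ C} {g : B ⟶ D} {h : C ⟶ E} {k : D ⟶ F} {p : A ⟶ E} {q : B ⟶ F}
    {φ : Cell J f g N} {ψ : Cell N h k L} {χ : Cell J p q L} (e : arr φ ≫ arr ψ = arr χ) :
    arr (T.mapCell φ) ≫ arr (T.mapCell ψ) = arr (T.mapCell χ) := by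
  rw [← arr_vcomp φ ψ rfl rfl] at e
  have h₁ : f ≫ h = p := congrArg Square.left e
  have h₂ : g ≫ k = q := congrArg Square.right e
  subst h₁ h₂
  rw [← arr_injective e, T.mapCell_vcomp, arr_vcomp]

theorem arr_mapCell_congr {J : Hor A B} {N : Hor C D} {f f' : A ⟶ C} {g g' : B ⟶ D}
    {φ : Cell J f g N} {ψ : Cell J f' g' N} (e : arr φ = arr ψ) :
    arr (T.mapCell φ) = arr (T.mapCell ψ) := by
  have h₁ : f = f' := congrArg Square.left e
  have h₂ : g = g' := congrArg Square.right e
  subst h₁ h₂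
  rw [arr_injective e]

theorem arr_mapCell_vid (J : Hor A B) : arr (T.mapCell (vid J)) = 𝟙 _ := by
  rw [T.mapCell_vid, arr_recast_sides, arr_vid]

/-- The inverse of the unitor cell. -/
def unitorInv (A : K) : HCell (T.mapHor (unit A)) (unit (T.obj A)) :=
  recast rfl rfl rfl (T.isNormal.mapHor_unit A) (vid (T.mapHor (unit A)))

@[simp]
theorem arr_unitor_unitorInv (A : K) : arr (T.unitor A) ≫ arr (T.unitorInv A) = 𝟙 _ := by
  rw [T.isNormal.unitor_eq]
  exact arr_recast_comp_recast _

@[simp]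
theorem arr_unitorInv_unitor (A : K) : arr (T.unitorInv A) ≫ arr (T.unitor A) = 𝟙 _ := by
  rw [T.isNormal.unitor_eq]
  exact arr_recast_comp_recast _

theorem arr_mapToUnit {J : Hor A B} {f : A ⟶ M} {g : B ⟶ M} (φ : Cell J f g (unit M)) :
    arr (T.mapToUnit φ) = arr (T.mapCell φ) ≫ arr (T.unitorInv M) :=
  arr_recast_tgt _ _

theorem arr_mapV {f g : A ⟶ C} (φ : VCell f g) :
    arr (T.mapV φ) = arr (T.unitor A) ≫ arr (T.mapCell φ) ≫ arr (T.unitorInv C) := by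
  rw [T.isNormal.unitor_eq]
  exact arr_recast_boundary _ _ _

theorem arr_compositor_naturality {J : Hor A B} {H : Hor B C} {N : Hor D E} {L : Hor E F}
    {f : A ⟶ D} {g : B ⟶ E} {h : C ⟶ F} (φ : Cell J f g N) (ψ : Cell H g h L) :
    arr (hcomp (T.mapCell φ) (T.mapCell ψ)) ≫ arr (T.compositor N L) =
      arr (T.compositor J H) ≫ arr (T.mapCell (hcomp φ ψ)) := by
  simpa using congrArg arr (T.compositor_naturality φ ψ)

theorem arr_unitor_naturality (f : A ⟶ C) :
    arr (unitCell (T.map f)) ≫ arr (T.unitor C) = arr (T.unitor A) ≫ arr (T.mapCell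
        (unitCell f)) := by
  simpa using congrArg arr (T.unitor_naturality f)

theorem arr_mapV_unitCell (f : A ⟶ C) :
    arr (T.unitor A) ≫ arr (T.mapCell (unitCell f)) ≫ arr (T.unitorInv C) =
      arr (unitCell (T.map f)) := by
  rw [← Category.assoc, ← arr_unitor_naturality]
  simp

theorem arr_mapCell_unitCell (f : A ⟶ C) :
    arr (T.mapCell (unitCell f)) ≫ arr (T.unitorInv C) =
      arr (T.unitorInv A) ≫ arr (unitCell (T.map f)) := by
  rw [← arr_mapV_unitCell, ← Category.assoc (arr (T.unitorInv A))]
  simp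

theorem arr_compositor_left_unit (J : Hor A B) :
    arr (T.compositor (unit A) J) ≫ arr (T.mapCell (lunit J)) =
      arr (hcomp (T.unitorInv A) (vid (T.mapHor J))) ≫ arr (lunit (T.mapHor J)) := by
  rw [← T.compositor_left_unit, arr_vcomp, arr_vcomp, Category.assoc, ← Category.assoc (arr
      (hcomp _ _)),
    arr_hcomp_comp _ _ _ _ (vid _) (vid _) (by simp) (by simp), arr_hcomp_vid, Category.id_comp]

theorem arr_compositor_right_unit (J : Hor A B) :
    arr (T.compositor J (unit B)) ≫ arr (T.mapCell (runit J)) =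
      arr (hcomp (vid (T.mapHor J)) (T.unitorInv B)) ≫ arr (runit (T.mapHor J)) := by
  rw [← T.compositor_right_unit, arr_vcomp, arr_vcomp, Category.assoc, ← Category.assoc (arr
      (hcomp _ _)),
    arr_hcomp_comp _ _ _ _ (vid _) (vid _) (by simp) (by simp), arr_hcomp_vid, Category.id_comp]

theorem arr_mapCell_lunitInv (J : Hor A B) :
    arr (T.mapCell (lunitInv J)) = arr (lunitInv (T.mapHor J)) ≫
      arr (hcomp (T.unitor A) (vid (T.mapHor J))) ≫ arr (T.compositor (unit A) J) := by
  have h : arr (T.mapCell (lunit J)) ≫ arr (T.mapCell (lunitInv J)) = 𝟙 _ := by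
    rw [T.arr_mapCell_comp (χ := vid _) (by simp), arr_mapCell_vid]
  have h' := T.arr_compositor_left_unit J
  rw [← Category.comp_id (arr (T.compositor _ _)), ← h, ← Category.assoc (arr (T.compositor _ _)),
    h', ← Category.assoc, ← Category.assoc, ← Category.assoc, Category.assoc (arr (lunitInv _)),
    arr_hcomp_comp _ _ _ _ (vid _) (vid _) (by simp) (by simp), arr_hcomp_vid, Category.comp_id]
  simp

theorem arr_mapCell_runitInv (J : Hor A B) :
    arr (T.mapCell (runitInv J)) = arr (runitInv (T.mapHor J)) ≫
      arr (hcomp (vid (T.mapHor J)) (T.unitor B)) ≫ arr (T.compositor J (unit B)) := by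
  have h : arr (T.mapCell (runit J)) ≫ arr (T.mapCell (runitInv J)) = 𝟙 _ := by
    rw [T.arr_mapCell_comp (χ := vid _) (by simp), arr_mapCell_vid]
  have h' := T.arr_compositor_right_unit J
  rw [← Category.comp_id (arr (T.compositor _ _)), ← h, ← Category.assoc (arr (T.compositor _ _)),
    h', ← Category.assoc, ← Category.assoc, ← Category.assoc, Category.assoc (arr (runitInv _)),
    arr_hcomp_comp _ _ _ _ (vid _) (vid _) (by simp) (by simp), arr_hcomp_vid, Category.comp_id]
  simp

/-- The compositor need not be invertible, so `T` respects `star` only after precomposition with it.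
The left unit axiom of `T` disposes of the compositor at `1_M`. -/
theorem arr_compositor_star {J : Hor A B} {H : Hor B C} {d : A ⟶ M} {l : B ⟶ M} {k : C ⟶ M}
    (φ : Cell J d l (unit M)) (ψ : Cell H l k (unit M)) :
    arr (T.compositor J H) ≫ arr (T.mapToUnit (star φ ψ)) =
      arr (star (T.mapToUnit φ) (T.mapToUnit ψ)) := by
  rw [arr_mapToUnit, ← T.arr_mapCell_comp (arr_star φ ψ).symm, ← Category.assoc, ← Category.assoc,
    ← arr_compositor_naturality, Category.assoc (arr (hcomp _ _)), arr_compositor_left_unit,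
    arr_star, ← arr_hcomp_comp _ _ _ _ _ _ (T.arr_mapToUnit φ).symm (T.arr_mapToUnit ψ).symm,
    Category.assoc, Category.assoc, Category.assoc, ← arr_lunit_naturality, unitCell_id,
    ← Category.assoc (arr (hcomp (T.unitorInv M) _)),
    arr_hcomp_comp _ _ _ _ (T.unitorInv M) (T.unitorInv M) (by simp) (by simp)]

/-- Although `T` is lax, the action of vertical cells is preserved strictly: the compositor involved
has a unit as its first factor, and is cancelled by the left unit axiom. -/
theorem mapToUnit_lact {J : Hor A B} {p d : A ⟶ M} {l : B ⟶ M} (s : VCell p d)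
    (φ : Cell J d l (unit M)) :
    T.mapToUnit (lact s φ) = lact (T.mapV s) (T.mapToUnit φ) := by
  apply arr_injective
  rw [arr_mapToUnit, ← T.arr_mapCell_comp (arr_lact s φ).symm, Category.assoc, ← arr_mapToUnit,
    arr_mapCell_lunitInv, arr_lact, Category.assoc, Category.assoc, arr_compositor_star,
    arr_hcomp_star (φ' := T.mapV s) (ψ' := T.mapToUnit φ) (by rw [arr_mapToUnit, arr_mapV])
        (by simp)]

theorem arr_mapV_eq {f g : A ⟶ C} (φ : VCell f g) :
    arr (T.mapV φ) = arr (T.unitor A) ≫ arr (T.mapToUnit φ) := by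
  rw [arr_mapV, arr_mapToUnit]

theorem mapV_lact {f g h : A ⟶ C} (s : VCell f g) (t : VCell g h) :
    T.mapV (lact s t) = lact (T.mapV s) (T.mapV t) := by
  apply arr_injective
  rw [arr_mapV_eq, mapToUnit_lact]
  exact arr_comp_lact (by simp) (arr_mapV_eq _ _).symm

theorem mapV_unitCell (f : A ⟶ C) : T.mapV (unitCell f) = unitCell (T.map f) :=
  arr_injective (by rw [arr_mapV, arr_mapV_unitCell])

theorem mapV_isInvertible {f g : A ⟶ C} {s : VCell f g} (hs : s.IsInvertible) :
    (T.mapV s).IsInvertible := by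
  rw [VCell.isInvertible_iff] at hs ⊢
  obtain ⟨t, h₁, h₂⟩ := hs
  exact ⟨T.mapV t, by rw [← mapV_lact, h₁, mapV_unitCell], by rw [← mapV_lact, h₂, mapV_unitCell]⟩

theorem arr_mapToUnit_comp {J : Hor A B} {N : Hor C D} {f : A ⟶ C} {g : B ⟶ D} {p : C ⟶ M}
    {q : D ⟶ M} {r : A ⟶ M} {s : B ⟶ M} {φ : Cell J f g N} {ψ : Cell N p q (unit M)}
    {χ : Cell J r s (unit M)} (e : arr φ ≫ arr ψ = arr χ) :
    arr (T.mapCell φ) ≫ arr (T.mapToUnit ψ) = arr (T.mapToUnit χ) := by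
  rw [arr_mapToUnit, arr_mapToUnit, ← Category.assoc, T.arr_mapCell_comp e]

theorem arr_mapToUnit_post {J : Hor A B} {f : A ⟶ C} {g : B ⟶ C} {e : C ⟶ X} {p : A ⟶ X} {q : B ⟶ X}
    {φ : Cell J f g (unit C)} {χ : Cell J p q (unit X)}
    (h : arr φ ≫ arr (unitCell e) = arr χ) :
    arr (T.mapToUnit φ) ≫ arr (unitCell (T.map e)) = arr (T.mapToUnit χ) := by
  rw [arr_mapToUnit, arr_mapToUnit, ← T.arr_mapCell_comp h, Category.assoc, Category.assoc,
    arr_mapCell_unitCell]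

theorem arr_mapV_post {f g : A ⟶ C} {e : C ⟶ X} {p q : A ⟶ X} {s : VCell f g} {s' : VCell p q}
    (h : arr s ≫ arr (unitCell e) = arr s') :
    arr (T.mapV s) ≫ arr (unitCell (T.map e)) = arr (T.mapV s') := by
  rw [arr_mapV_eq, arr_mapV_eq, Category.assoc, T.arr_mapToUnit_post h]

theorem arr_ιCell_mapToUnit {J : Hor A B} {f : A ⟶ M} {g : B ⟶ M} (φ : Cell J f g (unit M)) :
    arr (T.ιCell J) ≫ arr (T.mapToUnit φ) = arr φ ≫ arr (unitCell (T.ι M)) := by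
  have h := congrArg arr (T.ιCell_naturality φ)
  rw [arr_vcomp, arr_vcomp] at h
  rw [arr_mapToUnit, ← Category.assoc, ← h, ← T.ιCell_unit, arr_vcomp, Category.assoc,
    Category.assoc, arr_unitor_unitorInv, Category.comp_id]

theorem arr_ι_mapV {f g : A ⟶ M} (φ : VCell f g) :
    arr (unitCell (T.ι A)) ≫ arr (T.mapV φ) = arr φ ≫ arr (unitCell (T.ι M)) := by
  rw [arr_mapV_eq, ← arr_ιCell_mapToUnit, ← Category.assoc, ← T.ιCell_unit, arr_vcomp]

/-! ### Preservation of companions and cartesian cells -/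

/-- The image of a companion. -/
def mapCompanion {f : A ⟶ C} (c : Companion f) : Companion (T.map f) := by
  refine
    { hor := T.mapHor c.hor
      cart := vcomp (T.mapCell c.cart) (T.unitorInv C) (Category.comp_id _) (by simp)
      opcart := vcomp (T.unitor A) (T.mapCell c.opcart) (by simp) (Category.id_comp _)
      isCartesian := isCartesian_of_zigzag
        (opcart := vcomp (T.unitor A) (T.mapCell c.opcart) (by simp) (Category.id_comp _)) ?_ ?_
      fac := ?_ }
  · rw [arr_vcomp, arr_vcomp, Category.assoc, ← Category.assoc (arr (T.mapCell _)),
      T.arr_mapCell_comp c.arr_fac, arr_mapV_unitCell]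
  · have h := T.arr_mapCell_vid c.hor
    rw [← T.arr_mapCell_comp (φ := lunitInv c.hor) (ψ := vcomp (hcomp c.opcart c.cart) (runit c.hor)
      (Category.comp_id _) (Category.comp_id _)) (by simpa using c.zigzag),
      ← T.arr_mapCell_comp (arr_vcomp _ _ _ _).symm, arr_mapCell_lunitInv, Category.assoc,
      Category.assoc, ← Category.assoc (arr (T.compositor _ _)), ← arr_compositor_naturality,
      Category.assoc (arr (hcomp _ _)), arr_compositor_right_unit] at h
    rw [← h]
    congr 1
    simp only [← Category.assoc]
    congr 1
    rw [arr_hcomp_comp _ _ _ _ (vcomp (T.unitor A) (T.mapCell c.opcart) rfl rfl) (vcomp (vid _)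
        (T.mapCell c.cart) rfl rfl) (by simp) (by simp),
      arr_hcomp_comp _ _ _ _ (vcomp (T.unitor A) (T.mapCell c.opcart) rfl rfl)
        (vcomp (T.mapCell c.cart) (T.unitorInv C) (by simp) rfl) (by simp) (by simp)]
    exact arr_hcomp_congr (by simp) (by simp)
  · apply arr_injective
    rw [arr_vcomp, arr_vcomp, arr_vcomp, Category.assoc, ← Category.assoc (arr (T.mapCell _)),
      T.arr_mapCell_comp c.arr_fac, arr_mapV_unitCell]

/-- The image of a conjoint. -/
def mapConjoint {g : B ⟶ D} (c : Conjoint g) : Conjoint (T.map g) := by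
  refine
    { hor := T.mapHor c.hor
      cart := vcomp (T.mapCell c.cart) (T.unitorInv D) (by simp) (Category.comp_id _)
      opcart := vcomp (T.unitor B) (T.mapCell c.opcart) (Category.id_comp _) (by simp)
      isCartesian := isCartesian_of_conjoint_zigzag
        (opcart := vcomp (T.unitor B) (T.mapCell c.opcart) (Category.id_comp _) (by simp)) ?_ ?_
      arr_fac := ?_ }
  · rw [arr_vcomp, arr_vcomp, Category.assoc, ← Category.assoc (arr (T.mapCell _)),
      T.arr_mapCell_comp c.arr_fac, arr_mapV_unitCell]
  · have h := T.arr_mapCell_vid c.hor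
    rw [← T.arr_mapCell_comp (φ := runitInv c.hor) (ψ := vcomp (hcomp c.cart c.opcart) (lunit c.hor)
      (Category.comp_id _) (Category.comp_id _)) (by simpa using c.zigzag),
      ← T.arr_mapCell_comp (arr_vcomp _ _ _ _).symm, arr_mapCell_runitInv, Category.assoc,
      Category.assoc, ← Category.assoc (arr (T.compositor _ _)), ← arr_compositor_naturality,
      Category.assoc (arr (hcomp _ _)), arr_compositor_left_unit] at h
    rw [← h]
    congr 1
    simp only [← Category.assoc]
    congr 1
    rw [arr_hcomp_comp _ _ _ _ (vcomp (vid _) (T.mapCell c.cart) rfl rfl)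
        (vcomp (T.unitor B) (T.mapCell c.opcart) rfl rfl) (by simp) (by simp),
      arr_hcomp_comp _ _ _ _ (vcomp (T.mapCell c.cart) (T.unitorInv D) rfl (by simp))
        (vcomp (T.unitor B) (T.mapCell c.opcart) rfl rfl) (by simp) (by simp)]
    exact arr_hcomp_congr (by simp) (by simp)
  · rw [arr_vcomp, arr_vcomp, Category.assoc, ← Category.assoc (arr (T.mapCell _)),
      T.arr_mapCell_comp c.arr_fac, arr_mapV_unitCell]

/-- A normal lax double functor preserves cartesian cells into a unit. -/
theorem isCartesian_mapToUnit [IsEquipment K] {J : Hor A B} {f : A ⟶ C} {g : B ⟶ C}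
    {φ : Cell J f g (unit C)} (hφ : IsCartesian φ) : IsCartesian (T.mapToUnit φ) := by
  obtain ⟨c⟩ := nonempty_companion f
  obtain ⟨e⟩ := nonempty_conjoint g
  -- `ν` is the comparison `f_* ⊙ g^* ⇒ J` and `opcart ⊙ m` its section. The companion and conjoint
  -- are preserved by `T`, but their composite only laxly, so `ν'` below has to be inverted by hand.
  obtain ⟨ν, hν⟩ := hφ.exists_lift (𝟙 _) (𝟙 _) (star c.cart e.cart) (by simp) (by simp)
  obtain ⟨m, hm⟩ := e.isCartesian.exists_lift f (𝟙 _) φ (by simp) (by simp)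
  have hn : arr (lunitInv J) ≫ arr (hcomp c.opcart m) ≫ arr ν = 𝟙 _ := by
    have := hφ.hom_ext (ψ := (vcomp (vcomp (lunitInv J) (hcomp c.opcart m) rfl rfl) ν (by simp)
      (by simp) : HCell J J)) (ψ' := vid J) (by
        simp only [arr_vcomp, Category.assoc, hν]
        rw [arr_hcomp_star c.arr_fac hm, arr_unitCell_star, ← Category.assoc]
        simp)
    simpa using congrArg arr this
  let p : Cell (T.mapHor c.hor) (T.map f) (𝟙 _) (unit _) := (T.mapCompanion c).cart
  let o : Cell (unit _) (𝟙 _) (T.map f) (T.mapHor c.hor) := (T.mapCompanion c).opcart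
  let q : Cell (T.mapHor e.hor) (𝟙 _) (T.map g) (unit _) := (T.mapConjoint e).cart
  have hp : arr p = arr (T.mapCell c.cart) ≫ arr (T.unitorInv C) := arr_vcomp _ _ _ _
  have ho : arr o = arr (T.unitor A) ≫ arr (T.mapCell c.opcart) := arr_vcomp _ _ _ _
  have hq : arr q = arr (T.mapCell e.cart) ≫ arr (T.unitorInv C) := arr_vcomp _ _ _ _
  have hop : arr o ≫ arr p = arr (unitCell (T.map f)) := (T.mapCompanion c).arr_fac
  have hpq : IsCartesian (star p q) :=
    isCartesian_star_companion_conjoint (T.mapCompanion c) (T.mapConjoint e)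
  let ν' : HCell (compHor (T.mapHor c.hor) (T.mapHor e.hor)) (T.mapHor J) :=
    vcomp (T.compositor c.hor e.hor) (T.mapCell ν) (by simp) (by simp)
  have hν₀ : arr ν' = arr (T.compositor c.hor e.hor) ≫ arr (T.mapCell ν) := arr_vcomp _ _ _ _
  have hν' : arr ν' ≫ arr (T.mapToUnit φ) = arr (star p q) := by
    rw [hν₀, Category.assoc, T.arr_mapToUnit_comp hν, arr_compositor_star]
    exact arr_star_congr (by rw [arr_mapToUnit, hp]) (by rw [arr_mapToUnit, hq])
  let m' : Cell (T.mapHor J) (T.map f) (𝟙 _) (T.mapHor e.hor) :=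
    vcomp (T.mapCell m) (vid (T.mapHor e.hor)) (Category.comp_id _) (by simp)
  have hm₀ : arr m' = arr (T.mapCell m) := by simp [m']
  have hm' : arr m' ≫ arr q = arr (T.mapToUnit φ) := by
    rw [hm₀, hq, arr_mapToUnit, ← Category.assoc, T.arr_mapCell_comp hm]
  let n' : HCell (T.mapHor J) (compHor (T.mapHor c.hor) (T.mapHor e.hor)) :=
    vcomp (lunitInv _) (hcomp o m') (Category.id_comp _) (Category.id_comp _)
  have hn₀ : arr n' = arr (lunitInv _) ≫ arr (hcomp o m') := arr_vcomp _ _ _ _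
  have hn' : arr n' ≫ arr (star p q) = arr (T.mapToUnit φ) := by
    rw [hn₀, Category.assoc, arr_hcomp_star hop hm', arr_unitCell_star, ← Category.assoc]
    simp
  -- This is the image of `hn` under `T`; the other composite `h₂` is tested against the cartesian
  -- cell `star p q`.
  have h₁ : arr n' ≫ arr ν' = 𝟙 _ := by
    rw [← T.arr_mapCell_vid J, ← T.arr_mapCell_comp (φ := vcomp (lunitInv J) (hcomp c.opcart m)
      (Category.id_comp _) (Category.id_comp _)) (ψ := ν) (by simpa using hn), hν₀, hn₀,
      ← T.arr_mapCell_comp (arr_vcomp _ _ _ _).symm, arr_mapCell_lunitInv]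
    simp only [Category.assoc]
    rw [← Category.assoc (arr (T.compositor _ _)) (arr (T.mapCell (hcomp _ _))),
      ← arr_compositor_naturality]
    simp only [← Category.assoc]
    congr 2
    rw [Category.assoc, arr_hcomp_comp _ _ _ _ (vcomp (T.unitor A) (T.mapCell c.opcart) rfl rfl)
      (vcomp (vid _) (T.mapCell m) rfl rfl) (by simp) (by simp)]
    congr 1
    exact arr_hcomp_congr (by rw [ho, arr_vcomp]) (by simp [hm₀])
  have h₂ : arr ν' ≫ arr n' = 𝟙 _ := by
    have := hpq.hom_ext (ψ := HCell.comp ν' n') (ψ' := vid _) (by simp [hn', hν'])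
    simpa using congrArg arr this
  exact ((HCell.isInvertible_iff n').2 ⟨ν', h₁, h₂⟩).isCartesian.comp hpq hn'

/-! ### The comparison cells of an algebra structure on the target of a yoneda embedding -/

/-- The cell `ι_{A*} ⇒ 1_P` with sides `d` and `w ∘ Td` corresponding to a unit cell
`id_P ⇒ w ∘ ι_P`. -/
def extUnit {W : T.obj P ⟶ P} (υ : VCell (𝟙 P) (T.ι P ≫ W)) (cA : Companion (T.ι A)) (d : A ⟶ P) :
    Cell cA.hor d (T.map d ≫ W) (unit P) :=
  cA.desc (vcomp (unitCell d) υ (Category.comp_id d) rfl)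
    (by rw [← Category.assoc, ← T.ι_naturality, Category.assoc])

/-- The composite `1_w ∘ Tη`. -/
abbrev mapAct {J : Hor A B} {d : A ⟶ P} {l : B ⟶ P} (η : Cell J d l (unit P)) (W : T.obj P ⟶ P) :
    Cell (T.mapHor J) (T.map d ≫ W) (T.map l ≫ W) (unit P) :=
  vcomp (T.mapToUnit η) (unitCell W) rfl rfl

/-- The three cells composed in `ιStar` are absorbed separately: the opcartesian cell by `φ`, the
cell `ι_J` by `ψ`, and the cartesian cell by the unit cell of `q`. -/
theorem arr_ιStar_star {J : Hor A B} {f : A ⟶ M} {p : T.obj A ⟶ M} {q : T.obj B ⟶ M}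
    (cA : Companion (T.ι A)) (cB : Companion (T.ι B))
    (φ : Cell cA.hor f p (unit M)) (ψ : Cell (T.mapHor J) p q (unit M)) {r s : A ⟶ M} {t : B ⟶ M}
    {σ : VCell r s}
    {ψ' : Cell J s t (unit M)} {χ : Cell cB.hor t q (unit M)}
    (hσ : arr cA.opcart ≫ arr φ = arr σ)
    (hψ : arr (T.ιCell J) ≫ arr ψ = arr ψ')
    (hχ : arr cB.cart ≫ arr (unitCell q) = arr χ) :
    arr (T.ιStar cA cB J) ≫ arr (star φ ψ) = arr (star (lact σ ψ') χ) := by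
  rw [ιStar, arr_vcomp, arr_vcomp, Category.assoc,
    arr_hcomp_star (φ' := φ) (ψ' := star ψ (unitCell q)) (by simp) (arr_runit_comp_unit ψ),
    Category.assoc, arr_hcomp_star hσ (arr_hcomp_star hψ hχ), ← arr_lact, lact_star]

/-- Compatibility of the cells `extUnit` with the cells `ιStar`. -/
theorem arr_ιStar_extUnit {W : T.obj P ⟶ P} (υ : VCell (𝟙 P) (T.ι P ≫ W)) (cA : Companion (T.ι A))
    (cB : Companion (T.ι B)) {J : Hor A B} {d : A ⟶ P} {l : B ⟶ P} (η : Cell J d l (unit P)) :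
    arr (T.ιStar cA cB J) ≫ arr (star (T.extUnit υ cA d) (T.mapAct η W)) =
      arr (star η (T.extUnit υ cB l)) := by
  have hl : T.ι B ≫ T.map l ≫ W = l ≫ T.ι P ≫ W := by
    rw [← Category.assoc, ← T.ι_naturality, Category.assoc]
  rw [T.arr_ιStar_star cA cB (T.extUnit υ cA d) (T.mapAct η W)
    (σ := vcomp (unitCell d) υ (Category.comp_id d) rfl)
    (ψ' := vcomp η (unitCell (T.ι P ≫ W)) rfl rfl)
    (χ := vcomp cB.cart (unitCell (T.map l ≫ W)) hl (Category.id_comp _))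
    (cA.arr_opcart_desc _ _)
    (by rw [arr_vcomp, ← Category.assoc, arr_ιCell_mapToUnit, arr_vcomp, arr_unitCell_comp,
      Category.assoc]) (by simp)]
  rw [extUnit, Companion.desc, star_lact]
  refine arr_star_congr ?_ rfl
  -- What remains is interchange: `υ` whiskered by `d` on the left of `η` equals `υ` whiskered by
  -- `l` on its right.
  rw [← arr_comp_vcell_eq_lact (φ := η) (s := υ) (by simp) (by simp)]
  exact arr_comp_vcell_eq_ract (by simp) (by simp)

/-- The cell `ι_{J*}` is invertible if `J` is a companion. -/
theorem isInvertible_ιStar_companion {j : A ⟶ B} (c : Companion j) (cA : Companion (T.ι A))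
    (cB : Companion (T.ι B)) : (T.ιStar cA cB c.hor).IsInvertible := by
  let p : Cell (T.mapHor c.hor) (T.map j) (𝟙 _) (unit _) := (T.mapCompanion c).cart
  have hp : IsCartesian p := (T.mapCompanion c).isCartesian
  have hj : j ≫ T.ι B = T.ι A ≫ T.map j := T.ι_naturality j
  -- Both `j_* ⊙ ι_{B*}` and `ι_{A*} ⊙ T(j_*)` are restrictions of the unit of `TB` along `ι_B ∘ j =
  -- Tj ∘ ι_A` and the identity, and `ιStar` is the comparison between them.
  have h₁ : IsCartesian (star (vcomp c.cart (unitCell (T.ι B)) rfl (Category.id_comp _)) cB.cart) :=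
    (c.isCartesian_restr cB.hor).comp cB.isCartesian (by
      rw [Companion.restr, arr_vcomp, Category.assoc, arr_lunit_comp_unit,
        arr_hcomp_star (φ' := vcomp c.cart (unitCell (T.ι B)) rfl (Category.id_comp _))
          (ψ' := cB.cart) (by simp) (by simp)])
  have h₂ : IsCartesian (star (vcomp cA.cart (unitCell (T.map j)) hj.symm (Category.id_comp _))
      p) :=
    (cA.isCartesian_restr (T.mapHor c.hor)).comp hp (by
      rw [Companion.restr, arr_vcomp, Category.assoc, arr_lunit_comp_unit,
        arr_hcomp_star (φ' := vcomp cA.cart (unitCell (T.map j)) hj.symm (Category.id_comp _))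
          (ψ' := p) (by simp) (by simp)])
  refine h₁.isInvertible h₂ ?_
  have hc : arr p = arr (T.mapToUnit c.cart) := by
    rw [arr_mapToUnit]
    exact arr_vcomp _ _ _ _
  have := T.arr_ιStar_star cA cB (J := c.hor)
    (vcomp cA.cart (unitCell (T.map j)) hj.symm (Category.id_comp _)) p
    (σ := unitCell (j ≫ T.ι B)) (ψ' := vcomp c.cart (unitCell (T.ι B)) rfl (Category.id_comp _))
    (χ := cB.cart)
    (by rw [arr_vcomp, ← Category.assoc, cA.arr_fac, ← arr_unitCell_comp, arr_unitCell_congr hj])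
    (by rw [hc, arr_ιCell_mapToUnit, arr_vcomp]) (by simp)
  rw [unitCell_lact] at this
  exact this

variable {T} in
/-- For a yoneda embedding `y`, an adjunction `ι_P ⊣ w` and a cartesian cell `δ`, the cell
`ι_{M*} ⊙ TD ⇒ 1_P` is cartesian. -/
theorem isCartesian_star_extUnit [IsEquipment K] {W : T.obj P ⟶ P} (adj : VAdjunction (T.ι P) W)
    {y : M ⟶ P} {d : A ⟶ P} {D : Hor M A} {δ : Cell D y d (unit P)} (hδ : IsCartesian δ)
    (cM : Companion (T.ι M)) :
    IsCartesian (star (T.extUnit adj.η cM y) (T.mapAct δ W)) := by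
  have hy : y ≫ T.ι P = T.ι M ≫ T.map y := T.ι_naturality y
  have h₁ : arr (cM.restr (T.mapHor D)) ≫ arr (T.mapToUnit δ) =
      arr (star (vcomp cM.cart (unitCell (T.map y)) hy.symm (Category.id_comp _))
        (T.mapToUnit δ)) := by
    rw [Companion.restr, arr_vcomp, Category.assoc, arr_lunit_comp_unit,
      arr_hcomp_star (φ' := vcomp cM.cart (unitCell (T.map y)) hy.symm (Category.id_comp _))
          (ψ' := T.mapToUnit δ) (by simp) (by simp)]
  -- The cell is the transpose along `ι_P ⊣ w` of `ι_{M*} ⊙ TD ⇒ TD ⇒ 1_{TP}`, whose left side `Ty ∘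
  -- ι_M = ι_P ∘ y` factors through `ι_P`.
  refine (adj.isCartesian_sharp ((cM.isCartesian_restr (T.mapHor D)).comp
    (T.isCartesian_mapToUnit hδ) h₁) rfl rfl).congr ?_
  rw [extUnit, Companion.desc, lact_star]
  refine arr_lact_congr (by simp) ?_
  rw [arr_vcomp]
  exact arr_star_unitCell (by simp [arr_unitCell_comp]) (by simp)

end NormalLaxDoubleMonad

/-! ### Whiskering and transposing vertical cells along an adjunction. -/

namespace DoubleCategory

variable {K : Type u} [DoubleCategory.{w, x, v, u} K] {A B C X M : K}

theorem arr_pre {e : X ⟶ A} {f g : A ⟶ C} (φ : VCell f g) {p q : X ⟶ C} (hp : e ≫ f = p)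
    (hq : e ≫ g = q) : arr (φ.pre e hp hq) = arr (unitCell e) ≫ arr φ :=
  arr_vcomp _ _ _ _

theorem arr_post {e : C ⟶ X} {f g : A ⟶ C} (φ : VCell f g) {p q : A ⟶ X} (hp : f ≫ e = p)
    (hq : g ≫ e = q) : arr (φ.post e hp hq) = arr φ ≫ arr (unitCell e) :=
  arr_vcomp _ _ _ _

theorem lact_eq_unitCell_of_whisker {X Y M : K} {e : X ⟶ A} {f : M ⟶ Y}
    {p q : A ⟶ M} {s : VCell p q} {t : VCell q p} (h : lact s t = unitCell p) {p' q' : X ⟶ Y}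
    (hp : e ≫ p ≫ f = p') {s' : VCell p' q'} {t' : VCell q' p'}
    (hs : arr s' = arr (unitCell e) ≫ arr s ≫ arr (unitCell f))
    (ht : arr t' = arr (unitCell e) ≫ arr t ≫ arr (unitCell f)) : lact s' t' = unitCell p' := by
  apply arr_injective
  rw [← arr_comp_lact (α := unitCell e) (s := vcomp s (unitCell f) rfl rfl)
    (φ := vcomp t (unitCell f) rfl rfl) (by rw [arr_vcomp, hs]) (by rw [arr_vcomp, ht]),
    ← arr_lact_comp (arr_vcomp _ _ _ _).symm (arr_vcomp _ _ _ _).symm, h, ← arr_unitCell_comp,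
    ← arr_unitCell_comp, arr_unitCell_congr hp]

/-- Vertical cells out of a composite with a right adjoint are determined by their whiskerings with
the left adjoint. -/
theorem VAdjunction.pre_hom_ext {e : B ⟶ X} {b : X ⟶ B} (adj : VAdjunction e b) {f : B ⟶ M}
    {p g : X ⟶ M} (hp : b ≫ f = p) {χ χ' : VCell p g}
    (h : arr (unitCell e) ≫ arr χ = arr (unitCell e) ≫ arr χ') : χ = χ' := by
  subst hp
  -- By interchange and the right triangle identity `χ` is rebuilt from its whiskering with `e`,
  -- placed between the unit and the counit.
  have key (χ : VCell (b ≫ f) g) : arr χ = arr (lact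
      (lact (vcomp (vcomp (unitCell b) adj.η (Category.comp_id b) rfl : VCell b (b ≫ e ≫ b))
        (unitCell f) rfl rfl)
        (vcomp (unitCell b) (vcomp (unitCell e) χ rfl rfl : VCell (e ≫ b ≫ f) (e ≫ g))
          (by simp) rfl))
      (vcomp adj.ε (unitCell g) (Category.assoc _ _ _) (Category.id_comp g))) := by
    rw [← lact_lact]
    have h₁ : arr (lact (vcomp (unitCell b) (vcomp (unitCell e) χ rfl rfl : VCell (e ≫ b ≫ f)
        (e ≫ g))
          (p := (b ≫ e ≫ b) ≫ f) (by simp) rfl)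
        (vcomp adj.ε (unitCell g) (Category.assoc _ _ _) (Category.id_comp g))) =
        arr (lact (vcomp (vcomp adj.ε (unitCell b) (Category.assoc _ _ _) (Category.id_comp b) :
          VCell (b ≫ e ≫ b) b) (unitCell f) rfl rfl) χ) := by
      rw [← arr_comp_vcell_eq_lact (φ := adj.ε) (s := χ)
        (by simp [arr_unitCell_comp]) (by simp), lact_vcell]
      exact arr_comp_vcell_eq_ract (by simp [arr_unitCell_comp]) (by simp)
    rw [arr_injective h₁, lact_lact]
    have h₂ := arr_lact_comp (s := (vcomp (unitCell b) adj.η (Category.comp_id b) rfl : VCell b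
        (b ≫ e ≫ b)))
      (φ := vcomp adj.ε (unitCell b) (Category.assoc _ _ _) (Category.id_comp b)) (e := f)
      (s' := vcomp (vcomp (unitCell b) adj.η (Category.comp_id b) rfl : VCell b (b ≫ e ≫ b))
        (unitCell f)
        rfl rfl) (φ' := vcomp (vcomp adj.ε (unitCell b) (Category.assoc _ _ _)
            (Category.id_comp b) :
          VCell (b ≫ e ≫ b) b) (unitCell f) rfl rfl) (by simp) (by simp)
    rw [adj.right_triangle, ← arr_unitCell_comp] at h₂
    rw [← arr_injective h₂, unitCell_lact]
  have h' : (vcomp (unitCell e) χ rfl rfl : VCell (e ≫ b ≫ f) (e ≫ g)) = vcomp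
      (unitCell e) χ' rfl rfl :=
    arr_injective (by simpa using h)
  apply arr_injective
  rw [key χ, key χ', h']

/-- The witness is `ψ` whiskered with `b`, followed by the counit; interchange and the left triangle
identity give back `ψ`. -/
theorem VAdjunction.exists_transpose {e : B ⟶ X} {b : X ⟶ B} (adj : VAdjunction e b) {f : B ⟶ M}
    {g : X ⟶ M} (ψ : VCell f (e ≫ g)) : ∃ χ : VCell (b ≫ f) g,
      lact (vcomp adj.η (unitCell f) (Category.id_comp f) (Category.assoc _ _ _))
        (vcomp (unitCell e) χ rfl rfl) = ψ := by
  refine ⟨lact (vcomp (unitCell b) ψ rfl rfl)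
    (vcomp adj.ε (unitCell g) (Category.assoc _ _ _) (Category.id_comp g)), arr_injective ?_⟩
  have h₁ : arr (vcomp (unitCell e) (lact (vcomp (unitCell b) ψ rfl rfl)
      (vcomp adj.ε (unitCell g) (Category.assoc _ _ _) (Category.id_comp g))) rfl rfl) =
      arr (lact (vcomp (unitCell (e ≫ b)) ψ (q := ((e ≫ b) ≫ e) ≫ g) (Category.assoc _ _ _)
          (by simp))
        (vcomp (vcomp (unitCell e) adj.ε (Category.assoc _ _ _).symm (Category.comp_id e))
          (unitCell g)
          rfl rfl)) := by
    rw [arr_vcomp]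
    exact arr_comp_lact (by simp [arr_unitCell_comp]) (by simp)
  rw [arr_injective h₁, lact_lact]
  have h₂ : arr (lact (vcomp adj.η (unitCell f) (Category.id_comp f) (Category.assoc _ _ _))
      (vcomp (unitCell (e ≫ b)) ψ (q := ((e ≫ b) ≫ e) ≫ g) (Category.assoc _ _ _) (by simp))) =
      arr (lact ψ (vcomp (vcomp adj.η (unitCell e) (Category.id_comp e) rfl : VCell e ((e ≫ b) ≫ e))
        (unitCell g) rfl rfl)) := by
    rw [lact_vcell, ← arr_comp_vcell_eq_ract (φ := adj.η) (s := ψ) (by simp) (by simp)]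
    exact arr_comp_vcell_eq_lact (by simp) (by simp [arr_unitCell_comp])
  rw [arr_injective h₂, ← lact_lact]
  have h₃ := arr_lact_comp (e := g)
    (s := (vcomp adj.η (unitCell e) (Category.id_comp e) rfl : VCell e ((e ≫ b) ≫ e)))
    (φ := vcomp (unitCell e) adj.ε (Category.assoc _ _ _).symm (Category.comp_id e))
    (s' := vcomp (vcomp adj.η (unitCell e) (Category.id_comp e) rfl : VCell e ((e ≫ b) ≫ e))
        (unitCell g) rfl rfl)
    (φ' := vcomp (vcomp (unitCell e) adj.ε (Category.assoc _ _ _).symm (Category.comp_id e))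
      (unitCell g)
          rfl rfl) (by simp) (by simp)
  rw [adj.left_triangle, ← arr_unitCell_comp] at h₃
  rw [← arr_injective h₃, lact_vcell, ract_unitCell]

end DoubleCategory

namespace NormalLaxDoubleMonad

variable {K : Type u} [DoubleCategory.{w, x, v, u} K] {T : NormalLaxDoubleMonad K}
variable {A B C : K}

/-! ### Colax-idempotent 2-monads -/

variable (T) in
/-- The free algebra. -/
def freeAlgebra (A : K) : T.StrictAlgebra (T.obj A) where
  act := T.μ A
  act_assoc := (T.μ_assoc A).symm
  act_unit := T.ι_μ A

theorem isColaxMorphism_freeAlgebra_iff {f : T.obj A ⟶ T.obj C}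
    (φ : VCell (T.μ A ≫ f) (T.map f ≫ T.μ C)) :
    (T.freeAlgebra A).IsColaxMorphism (T.freeAlgebra C) f φ ↔
      arr (unitCell (T.ι (T.obj A))) ≫ arr φ = arr (unitCell f) ∧
      arr (unitCell (T.μ (T.obj A))) ≫ arr φ = arr (lact
        (vcomp (unitCell (T.map (T.μ A))) φ rfl rfl :
          VCell (T.map (T.μ A) ≫ T.μ A ≫ f) (T.map (T.μ A) ≫ T.map f ≫ T.μ C))
        (vcomp (T.mapV φ) (unitCell (T.μ C)) (by rw [T.map_comp, Category.assoc]) rfl)) := by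
  constructor
  · intro h
    have ha := h.assoc
    rw [VCell.comp_eq_lact] at ha
    exact ⟨(arr_vcomp _ _ _ _).symm.trans (congrArg arr h.unit),
      (arr_vcomp _ _ _ _).symm.trans ((congrArg arr ha).trans
        (arr_lact_congr (arr_vcomp _ _ _ _) ((arr_vcomp _ _ _ _).trans (arr_vcomp _ _ _ _).symm)))⟩
  · intro h
    refine ⟨arr_injective ((arr_vcomp _ _ _ _).trans h.1), ?_⟩
    rw [VCell.comp_eq_lact]
    exact arr_injective ((arr_vcomp _ _ _ _).trans (h.2.trans
      (arr_lact_congr (arr_vcomp _ _ _ _) ((arr_vcomp _ _ _ _).trans (arr_vcomp _ _ _ _).symm))))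

/-- If `T` is colax-idempotent then `ι_{TA}` is left adjoint to `μ_A`, with identity unit. -/
theorem IsColaxIdempotent.exists_counit (hT : T.IsColaxIdempotent) (A : K) :
    ∃ ε : VCell (T.μ A ≫ T.ι (T.obj A)) (𝟙 (T.obj (T.obj A))),
      arr (unitCell (T.ι (T.obj A))) ≫ arr ε = arr (unitCell (T.ι (T.obj A))) ∧
      arr ε ≫ arr (unitCell (T.μ A)) = arr (unitCell (T.μ A)) := by
  -- As `μ_{TA} ∘ Tι_{TA}` is the identity, the colax structure on `ι_{TA}` has the boundary of a
  -- counit, and its unit axiom is the first identity sought.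
  obtain ⟨φ, hφ, -⟩ := hT (T.freeAlgebra A) (T.freeAlgebra (T.obj A)) (T.ι (T.obj A))
  change VCell (T.μ A ≫ T.ι (T.obj A)) (T.map (T.ι (T.obj A)) ≫ T.μ (T.obj A)) at φ
  obtain ⟨hu, ha⟩ := (isColaxMorphism_freeAlgebra_iff φ).1 hφ
  -- Composing with the strict morphism `μ_A` yields a colax structure on the identity of `TA`. The
  -- identity cell `χ` is another, and uniqueness of such structures gives the second identity.
  let ψ : VCell (T.μ A ≫ 𝟙 _) (T.map (𝟙 (T.obj A)) ≫ T.μ A) :=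
    vcomp φ (unitCell (T.μ A)) (by rw [Category.assoc, T.ι_μ])
      (by rw [Category.assoc, T.μ_assoc, ← Category.assoc, ← T.map_comp, T.ι_μ])
  have hψ₀ : arr ψ = arr φ ≫ arr (unitCell (T.μ A)) := arr_vcomp _ _ _ _
  let χ : VCell (T.μ A ≫ 𝟙 _) (T.map (𝟙 (T.obj A)) ≫ T.μ A) :=
    vcomp (unitCell (T.μ A)) (unitCell (𝟙 _)) rfl (by simp [T.map_id])
  have hχ₀ : arr χ = arr (unitCell (T.μ A)) := by simp [χ]
  have hψ : (T.freeAlgebra A).IsColaxMorphism (T.freeAlgebra A) (𝟙 _) ψ := by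
    refine (isColaxMorphism_freeAlgebra_iff ψ).2 ⟨?_, ?_⟩
    · rw [hψ₀, ← Category.assoc, hu, ← arr_unitCell_comp, arr_unitCell_congr (T.ι_μ A)]
    · rw [hψ₀, ← Category.assoc, ha]
      refine arr_lact_comp ?_ ?_
      · rw [arr_vcomp, arr_vcomp, hψ₀, Category.assoc]
      · rw [arr_vcomp, arr_vcomp, ← T.arr_mapV_post hψ₀.symm, Category.assoc, Category.assoc,
          ← arr_unitCell_comp, ← arr_unitCell_comp, arr_unitCell_congr (T.μ_assoc A)]
  have hχ : (T.freeAlgebra A).IsColaxMorphism (T.freeAlgebra A) (𝟙 _) χ := by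
    refine (isColaxMorphism_freeAlgebra_iff χ).2 ⟨?_, ?_⟩
    · rw [hχ₀, ← arr_unitCell_comp, arr_unitCell_congr (T.ι_μ A)]
    · have h₁ : arr (T.mapV χ) = arr (unitCell (T.map (T.μ A))) := by
        rw [← T.mapV_unitCell, arr_mapV, arr_mapV, T.arr_mapCell_congr hχ₀]
      rw [arr_lact_congr (s' := unitCell (T.map (T.μ A) ≫ T.μ A))
        (φ' := unitCell (T.map (T.μ A) ≫ T.μ A)) ?_ ?_, unitCell_lact, hχ₀, ← arr_unitCell_comp,
        arr_unitCell_congr (T.μ_assoc A)]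
      · rw [arr_vcomp, hχ₀, arr_unitCell_comp]
      · rw [arr_vcomp, h₁, arr_unitCell_comp]
  have hψχ : ψ = χ := (hT _ _ _).unique hψ hχ
  refine ⟨vcomp φ (unitCell (𝟙 _)) (Category.comp_id _) (by rw
      [Category.comp_id, T.map_ι_μ]), ?_, ?_⟩
  · rw [arr_vcomp, arr_unitCell_id, Category.comp_id, hu]
  · rw [arr_vcomp, arr_unitCell_id, Category.comp_id, ← hψ₀, hψχ, hχ₀]

/-- The adjunction `ι_{TA} ⊣ μ_A`. -/
theorem IsColaxIdempotent.exists_free_adjunction (hT : T.IsColaxIdempotent) (A : K) :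
    ∃ adj : VAdjunction (T.ι (T.obj A)) (T.μ A), arr adj.η = 𝟙 _ := by
  obtain ⟨ε, h₁, h₂⟩ := hT.exists_counit A
  refine ⟨⟨vcomp (unitCell (𝟙 _)) (unitCell (𝟙 _)) (Category.comp_id _) (by simp
      [T.ι_μ]), ε, ?_, ?_⟩, ?_⟩
  · apply arr_injective
    rw [arr_lact_congr (s' := unitCell (T.ι (T.obj A))) (φ' := unitCell (T.ι (T.obj A))) (by simp)
      (by simpa using h₁), unitCell_lact]
  · apply arr_injective
    rw [arr_lact_congr (s' := unitCell (T.μ A)) (φ' := unitCell (T.μ A)) (by simp)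
      (by simpa using h₂), unitCell_lact]
  · simp

/-- For a colax-idempotent 2-monad, the structure morphism of a pseudo algebra is right adjoint to
the unit. -/
theorem IsColaxIdempotent.exists_adjunction (hT : T.IsColaxIdempotent) (b : T.PseudoAlgebra B) :
    ∃ adj : VAdjunction (T.ι B) b.act, adj.η = b.unit := by
  obtain ⟨ε, h₁, h₂⟩ := hT.exists_counit B
  obtain ⟨u', hu₁, hu₂⟩ := (VCell.isInvertible_iff _).1 b.unit_isInvertible
  -- This is the cell `ι_{TB} ⇒ Tι_B` characteristic of colax-idempotent monads; it becomes an
  -- identity when whiskered with `ι_B` or with `μ_B`.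
  let t : VCell (T.ι (T.obj B)) (T.map (T.ι B)) := vcomp (unitCell (T.map (T.ι B))) ε
    (by rw [← Category.assoc, T.map_ι_μ, Category.id_comp]) (Category.comp_id _)
  have ht₀ : arr t = arr (unitCell (T.map (T.ι B))) ≫ arr ε := arr_vcomp _ _ _ _
  have ht₁ : arr (unitCell (T.ι B)) ≫ arr t = arr (unitCell (T.ι B ≫ T.map (T.ι B))) := by
    rw [ht₀, ← Category.assoc, ← arr_unitCell_comp, ← arr_unitCell_congr (T.ι_naturality (T.ι B)),
      arr_unitCell_comp, Category.assoc, h₁]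
  have ht₂ : arr t ≫ arr (unitCell (T.μ B)) = 𝟙 _ := by
    rw [ht₀, Category.assoc, h₂, ← arr_unitCell_comp, arr_unitCell_congr (T.map_ι_μ B),
      arr_unitCell_id]
  -- The counit is `ι_B ∘ b = Tb ∘ ι_{TB} ⇒ Tb ∘ Tι_B = T(b ∘ ι_B) ⇒ id`, given by `t` and then the
  -- image of the inverse of the algebra unit.
  let e : VCell (b.act ≫ T.ι B) (𝟙 (T.obj B)) :=
    lact (vcomp t (unitCell (T.map b.act)) (T.ι_naturality b.act).symm (T.map_comp _ _).symm)
      (vcomp (T.mapV u') (unitCell (𝟙 _)) (Category.comp_id _) (by simp [T.map_id]))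
  refine ⟨⟨b.unit, e, ?_, ?_⟩, rfl⟩
  · apply arr_injective
    have h : arr (unitCell (T.ι B)) ≫ arr e = arr u' ≫ arr (unitCell (T.ι B)) := by
      rw [← T.arr_ι_mapV, arr_comp_lact
        (s' := unitCell (T.ι B ≫ T.map (T.ι B ≫ b.act)))
        (φ' := vcomp (unitCell (T.ι B)) (T.mapV u') rfl rfl) ?_ (by simp), unitCell_lact, arr_vcomp]
      rw [arr_vcomp, ← Category.assoc, ht₁, ← arr_unitCell_comp]
      exact arr_unitCell_congr (by rw [Category.assoc, ← T.map_comp])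
    rw [arr_lact_congr rfl (φ' := vcomp u' (unitCell (T.ι B)) rfl (Category.id_comp _))
      (by rw [arr_vcomp, arr_vcomp, h]), ← arr_lact_comp (arr_vcomp _ _ _ _).symm
      (arr_vcomp _ _ _ _).symm, hu₁]
    simp
  · have hr := b.coherence_right_unit
    have hl := b.coherence_left_unit
    rw [VCell.comp_eq_lact] at hr hl
    refine Eq.trans (arr_injective ?_) hl
    refine arr_lact_congr (by rw [arr_vcomp, arr_pre]) ?_
    -- Both cells are inverse to the image of the algebra unit: the left one by functoriality of `T`
    -- on vertical cells, the right one by the right unit coherence.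
    have h₃ : arr (vcomp (T.mapV u') (unitCell b.act) rfl (by simp [T.map_id]) :
        VCell (T.map (T.ι B ≫ b.act) ≫ b.act) b.act) = arr (unitCell (T.map
            (T.ι B))) ≫ arr b.assoc := by
      have h₄ : lact (vcomp (T.mapV u') (unitCell b.act) rfl (by simp [T.map_id]) :
          VCell (T.map (T.ι B ≫ b.act) ≫ b.act) b.act)
        ((T.mapV b.unit).post b.act (p := b.act) (q := T.map (T.ι B) ≫ T.map b.act ≫ b.act)
          (by rw [T.map_id, Category.id_comp]) (by rw [T.map_comp, Category.assoc])) =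
          vcomp (unitCell _) (unitCell (𝟙 _)) (Category.comp_id _) (by simp [T.map_comp]) := by
        apply arr_injective
        have := arr_lact_comp (s := T.mapV u') (φ := T.mapV b.unit) (e := b.act)
          (s' := (vcomp (T.mapV u') (unitCell b.act) rfl (by simp [T.map_id]) :
          VCell (T.map (T.ι B ≫ b.act) ≫ b.act) b.act)) (φ' := (T.mapV b.unit).post b.act
              (p := b.act) (q := T.map (T.ι B) ≫ T.map b.act ≫ b.act)
          (by rw [T.map_id, Category.id_comp]) (by rw [T.map_comp, Category.assoc]))
            (arr_vcomp _ _ _ _).symm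
          (arr_post _ _ _).symm
        rw [← this, ← T.mapV_lact, hu₂, T.mapV_unitCell, ← arr_unitCell_comp]
        simp
      have h₅ := congrArg (lact (vcomp (T.mapV u') (unitCell b.act) rfl (by simp [T.map_id]) :
          VCell (T.map (T.ι B ≫ b.act) ≫ b.act) b.act)) hr
      rw [lact_lact, h₄, lact_vcell _ (unitCell b.act), ract_unitCell] at h₅
      rw [← h₅, arr_lact_congr (s' := unitCell _) (φ' := b.assoc.pre (T.map (T.ι B)) rfl
          (by rw [← Category.assoc, T.map_ι_μ, Category.id_comp])) ?_ rfl, unitCell_lact, arr_pre]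
      rw [arr_vcomp, arr_unitCell_id, Category.comp_id]
      exact arr_unitCell_congr (by rw [T.map_comp, Category.assoc])
    rw [arr_vcomp]
    have h₅ : arr e ≫ arr (unitCell b.act) = arr (lact
        (vcomp t (unitCell (T.map b.act ≫ b.act)) rfl rfl)
        (vcomp (unitCell (T.map (T.ι B))) b.assoc rfl (q := b.act) (by
          rw [← Category.assoc, T.map_ι_μ, Category.id_comp]))) := by
      refine (arr_lact_comp (s' := vcomp t (unitCell (T.map b.act ≫ b.act))
          (p := b.act ≫ T.ι B ≫ b.act)
          (q := T.map (T.ι B ≫ b.act) ≫ b.act) (by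
            rw [← Category.assoc, ← Category.assoc, T.ι_naturality]) (by simp [T.map_comp]))
        (φ' := (vcomp (T.mapV u') (unitCell b.act) rfl (by simp [T.map_id]) :
          VCell (T.map (T.ι B ≫ b.act) ≫ b.act) b.act)) ?_ ?_).trans ?_
      · rw [arr_vcomp t, arr_vcomp t, Category.assoc, ← arr_unitCell_comp]
      · rw [arr_vcomp, arr_vcomp]
        simp
      · exact arr_lact_congr (by simp) (by rw [h₃, arr_vcomp])
    -- Interchange replaces the associativity cell at `Tι_B` by the one at `ι_{TB}`, and turns `t`
    -- into its whiskering with `μ_B`, which is an identity. The left unit coherence then applies.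
    rw [h₅, lact_vcell, ← arr_comp_vcell_eq_ract (φ := t) (s := b.assoc) (by simp) (by simp),
      arr_comp_vcell_eq_lact (φ := t) (s := b.assoc) (s' := b.assoc.pre (T.ι (T.obj B)) rfl rfl)
        (φ' := vcomp t (unitCell (T.μ B ≫ b.act)) rfl rfl) (arr_pre _ _ _).symm (by simp)]
    rw [lact_vcell]
    have h₆ : arr (vcomp t (unitCell (T.μ B ≫ b.act)) rfl rfl) = arr (unitCell b.act) := by
      rw [arr_vcomp, arr_unitCell_comp, ← Category.assoc, ht₂, Category.id_comp]
    rw [arr_ract_congr (φ' := b.assoc.pre (T.ι (T.obj B)) rfl (by rw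
        [← Category.assoc, T.ι_μ, Category.id_comp]))
      (t' := unitCell b.act) (by simp [arr_pre]) h₆, ract_unitCell]

/-- Vertical cells out of a composite of pseudo algebra structures are determined by their
whiskerings with the units. -/
theorem IsColaxIdempotent.eq_of_unitCell_comp (hT : T.IsColaxIdempotent) (b : T.PseudoAlgebra B)
    {f : B ⟶ C} {g : T.obj (T.obj B) ⟶ C} {S R : VCell (T.map b.act ≫ b.act ≫ f) g}
    (h : arr (unitCell (T.ι B ≫ T.ι (T.obj B))) ≫ arr S =
      arr (unitCell (T.ι B ≫ T.ι (T.obj B))) ≫ arr R) : S = R := by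
  rw [arr_unitCell_comp, Category.assoc, Category.assoc] at h
  obtain ⟨adj, -⟩ := hT.exists_adjunction b
  obtain ⟨adj', -⟩ := hT.exists_free_adjunction B
  obtain ⟨α', hα, -⟩ := (VCell.isInvertible_iff _).1 b.assoc_isInvertible
  let a : VCell (T.map b.act ≫ b.act ≫ f) (T.μ B ≫ b.act ≫ f) :=
    b.assoc.post f (Category.assoc _ _ _) (Category.assoc _ _ _)
  let a' : VCell (T.μ B ≫ b.act ≫ f) (T.map b.act ≫ b.act ≫ f) :=
    α'.post f (Category.assoc _ _ _) (Category.assoc _ _ _)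
  have ha : lact a a' = unitCell _ :=
    lact_eq_unitCell_of_whisker (e := 𝟙 _) (f := f) hα (by simp) (by simp [a, arr_post])
      (by simp [a', arr_post])
  have key (S : VCell (T.map b.act ≫ b.act ≫ f) g) :
      arr (unitCell (T.ι B)) ≫ arr (unitCell (T.ι (T.obj B))) ≫ arr (lact a' S) =
      arr (lact (vcomp (unitCell (T.ι B ≫ T.ι (T.obj B))) a' rfl rfl)
        (vcomp (unitCell (T.ι B)) (vcomp (unitCell (T.ι (T.obj B))) S rfl rfl) (by simp) rfl)) := by
    rw [← Category.assoc, ← arr_unitCell_comp]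
    exact arr_comp_lact (arr_vcomp _ _ _ _).symm
      (by rw [arr_vcomp, arr_vcomp, arr_unitCell_comp, Category.assoc])
  -- With `b ∘ Tb` replaced by `b ∘ μ_B`, the right adjoints `μ_B` and `b` are stripped off in turn,
  -- using `ι_{TB} ⊣ μ_B` and `ι_B ⊣ b`.
  have h₁ : lact a' S = lact a' R := by
    refine adj'.pre_hom_ext rfl ?_
    have h₂ : (vcomp (unitCell (T.ι (T.obj B))) (lact a' S)
        (by rw [← Category.assoc, T.ι_μ, Category.id_comp]) rfl : VCell (b.act ≫ f) _) =
        vcomp (unitCell (T.ι (T.obj B))) (lact a' R)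
          (by rw [← Category.assoc, T.ι_μ, Category.id_comp]) rfl := by
      refine adj.pre_hom_ext rfl ?_
      rw [arr_vcomp, arr_vcomp, key, key]
      exact arr_lact_congr rfl (by rw [arr_vcomp, arr_vcomp, arr_vcomp, arr_vcomp, h])
    simpa using congrArg arr h₂
  rw [← unitCell_lact S, ← ha, ← lact_lact, h₁, lact_lact, ha, unitCell_lact]

/-- For a colax-idempotent 2-monad, the associativity axiom of colax morphisms is a consequence of
the unit axiom. -/
theorem IsColaxIdempotent.isColaxMorphism_of_unit (hT : T.IsColaxIdempotent) (b : T.PseudoAlgebra B)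
    (c : T.PseudoAlgebra C) {f : B ⟶ C} {φ : VCell (b.act ≫ f) (T.map f ≫ c.act)}
    (hφ : lact (vcomp b.unit (unitCell f) (Category.id_comp f) (Category.assoc _ _ _) :
        VCell f (T.ι B ≫ b.act ≫ f))
      (vcomp (unitCell (T.ι B)) φ rfl
        (by rw [← Category.assoc, ← T.ι_naturality, Category.assoc]) :
        VCell (T.ι B ≫ b.act ≫ f) (f ≫ T.ι C ≫ c.act)) =
      vcomp (unitCell f) c.unit (Category.comp_id f) rfl) : b.IsColaxMorphism c f φ := by
  have hf := T.ι_naturality f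
  have hb := T.ι_naturality b.act
  have hc := T.ι_naturality c.act
  have hf' := T.ι_naturality (T.map f)
  obtain ⟨u', hu₁, hu₂⟩ := (VCell.isInvertible_iff _).1 b.unit_isInvertible
  have hlb := b.coherence_left_unit
  have hlc := c.coherence_left_unit
  rw [VCell.comp_eq_lact] at hlb hlc
  refine ⟨?_, hT.eq_of_unitCell_comp b ?_⟩
  · rw [VCell.comp_eq_lact]
    exact hφ
  rw [VCell.comp_eq_lact, VCell.comp_eq_lact, VCell.comp_eq_lact]
  -- After whiskering with `ι_{TB} ∘ ι_B`, naturality of `ι` turns the two sides of the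
  -- associativity axiom into `A₁` followed by `k`, and `B₁` followed by `B₂` and `B₃`.
  let k : VCell (T.ι B ≫ b.act ≫ f) (f ≫ T.ι C ≫ c.act) := vcomp (unitCell (T.ι B)) φ rfl
    (by rw [← Category.assoc, ← T.ι_naturality, Category.assoc])
  have hk : arr k = arr (unitCell (T.ι B)) ≫ arr φ := arr_vcomp _ _ _ _
  let s : VCell (T.ι B ≫ b.act ≫ f) (T.ι B ≫ b.act ≫ T.ι B ≫ b.act ≫ f) :=
    vcomp (unitCell (T.ι B ≫ b.act)) (vcomp b.unit (unitCell f) rfl rfl) (by simp) (by simp)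
  have hs : arr s = arr (unitCell (T.ι B ≫ b.act)) ≫ arr b.unit ≫ arr (unitCell f) := by
    rw [arr_vcomp, arr_vcomp]
  let s' : VCell (T.ι B ≫ b.act ≫ T.ι B ≫ b.act ≫ f) (T.ι B ≫ b.act ≫ f) :=
    vcomp (unitCell (T.ι B ≫ b.act)) (vcomp u' (unitCell f) rfl rfl) (by simp) (by simp)
  have hs' : lact s' s = unitCell _ :=
    lact_eq_unitCell_of_whisker hu₂ (by simp) (by rw [arr_vcomp, arr_vcomp]) hs
  let A₁ : VCell (T.ι B ≫ b.act ≫ T.ι B ≫ b.act ≫ f) (T.ι B ≫ b.act ≫ f) :=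
    vcomp (unitCell (T.ι B ≫ T.ι (T.obj B))) (b.assoc.post f rfl rfl)
      (by simp [← reassoc_of% hb]) (by simp [reassoc_of% (T.ι_μ B)])
  have hA₁ : arr A₁ = arr (unitCell (T.ι B ≫ T.ι (T.obj B))) ≫ arr b.assoc ≫ arr (unitCell f) := by
    rw [arr_vcomp, arr_post]
  have hsA : lact s A₁ = unitCell _ := by
    refine lact_eq_unitCell_of_whisker (e := T.ι B) (f := f) hlb rfl ?_ ?_
    · rw [hs, arr_pre, arr_unitCell_comp, Category.assoc, Category.assoc]
    · rw [hA₁, arr_pre, arr_unitCell_comp, Category.assoc, Category.assoc]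
  let B₁ : VCell (T.ι B ≫ b.act ≫ T.ι B ≫ b.act ≫ f) (T.ι B ≫ b.act ≫ f ≫ T.ι C ≫ c.act) :=
    vcomp (unitCell (T.ι B ≫ b.act)) k (by simp) (by simp)
  let B₂ : VCell (T.ι B ≫ b.act ≫ f ≫ T.ι C ≫ c.act) (f ≫ T.ι C ≫ c.act ≫ T.ι C ≫ c.act) :=
    vcomp k (unitCell (T.ι C ≫ c.act)) (by simp) (by simp)
  let B₃ : VCell (f ≫ T.ι C ≫ c.act ≫ T.ι C ≫ c.act) (f ≫ T.ι C ≫ c.act) :=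
    vcomp (unitCell (f ≫ T.ι C)) (vcomp (unitCell (T.ι (T.obj C))) c.assoc rfl rfl)
      (by simp [← reassoc_of% hc]) (by simp [reassoc_of% (T.ι_μ C)])
  let E : VCell (T.ι B ≫ b.act ≫ f) (T.ι B ≫ b.act ≫ f ≫ T.ι C ≫ c.act) :=
    vcomp (unitCell (T.ι B ≫ b.act)) (vcomp (unitCell f) c.unit rfl rfl) (by simp) (by simp)
  let C₁ : VCell (f ≫ T.ι C ≫ c.act) (f ≫ T.ι C ≫ c.act ≫ T.ι C ≫ c.act) :=
    vcomp (unitCell (f ≫ T.ι C ≫ c.act)) c.unit (by simp) (by simp)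
  have hsB : lact s B₁ = E := by
    have h := congrArg (fun x => arr (unitCell (T.ι B ≫ b.act)) ≫ arr x) hφ
    refine arr_injective (Eq.trans (Eq.symm ?_) (h.trans ?_))
    · exact arr_comp_lact (by rw [hs, arr_vcomp]) (arr_vcomp _ _ _ _).symm
    · rw [arr_vcomp, arr_vcomp, arr_vcomp]
  have hEB : lact E B₂ = lact k C₁ := by
    rw [lact_vcell k]
    refine arr_injective (Eq.trans (Eq.symm ?_) (arr_comp_vcell_eq_ract (φ := k) (s := c.unit)
      (by simp) (arr_vcomp _ _ _ _).symm))
    refine arr_comp_vcell_eq_lact ?_ (arr_vcomp _ _ _ _).symm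
    rw [arr_vcomp, arr_vcomp, ← Category.assoc, ← Category.assoc, ← arr_unitCell_comp]
  have hCB : lact C₁ B₃ = unitCell _ := by
    refine lact_eq_unitCell_of_whisker (e := f ≫ T.ι C) (f := 𝟙 C) hlc (by simp) ?_ ?_
    · simp only [C₁, arr_vcomp, arr_pre, arr_unitCell_id, Category.comp_id, arr_unitCell_comp,
        Category.assoc]
    · rw [arr_vcomp, arr_vcomp, arr_pre, arr_unitCell_id, Category.comp_id]
  -- Both sides become `k` after precomposition with `s`: the first by the left unit coherence of
  -- `b`, the second by the unit axiom, interchange and the left unit coherence of `c`. Then `s` is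
  -- cancelled by means of `s'`.
  have hSR : lact A₁ k = lact (lact B₁ B₂) B₃ := by
    rw [← unitCell_lact (lact A₁ k), ← hs', ← lact_lact, lact_lact s, hsA, unitCell_lact,
      ← unitCell_lact (lact (lact B₁ B₂) B₃), ← hs', ← lact_lact s' s,
      lact_lact s (lact B₁ B₂), lact_lact s B₁, hsB, hEB, ← lact_lact, hCB, lact_vcell k,
      ract_unitCell]
  refine (arr_comp_lact ?_ ?_).trans ((congrArg arr hSR).trans (Eq.symm
    ((arr_comp_lact (arr_comp_lact ?_ ?_) ?_))))
  · rw [hA₁, arr_post]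
  · rw [arr_pre, hk, ← Category.assoc, ← arr_unitCell_comp, Category.assoc, T.ι_μ, Category.comp_id]
  · rw [arr_pre, arr_vcomp (unitCell _) k, hk, ← Category.assoc, ← arr_unitCell_comp,
      ← Category.assoc, ← arr_unitCell_comp, Category.assoc, Category.assoc, hb]
  · rw [arr_post, arr_vcomp k, hk, arr_unitCell_comp, arr_unitCell_comp, Category.assoc,
      ← Category.assoc (arr (unitCell (T.ι (T.obj B)))), T.arr_ι_mapV, Category.assoc,
          Category.assoc]
  · rw [arr_pre, arr_vcomp, arr_vcomp, ← Category.assoc, ← Category.assoc, ← arr_unitCell_comp,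
      ← arr_unitCell_comp, Category.assoc, ← hf', ← Category.assoc, ← hf]

/-- For a colax-idempotent 2-monad, each morphism of pseudo algebras admits a unique structure of
colax morphism. -/
theorem IsColaxIdempotent.existsUnique_isColaxMorphism (hT : T.IsColaxIdempotent)
    (b : T.PseudoAlgebra B) (c : T.PseudoAlgebra C) (f : B ⟶ C) :
    ∃! fbar : VCell (b.act ≫ f) (T.map f ≫ c.act), b.IsColaxMorphism c f fbar := by
  obtain ⟨adj, hadj⟩ := hT.exists_adjunction b
  -- Since the unit of `ι_B ⊣ b` is `b.unit`, the unit axiom says precisely that the structure cell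
  -- is the transpose of `c.unit` whiskered with `f`.
  obtain ⟨φ, hφ⟩ := adj.exists_transpose (f := f) (g := T.map f ≫ c.act)
    (vcomp (unitCell f) c.unit (Category.comp_id f)
      (by rw [← Category.assoc, T.ι_naturality, Category.assoc]))
  have hφ' : b.IsColaxMorphism c f φ := by
    refine hT.isColaxMorphism_of_unit b c (arr_injective ?_)
    refine Eq.trans ?_ ((congrArg arr hφ).trans ?_)
    · exact arr_lact_congr (by rw [arr_vcomp, arr_vcomp, hadj]) (by rw [arr_vcomp, arr_vcomp])
    · rw [arr_vcomp, arr_vcomp]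
  refine ⟨φ, hφ', fun ψ hψ => adj.pre_hom_ext rfl ?_⟩
  obtain ⟨u', -, hu⟩ := (VCell.isInvertible_iff _).1 b.unit_isInvertible
  have h := hψ.unit.trans hφ'.unit.symm
  rw [VCell.comp_eq_lact, VCell.comp_eq_lact] at h
  have hu' : lact (u'.post f (p := T.ι B ≫ b.act ≫ f) (q := f) (Category.assoc _ _ _)
      (Category.id_comp f)) (b.unit.post f (Category.id_comp f) (Category.assoc _ _ _)) =
      unitCell _ :=
    lact_eq_unitCell_of_whisker (e := 𝟙 _) (f := f) hu (by simp) (by simp [arr_post])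
      (by simp [arr_post])
  have h' := congrArg (lact (u'.post f (p := T.ι B ≫ b.act ≫ f) (q := f) (Category.assoc _ _ _)
    (Category.id_comp f))) h
  rw [lact_lact, lact_lact, hu', unitCell_lact, unitCell_lact] at h'
  simpa [arr_pre] using congrArg arr h'

end NormalLaxDoubleMonad

/-! ### Invertible vertical cells, and Kan extension along full and faithful morphisms. -/

namespace DoubleCategory

variable {K : Type u} [DoubleCategory.{w, x, v, u} K] {A B C X Y M P : K}

/-- Whiskering preserves invertibility of vertical cells. -/
theorem VCell.IsInvertible.post {f g : A ⟶ M} {s : VCell f g} (hs : s.IsInvertible) (e : M ⟶ X)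
    {p q : A ⟶ X} (hp : f ≫ e = p) (hq : g ≫ e = q) : (s.post e hp hq).IsInvertible := by
  obtain ⟨t, h₁, h₂⟩ := (VCell.isInvertible_iff _).1 hs
  refine (VCell.isInvertible_iff _).2 ⟨t.post e hq hp, ?_, ?_⟩
  · exact lact_eq_unitCell_of_whisker (e := 𝟙 _) (f := e) h₁ (by simp [hp]) (by simp [arr_post])
      (by simp [arr_post])
  · exact lact_eq_unitCell_of_whisker (e := 𝟙 _) (f := e) h₂ (by simp [hq]) (by simp [arr_post])
      (by simp [arr_post])

theorem VCell.IsInvertible.exists_inverse {f g : A ⟶ M} {s : VCell f g} (hs : s.IsInvertible) :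
    ∃ t : VCell g f, t.IsInvertible ∧ lact s t = unitCell f := by
  obtain ⟨t, h₁, h₂⟩ := (VCell.isInvertible_iff _).1 hs
  exact ⟨t, (VCell.isInvertible_iff _).2 ⟨s, h₂, h₁⟩, h₁⟩

theorem isInvertible_associator {D : K} (J : Hor A B) (H : Hor B C) (L : Hor C D) :
    HCell.IsInvertible (associator J H L) :=
  ⟨_, associator_associatorInv J H L, associatorInv_associator J H L⟩

theorem Companion.arr_opRestr_star {j : A ⟶ B} (c : Companion j) {J : Hor X A} {f : X ⟶ M}
    {g : A ⟶ M}
    {l : B ⟶ M} (φ : Cell J f g (unit M)) (ψ : Cell c.hor g l (unit M)) {p : A ⟶ M}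
    {s : VCell g p} (hs : arr c.opcart ≫ arr ψ = arr s) :
    arr (c.opRestr J) ≫ arr (star φ ψ) = arr (ract φ s) := by
  rw [Companion.opRestr, arr_vcomp, Category.assoc,
    arr_hcomp_star (φ' := φ) (ψ' := s) (by simp) hs, arr_ract]

/-- A pointwise left Kan extension, along a full and faithful morphism, of a morphism into the
target of a yoneda embedding is a genuine extension. -/
theorem IsYonedaEmbedding.isInvertible_opcart_comp [IsEquipment K] {y : M ⟶ P}
    (hy : IsYonedaEmbedding y) {d : A ⟶ P} {D : Hor M A} {δ : Cell D y d (unit P)}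
    (hδ : IsCartesian δ) {j : A ⟶ B} (c : Companion j) (hj : IsFullyFaithful j) {l : B ⟶ P}
    {η : Cell c.hor d l (unit P)} (hη : IsPointwiseLeftKan η) {p : A ⟶ P} {s : VCell d p}
    (hs : arr c.opcart ≫ arr η = arr s) : s.IsInvertible := by
  have h₁ : IsPointwiseLeftKan δ := hy.isPointwiseLeftKan _ _ _ hδ
  have h₂ : IsCartesian (star δ η) := (hy.isCartesian_iff _).2 (h₁.star_iff.2 hη)
  -- Restricting `D ⊙ j_* ⇒ 1_P` along the cartesian cell `D ⇒ D ⊙ j_*` gives `δ` followed by `s`.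
  -- Thus `s` compares two cartesian cells on `D`, both of which are Kan extensions.
  have h₃ : IsCartesian (ract δ s) :=
    (c.isCartesian_opRestr hj D).comp h₂ (c.arr_opRestr_star δ η hs)
  exact h₁.isLeftKan.isInvertible_of_ract (hy.isPointwiseLeftKan _ _ _ h₃).isLeftKan

end DoubleCategory

/-! ### Beck–Chevalley, Kan extensions and invertibility of the colax structure. -/

namespace NormalLaxDoubleMonad

variable {K : Type u} [DoubleCategory.{w, x, v, u} K] {T : NormalLaxDoubleMonad K}
variable {A B C M P : K}

/-- Up to the invertible unitor of `T`, the unit cell of `Tj` is the image of that of `j`, and `T`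
preserves cartesian cells into units. -/
theorem isFullyFaithful_map [IsEquipment K] {j : A ⟶ B} (hj : IsFullyFaithful j) :
    IsFullyFaithful (T.map j) := by
  have h : (T.unitor A : HCell _ _).IsInvertible :=
    (HCell.isInvertible_iff _).2 ⟨T.unitorInv A, by simp, by simp⟩
  refine h.isCartesian.comp (T.isCartesian_mapToUnit hj) ?_
  rw [← T.mapV_unitCell, arr_mapV_eq]

/-- The colax structure cell `l̄` of `l` is the comparison of `ι_P ∘ l` with its extension. -/
theorem PseudoAlgebra.IsColaxMorphism.ract_desc {b : T.PseudoAlgebra B} {w : T.PseudoAlgebra P}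
    {l : B ⟶ P} {lbar : VCell (b.act ≫ l) (T.map l ≫ w.act)} (h : b.IsColaxMorphism w l lbar)
    (cB : Companion (T.ι B)) :
    ract (cB.desc (vcomp b.unit (unitCell l) (Category.id_comp l) rfl) (q := b.act ≫ l)
      (Category.assoc _ _ _).symm) lbar = T.extUnit w.unit cB l := by
  have hu := h.unit
  rw [VCell.comp_eq_lact] at hu
  -- Compared on the opcartesian cell of `ι_{B*}`, the equation is the unit axiom of the colax
  -- morphism.
  refine cB.desc_hom_ext ?_
  rw [extUnit, Companion.arr_opcart_desc]
  refine (arr_comp_ract (φ' := vcomp b.unit (unitCell l) (Category.id_comp l) rfl)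
    (t' := lbar.pre (T.ι B) (q := l ≫ T.ι P ≫ w.act) (Category.assoc _ _ _).symm
      (by rw [← Category.assoc, ← T.ι_naturality, Category.assoc]))
    (cB.arr_opcart_desc _ _) (arr_pre _ _ _).symm).trans ?_
  rw [← lact_vcell]
  refine (arr_lact_congr ?_ ?_).trans ((congrArg arr hu).trans ?_)
  · rw [arr_vcomp, arr_post]
  · rw [arr_pre, arr_pre]
  · rw [arr_pre, arr_vcomp]

section

variable [IsEquipment K] {y : M ⟶ P} {d : A ⟶ P} {D : Hor M A}
  {δ : Cell D y d (unit P)} {j : A ⟶ B} {jStar : Companion j} {l : B ⟶ P}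
  {η : Cell jStar.hor d l (unit P)}
  {b : T.PseudoAlgebra B} {w : T.PseudoAlgebra P} {ιM : Companion (T.ι M)} {ιA : Companion (T.ι A)}
  {lbar : VCell (b.act ≫ l) (T.map l ≫ w.act)}

theorem IsColaxIdempotent.isCartesian_star_extUnit_mapAct (hT : T.IsColaxIdempotent)
    (hδ : IsCartesian δ) (w : T.PseudoAlgebra P) (ιM : Companion (T.ι M)) :
    IsCartesian (star (T.extUnit w.unit ιM y) (T.mapAct δ w.act)) := by
  obtain ⟨adj, hadj⟩ := hT.exists_adjunction w
  rw [← hadj]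
  exact isCartesian_star_extUnit adj hδ ιM

/-- The right Beck–Chevalley condition in terms of the cell `D ⊙ ι_{A*} ⇒ 1_P`. -/
theorem IsColaxIdempotent.rightBeckChevalley_iff (hT : T.IsColaxIdempotent)
    (hδ : IsCartesian δ) (w : T.PseudoAlgebra P) (ιM : Companion (T.ι M)) (ιA : Companion (T.ι A)) :
    T.RightBeckChevalley ιM ιA D ↔ IsCartesian (star δ (T.extUnit w.unit ιA d)) := by
  have h := hT.isCartesian_star_extUnit_mapAct hδ w ιM
  have e := T.arr_ιStar_extUnit w.unit ιM ιA δ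
  -- By `e` the cell `ι_{D*}` is the factorisation of `D ⊙ ι_{A*} ⇒ 1_P` through the cartesian cell
  -- `ι_{M*} ⊙ TD ⇒ 1_P`.
  exact ⟨fun hD => HCell.IsInvertible.isCartesian hD |>.comp h e, fun h' => h'.isInvertible h e⟩

/-- Both `l ∘ b` and `w ∘ Tl` become left Kan extensions of `d` along `j_* ⊙ ι_{B*}`, and `lbar` is
the comparison between them. -/
theorem IsColaxIdempotent.isInvertible_colax (hT : T.IsColaxIdempotent)
    (hy : IsYonedaEmbedding y) (hδ : IsCartesian δ) (hη : IsPointwiseLeftKan η)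
    (hl : b.IsColaxMorphism w l lbar) (hD : T.RightBeckChevalley ιM ιA D)
    (hK : IsLeftKan (T.mapAct η w.act)) : lbar.IsInvertible := by
  obtain ⟨adj, hadj⟩ := hT.exists_adjunction b
  obtain ⟨ιB⟩ := nonempty_companion (T.ι B)
  have h₁ := (hT.rightBeckChevalley_iff hδ w ιM ιA).1 hD
  -- `δ` is cancelled on the left by the pasting law; the Beck–Chevalley condition thus says that `w
  -- ∘ Td` extends `d` along `ι_{A*}`.
  have h₂ : IsPointwiseLeftKan (T.extUnit w.unit ιA d) :=
    (hy.isPointwiseLeftKan _ _ _ hδ).star_iff.1 ((hy.isCartesian_iff _).1 h₁)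
  have h₃ : IsLeftKan (star η (T.extUnit w.unit ιB l)) :=
    (h₂.star_isLeftKan hK).comp (T.isInvertible_ιStar_companion jStar ιA ιB)
      (T.arr_ιStar_extUnit w.unit ιA ιB η)
  rw [← hl.ract_desc ιB, star_ract] at h₃
  have h₄ := adj.isPointwiseLeftKan_desc ιB l
  rw [hadj] at h₄
  exact (hη.star_iff.2 h₄).isLeftKan.isInvertible_of_ract h₃

theorem IsColaxIdempotent.rightBeckChevalley_and_isPointwiseLeftKan (hT : T.IsColaxIdempotent)
    (hy : IsYonedaEmbedding y) (hδ : IsCartesian δ) (hη : IsPointwiseLeftKan η)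
    (hl : b.IsColaxMorphism w l lbar) (hj : IsFullyFaithful j) (hl' : lbar.IsInvertible) :
    T.RightBeckChevalley ιM ιA D ∧ IsPointwiseLeftKan (T.mapAct η w.act) := by
  obtain ⟨adj, hadj⟩ := hT.exists_adjunction b
  obtain ⟨ιB⟩ := nonempty_companion (T.ι B)
  have hδ' := hy.isPointwiseLeftKan _ _ _ hδ
  have h₁ := adj.isPointwiseLeftKan_desc ιB l
  rw [hadj] at h₁
  have h₂ : IsPointwiseLeftKan (star η (T.extUnit w.unit ιB l)) := by
    rw [← hl.ract_desc ιB]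
    exact hη.star_iff.2 (h₁.ract hl')
  have h₃ : IsPointwiseLeftKan (star (T.extUnit w.unit ιA d) (T.mapAct η w.act)) := by
    obtain ⟨ν, hν₁, hν₂⟩ := (HCell.isInvertible_iff _).1 (T.isInvertible_ιStar_companion jStar ιA
        ιB)
    refine h₂.comp (ν := ν) ((HCell.isInvertible_iff _).2 ⟨_, hν₂, hν₁⟩) ?_
    rw [← T.arr_ιStar_extUnit w.unit ιA ιB η, ← Category.assoc, hν₂, Category.id_comp]
  -- Prefixing `δ` gives a cell whose left side is the yoneda embedding, so that the pointwise Kan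
  -- property can be read as cartesianness.
  have h₄ : IsPointwiseLeftKan (star (star δ (T.extUnit w.unit ιA d)) (T.mapAct η w.act)) :=
    (hδ'.star_iff.2 h₃).comp (isInvertible_associator _ _ _) (arr_star_star _ _ _).symm
  let s : VCell d (j ≫ l) := vcomp jStar.opcart η (Category.id_comp d) rfl
  have hs : s.IsInvertible := hy.isInvertible_opcart_comp hδ jStar hj hη (arr_vcomp _ _ _ _).symm
  let t : VCell (T.map d ≫ w.act) (T.map (j ≫ l) ≫ w.act) := (T.mapV s).post w.act rfl rfl
  obtain ⟨t', ht', htt'⟩ := ((mapV_isInvertible T hs).post w.act rfl rfl :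
    t.IsInvertible).exists_inverse
  -- Restriction along the full and faithful `Tj` removes `T(j_*)` at the cost of the vertical cell
  -- `t`. It is invertible because `η` restricts along `j` to an invertible cell.
  have h₅ : IsCartesian (ract (star δ (T.extUnit w.unit ιA d)) t) := by
    refine ((T.mapCompanion jStar).isCartesian_opRestr (isFullyFaithful_map hj) _).comp
      ((hy.isCartesian_iff _).2 h₄) ((T.mapCompanion jStar).arr_opRestr_star _ _ ?_)
    change arr (vcomp (T.unitor A) (T.mapCell jStar.opcart) _ _) ≫ arr (T.mapAct η w.act) = _
    rw [arr_vcomp, arr_vcomp, arr_post, arr_mapV_eq,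
      ← T.arr_mapToUnit_comp (arr_vcomp jStar.opcart η (Category.id_comp d) rfl).symm]
    simp only [Category.assoc]
  have h₆ : IsCartesian (star δ (T.extUnit w.unit ιA d)) := by
    have := h₅.ract ht'
    rwa [ract_ract, htt', ract_unitCell] at this
  exact ⟨(hT.rightBeckChevalley_iff hδ w ιM ιA).2 h₆,
    (hδ'.star_iff.1 ((hy.isCartesian_iff _).1 h₆)).star_iff.1 h₃⟩

end

end NormalLaxDoubleMonad

theorem mainTheorem1 {K : Type u} [DoubleCategory.{w, x, v, u} K] [IsEquipment K]
    (T : NormalLaxDoubleMonad K) (hT : T.IsColaxIdempotent)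
    {M Mhat A B : K} (y : M ⟶ Mhat) (hy : IsYonedaEmbedding y)
    (d : A ⟶ Mhat) (D : Hor M A) (δ : Cell D y d (unit Mhat)) (hδ : IsCartesian δ)
    (j : A ⟶ B) (jStar : Companion j) (l : B ⟶ Mhat)
    (η : Cell jStar.hor d l (unit Mhat)) (hη : IsPointwiseLeftKan η)
    (b : T.PseudoAlgebra B) (w : T.PseudoAlgebra Mhat)
    (ιM : Companion (T.ι M)) (ιA : Companion (T.ι A)) :
    (∃! lbar : VCell (b.act ≫ l) (T.map l ≫ w.act), b.IsColaxMorphism w l lbar) ∧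
    ∀ lbar : VCell (b.act ≫ l) (T.map l ≫ w.act), b.IsColaxMorphism w l lbar →
      (T.RightBeckChevalley ιM ιA D ∧
          IsLeftKan (vcomp (T.mapToUnit η) (unitCell w.act) rfl rfl) →
        lbar.IsInvertible) ∧
      (IsFullyFaithful j → lbar.IsInvertible →
        T.RightBeckChevalley ιM ιA D ∧
          IsLeftKan (vcomp (T.mapToUnit η) (unitCell w.act) rfl rfl)) := by
  refine ⟨hT.existsUnique_isColaxMorphism b w l, fun lbar hl =>
    ⟨fun h => hT.isInvertible_colax hy hδ hη hl h.1 h.2, fun hj hl' => ?_⟩⟩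
  obtain ⟨h₁, h₂⟩ := hT.rightBeckChevalley_and_isPointwiseLeftKan (ιM := ιM) (ιA := ιA) hy hδ hη hl
    hj hl'
  exact ⟨h₁, h₂.isLeftKan⟩
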